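/- **Theorem.** There are absolute constants $\kappa>0$ and $C$ such that the following holds. Let $G$ be a finite simple graph with $m\ge 1$ edges, no isolated vertices and maximum degree $d$, and let $c$ be a partial edge-coloring of $G$ with the $d+1$ colors $\{1,\dots,d+1\}$ (some edges may be uncolored; no color occurs twice at a vertex). Let $\ell$ be the number of uncolored edges. Then, whatever choices are made where the procedure leaves a choice, every execution of the procedure Color-Many described below, started from $c$, finishes within $C\cdot m$ steps, and at its end the edges of $G$ carry a partial edge-coloring with the same $d+1$ colors for which the number of uncolored edges is at most $\ell-\kappa\,\ell/d$. Moreover, after Steps 1 and 2, also reached within $C\cdot m$ steps, the coloring is a partial edge-coloring, $|I_\alpha|=\max_\beta|I_\beta|$ for the initial coloring, and $\mathcal C$ is an $\alpha$-collection. *Notions.* $M(v)$ is the set of colors missing at $v$ (occurring on no edge at $v$), and $I_\beta$ is the set of vertices that are incident to an uncolored edge and miss $\beta$. A *c-fan* $(\alpha,v,x_0,\dots,x_k)$ has center $v$ with $\alpha\in M(v)$ and leaves $x_i$ that are neighbors of $v$, where $x_1,\dots,x_k$ are distinct, $vx_0$ is uncolored, and for $1\le i\le k$ the edge $vx_i$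 is colored with $c(vx_i)\in M(x_{i-1})$. It is *primed* by $\beta$ if $\beta\in M(x_k)$ and either $\beta\in M(v)$ or $c(vx_j)=\beta$ for some leaf $x_j$. *Shifting* it from $x_j$ gives $vx_{i-1}$ the color of $vx_i$ for $i=1,\dots,j$ and makes $vx_j$ uncolored. A *u-fan* $(\alpha,v,x_1,\dots,x_k)$, $k\ge2$, has a center $v$ with $\alpha\notin M(v)$ and distinct leaves $x_i$, all missing $\alpha$, with uncolored edges $vx_i$. An *$\alpha$-collection* is a set of vertex-disjoint primed c-fans and u-fans with first parameter $\alpha$. For $\alpha\ne\beta$, an *$\alpha\beta$-path* is a component that is a path (possibly a single vertex) of the subgraph of edges colored $\alpha$ or $\beta$; *flipping* it exchanges $\alpha$ and $\beta$ on it. *Steps.* Constant time is charged for each of: checking $\gamma\in M(v)$, getting a color of $M(v)$, reading the color of an edge, coloring or uncoloring an edge, finding the edge of color $\gamma$ at $v$, finding the fan that contains a vertex, testing a mark, adding or removing a leaf of a u-fan, checking whether a fan is damaged at a given vertex, and picking a fan of a set $Q_\beta$ below or detecting that it is empty. Scanning a list takes time proportional to its length; adding or discarding a fan takes time proportional to its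 size; setting up the sets $Q_\beta$ takes time proportional to the number of vertices plus the sum of the degrees of the centers of the fans. (The initial setup of the data structures that provide these operations is not counted.) *Color-Many.* Step 1. Count, for every color, its edges incident to vertices that have an uncolored edge, and thereby choose $\alpha$ with $|I_\alpha|$ maximal; form $I_\alpha$. Step 2 (Build-Collection). Let $\mathcal C=\emptyset$, $S=I_\alpha$. While $S\neq\emptyset$, remove some $v$ from $S$, choose an uncolored edge $vx_0$, let $F=(\alpha,v,x_0)$, and repeat, with $x_k$ the last leaf of $F$: (1) If $x_k$ lies in a fan $F'\in\mathcal C$, shift $F$ from $x_k$, discard $F$, and: if $F'$ is a c-fan with center $x_k$, color $vx_k$ by $\alpha$ and discard $F'$; if $F'$ is a c-fan with center $u$ and leaf $x_k$, shift $F'$ from $x_k$ and replace $F'$ in $\mathcal C$ by the u-fan with center $x_k$ and leaves $u,v$; if $F'$ is a u-fan with center $x_k$, add $v$ to its leaves; if $F'$ is a u-fan with leaf $x_k$, color $vx_k$ by $\alpha$, remove $x_k$ from $F'$, and discard $F'$ if fewer than two leaves remain. Go to the next $v$. (2) Otherwise, if $\alpha\in M(x_k)$, shift $F$ from $x_k$,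 color $vx_k$ by $\alpha$, discard $F$, remove $x_k$ from $S$, and go to the next $v$. (3) Otherwise take any $\beta\in M(x_k)$. If $\beta\in M(v)$, or if the neighbor $y$ with $c(vy)=\beta$ is already a leaf, prime $F$ by $\beta$, add it to $\mathcal C$, and go to the next $v$; else append $y$ to $F$ as $x_{k+1}$. Step 3 (Activate-Collection). For each color $\beta\neq\alpha$, in any order, perform a stage: while the set $Q_\beta$ of those c-fans of $\mathcal C$ that are primed by $\beta$ and those u-fans of $\mathcal C$ whose center misses $\beta$ is nonempty, pick $F\in Q_\beta$, with center $v$. If $F$ is a c-fan and $\beta\in M(v)$, shift $F$ from $x_k$ and color $vx_k$ by $\beta$. If $F$ is a c-fan and $c(vx_j)=\beta$, flip the $\alpha\beta$-path beginning at $v$ and let $w$ be its other end; let $x=x_{j-1}$ if $w\ne x_{j-1}$ and $x=x_k$ otherwise; shift $F$ from $x$ and color $vx$ by $\beta$. In both cases discard $F$. If $F$ is a u-fan, flip the $\alpha\beta$-path beginning at $v$, remove its other end from the leaves of $F$ if it is one, pick a remaining leaf $x$, color $vx$ by $\alpha$, remove $x$ from $F$, and discard $F$ if fewer than two leaves remain.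 Then call Disconnect-Vertex$(v)$: let $P$ be the $\alpha\beta$-path containing $v$. While an end of $P$ lies in a fan of $\mathcal C$, let $e_1,e_2$ be the ends of $P$; let $w=e_1$ if $e_2$ is in no fan of $\mathcal C$ or $e_1$ is a damaged vertex of its fan (a requirement on $M(e_1)$ in the definition of a primed c-fan, respectively u-fan, fails), and $w=e_2$ otherwise; let $F'$ be the fan containing $w$. If $F'$ is a c-fan or has only two leaves, discard $F'$. Otherwise, if $w$ is a leaf of $F'$, remove it from $F'$. Otherwise $w$ is the center: choose a leaf $x$ of $F'$ not on $P$ and remove it from $F'$; if $\alpha\in M(w)$, color $wx$ by $\alpha$, else flip the $\alpha\beta$-path that begins at $x$ and color $wx$ by $\beta$; extend $P$ along the $\alpha\beta$-path through $wx$. -/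

import Mathlib

noncomputable section

namespace EdgeColoring

/-! ## Nondeterministic programs with a step budget

A program is started with a number of available time units and a memory state. Every elementary
operation uses up one time unit; a program that runs out of time, or that attempts an illegal
operation, is aborted. All the arbitrary choices of the algorithm ("pick any") are
nondeterministic, so a program has a nonempty set of possible outcomes. -/

/-- The result of one execution: it finishes (with a returned value, the time that is left and the
final memory state), or it is aborted. -/
inductive Outcome (σ α : Type) : Type
  | finished (value : α) (timeLeft : ℕ) (state : σ)
  | aborted

/-- A program: for a time budget and an initial state, the nonempty set of its outcomes. -/
def Prog (σ α : Type) : Type := ℕ → σ → {R : Set (Outcome σ α) // R.Nonempty}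

namespace Prog

variable {σ α β γ : Type}

/-- The set of outcomes of `p` when it is started in state `s` with `t` time units. -/
def outcomes (p : Prog σ α) (t : ℕ) (s : σ) : Set (Outcome σ α) := (p t s).1

def ret (a : α) : Prog σ α := fun t s => ⟨{.finished a t s}, Set.singleton_nonempty _⟩

def abort : Prog σ α := fun _ _ => ⟨{.aborted}, Set.singleton_nonempty _⟩

/-- Sequential composition. -/
def seq (p : Prog σ α) (f : α → Prog σ β) : Prog σ β := fun t s =>
  ⟨{o | (.aborted ∈ p.outcomes t s ∧ o = .aborted) ∨
      ∃ a t' s', .finished a t' s' ∈ p.outcomes t s ∧ o ∈ (f a).outcomes t' s'}, by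
    obtain ⟨o, ho⟩ := (p t s).2
    cases o with
    | aborted => exact ⟨.aborted, Or.inl ⟨ho, rfl⟩⟩
    | finished a t' s' =>
      obtain ⟨o', ho'⟩ := (f a t' s').2
      exact ⟨o', Or.inr ⟨a, t', s', ho, ho'⟩⟩⟩

instance : Monad (Prog σ) where
  pure := ret
  bind := seq

/-- Use up `k` time units. -/
def spend (k : ℕ) : Prog σ Unit := fun t s =>
  if k ≤ t then ret () (t - k) s else abort t s

/-- Use up one time unit. -/
def tick : Prog σ Unit := spend 1

def getState : Prog σ σ := fun t s => ret s t s

def setState (s' : σ) : Prog σ Unit := fun t _ => ret () t s'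

open Classical in
/-- Pick an arbitrary element of `A`; abort if there is none. -/
def pick (A : Set α) : Prog σ α := fun t s =>
  if h : A.Nonempty then ⟨(fun a => .finished a t s) '' A, h.image _⟩ else abort t s

/-- At most `n` iterations of a loop. -/
def iter (body : β → Prog σ (β ⊕ γ)) : ℕ → β → Prog σ γ
  | 0, _ => abort
  | n + 1, b => do
    tick
    match ← body b with
    | .inl b' => iter body n b'
    | .inr c => pure c

/-- Repeat `body` until it returns a value in the right summand. Every iteration uses at least one
time unit, so the bound `t + 1` on the number of iterations is no restriction beyond the time
budget `t` itself. -/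
def loop (body : β → Prog σ (β ⊕ γ)) (b : β) : Prog σ γ := fun t s => iter body (t + 1) b t s

/-- Run through the list `l`, updating a local variable. -/
def forList : List α → β → (β → α → Prog σ β) → Prog σ β
  | [], b, _ => pure b
  | a :: l, b, f => do
    tick
    let b' ← f b a
    forList l b' f

end Prog

open Prog

/-! ## Colorings and fans -/

section Notions

variable {V : Type} {d : ℕ}

/-- `c` is a partial `(d+1)`-edge-coloring of `G`: only edges of `G` may be colored (`none` means
uncolored), and no color is repeated at a vertex. -/
structure IsPartialEdgeColoring (G : SimpleGraph V) (c : Sym2 V → Option (Fin (d + 1))) : Prop where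
  eq_none : ∀ e, e ∉ G.edgeSet → c e = none
  proper : ∀ v u w γ, c s(v, u) = some γ → c s(v, w) = some γ → u = w

/-- The set of uncolored edges. -/
def uncoloredEdges (G : SimpleGraph V) (c : Sym2 V → Option (Fin (d + 1))) : Set (Sym2 V) :=
  {e | e ∈ G.edgeSet ∧ c e = none}

/-- `M(v)`: the colors that no edge at `v` has. -/
def missing (c : Sym2 V → Option (Fin (d + 1))) (v : V) : Set (Fin (d + 1)) :=
  {γ | ∀ u, c s(v, u) ≠ some γ}

/-- `I_β`: the vertices that are incident to an uncolored edge and at which `β` is missing. -/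
def incompleteMissing (G : SimpleGraph V) (c : Sym2 V → Option (Fin (d + 1))) (β : Fin (d + 1)) :
    Set V :=
  {v | (∃ u, G.Adj v u ∧ c s(v, u) = none) ∧ β ∈ missing c v}

/-- The records for fans. The first parameter `α` of a fan is common to all the fans of a
collection and is not stored. -/
inductive Fan (V : Type) (d : ℕ) : Type
  /-- A c-fan with its center, its leaves `x₀, …, x_k` and the color that primes it. -/
  | cfan (center : V) (leaves : List V) (prime : Fin (d + 1))
  /-- A u-fan with its center and its leaves. -/
  | ufan (center : V) (leaves : Finset V)

def Fan.center : Fan V d → V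
  | .cfan v _ _ => v
  | .ufan v _ => v

def Fan.verts : Fan V d → Set V
  | .cfan v xs _ => insert v {x | x ∈ xs}
  | .ufan v L => insert v (L : Set V)

/-- The length of the record. -/
def Fan.size : Fan V d → ℕ
  | .cfan _ xs _ => xs.length + 1
  | .ufan _ L => L.card + 1

/-- `(α, v, x₀, …, x_k)` is a c-fan. -/
def IsCFan (G : SimpleGraph V) (c : Sym2 V → Option (Fin (d + 1))) (α : Fin (d + 1)) (v : V)
    (xs : List V) : Prop :=
  α ∈ missing c v ∧ (∀ x ∈ xs, G.Adj v x) ∧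
  (∃ x₀ ys, xs = x₀ :: ys ∧ ys.Nodup ∧ c s(v, x₀) = none) ∧
  xs.IsChain (fun x y => ∃ γ, c s(v, y) = some γ ∧ γ ∈ missing c x)

/-- The c-fan `(α, v, x₀, …, x_k)` is primed by `β`. -/
def IsPrimedCFan (G : SimpleGraph V) (c : Sym2 V → Option (Fin (d + 1))) (α : Fin (d + 1)) (v : V)
    (xs : List V) (β : Fin (d + 1)) : Prop :=
  IsCFan G c α v xs ∧ (∃ xk ∈ xs.getLast?, β ∈ missing c xk) ∧
  (β ∈ missing c v ∨ ∃ x ∈ xs, c s(v, x) = some β)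

/-- `(α, v, x₁, …, x_k)` is a (nondegenerate) u-fan with set of leaves `L`. -/
def IsUFan (G : SimpleGraph V) (c : Sym2 V → Option (Fin (d + 1))) (α : Fin (d + 1)) (v : V)
    (L : Finset V) : Prop :=
  2 ≤ L.card ∧ (∀ x ∈ L, G.Adj v x ∧ c s(v, x) = none ∧ α ∈ missing c x) ∧ α ∉ missing c v

/-- `coll` is an `α`-collection: a set of vertex-disjoint primed c-fans and u-fans. -/
def IsCollection (G : SimpleGraph V) (c : Sym2 V → Option (Fin (d + 1))) (α : Fin (d + 1))
    (coll : Set (Fan V d)) : Prop :=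
  coll.PairwiseDisjoint Fan.verts ∧
  ∀ F ∈ coll, match F with
    | .cfan v xs β => IsPrimedCFan G c α v xs β
    | .ufan v L => IsUFan G c α v L

/-- `w` is a damaged vertex of the fan: one of the requirements on `M(w)` in the definition of a
primed c-fan or of a u-fan with first parameter `α` fails. -/
def Fan.DamagedAt (c : Sym2 V → Option (Fin (d + 1))) (α : Fin (d + 1)) (w : V) : Fan V d → Prop
  | .cfan v xs β =>
      (w = v ∧ ¬ (α ∈ missing c v ∧ (β ∈ missing c v ∨ ∃ x ∈ xs, c s(v, x) = some β))) ∨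
      (∃ pre y post, xs = pre ++ w :: y :: post ∧
        ¬ ∃ γ, c s(v, y) = some γ ∧ γ ∈ missing c w) ∨
      (xs.getLast? = some w ∧ β ∉ missing c w)
  | .ufan v L => (w = v ∧ α ∈ missing c v) ∨ (w ∈ L ∧ α ∉ missing c w)

/-- The memory: the color fields of the edges, the current collection of fans, and the set `S` of
vertices around which a fan has still to be built. -/
structure State (V : Type) (d : ℕ) : Type where
  color : Sym2 V → Option (Fin (d + 1))
  coll : Set (Fan V d)
  pending : Set V

end Notions

/-! ## Elementary operations -/

section Operations

variable {V : Type} {d : ℕ}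

/-- Read the color field of the edge `uw`. -/
def readColor (u w : V) : Prog (State V d) (Option (Fin (d + 1))) := do
  tick
  return (← getState).color s(u, w)

open Classical in
/-- Check whether `γ ∈ M(v)`. -/
def isMissing (γ : Fin (d + 1)) (v : V) : Prog (State V d) Bool := do
  tick
  return decide (γ ∈ missing (← getState).color v)

/-- Get some color in `M(v)`. -/
def someMissing (v : V) : Prog (State V d) (Fin (d + 1)) := do
  tick
  pick (missing (← getState).color v)

open Classical in
/-- Find the edge `vw` with color `γ` at `v`, and return `w`, or `none` if there is no such edge. -/
def lookup (v : V) (γ : Fin (d + 1)) : Prog (State V d) (Option V) := do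
  tick
  let s ← getState
  if ∃ w, s.color s(v, w) = some γ then
    let w ← pick {w | s.color s(v, w) = some γ}
    return some w
  else
    return none

open Classical in
/-- Color the edge `uw` by `γ`. This is legal only if `uw` is an uncolored edge and `γ` is missing
at both of its ends. -/
def colorEdge (G : SimpleGraph V) (u w : V) (γ : Fin (d + 1)) : Prog (State V d) Unit := do
  tick
  let s ← getState
  if G.Adj u w ∧ s.color s(u, w) = none ∧ γ ∈ missing s.color u ∧ γ ∈ missing s.color w then
    setState { s with color := Function.update s.color s(u, w) (some γ) }
  else
    abort

open Classical in
/-- Uncolor the edge `uw`. -/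
def uncolorEdge (u w : V) : Prog (State V d) Unit := do
  tick
  let s ← getState
  setState { s with color := Function.update s.color s(u, w) none }

/-- Find the fan of the collection that contains `x`, if any. -/
def fanContaining (x : V) : Prog (State V d) (Option (Fan V d)) := do
  tick
  let s ← getState
  pick {o | match o with
    | some F => F ∈ s.coll ∧ x ∈ F.verts
    | none => ∀ F ∈ s.coll, x ∉ F.verts}

/-- Add a fan to the collection, in time proportional to its size. -/
def addFan (F : Fan V d) : Prog (State V d) Unit := do
  spend F.size
  let s ← getState
  setState { s with coll := insert F s.coll }

/-- Discard a fan of the collection, in time proportional to its size. -/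
def removeFan (F : Fan V d) : Prog (State V d) Unit := do
  spend F.size
  let s ← getState
  setState { s with coll := s.coll \ {F} }

/-- Add one leaf to a u-fan `(α, v, L)` of the collection with at least two leaves, or remove at
most two leaves from it: the set `L` of leaves becomes `L'`. -/
def changeLeaves (v : V) (L L' : Finset V) : Prog (State V d) Unit := do
  spend 2
  let s ← getState
  setState { s with coll := insert (.ufan v L') (s.coll \ {.ufan v L}) }

/-- Remove `x` from the set `S` of pending vertices. -/
def removePending (x : V) : Prog (State V d) Unit := do
  tick
  let s ← getState
  setState { s with pending := s.pending \ {x} }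

open Classical in
/-- Remove an arbitrary vertex from `S` and return it; return `none` if `S` is empty. -/
def takePending : Prog (State V d) (Option V) := do
  tick
  let s ← getState
  if s.pending.Nonempty then
    let v ← pick s.pending
    setState { s with pending := s.pending \ {v} }
    return some v
  else
    return none

open Classical in
/-- Check whether `w` is a damaged vertex of the fan `F`. Only `M(w)`, and the color of one edge
from the center of `F` to the leaf after `w`, respectively the edge at `w` with the priming color,
need to be looked at. -/
def isDamagedAt (α : Fin (d + 1)) (w : V) (F : Fan V d) : Prog (State V d) Bool := do
  tick
  return decide (F.DamagedAt (← getState).color α w)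

/-- The set `Q` of a stage: the fans of the collection that are c-fans primed by `β` or u-fans with
`β` missing at the center. -/
def stageFans (s : State V d) (β : Fin (d + 1)) : Set (Fan V d) :=
  {F | F ∈ s.coll ∧ match F with
    | .cfan _ _ β' => β' = β
    | .ufan v _ => β ∈ missing s.color v}

open Classical in
/-- Pick an arbitrary fan of the set `Q` for `β`; return `none` if this set is empty. The sets `Q`
are kept up to date with constant overhead when edges are colored and uncolored. -/
def pickStageFan (β : Fin (d + 1)) : Prog (State V d) (Option (Fan V d)) := do
  tick
  let s ← getState
  if (stageFans s β).Nonempty then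
    let F ← pick (stageFans s β)
    return some F
  else
    return none

end Operations

/-! ## Shifting fans and flipping alternating paths -/

section Paths

variable {V : Type} [DecidableEq V] {d : ℕ}

/-- Shift the c-fan with center `v` and leaves given by the list from its leaf `z`. -/
def shift (G : SimpleGraph V) (v : V) : List V → V → Prog (State V d) Unit
  | x :: y :: xs, z => do
    tick
    if x = z then
      pure ()
    else
      match ← readColor v y with
      | none => abort
      | some β =>
        uncolorEdge v y
        colorEdge G v x β
        shift G v (y :: xs) z
  | _, _ => pure ()

/-- Follow the edges with alternating colors `γ, δ, γ, …` from `v` as far as possible. Returns the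
list of visited vertices, and the last one. -/
def walk (v : V) (γ δ : Fin (d + 1)) : Prog (State V d) (List V × V) :=
  loop (fun (p : List V × V × Fin (d + 1) × Fin (d + 1)) => do
    let (visited, u, γ', δ') := p
    match ← lookup u γ' with
    | none => return .inr (visited, u)
    | some w => return .inl (visited ++ [w], w, δ', γ')) ([v], v, γ, δ)

/-- Uncolor the edges of a path. -/
def uncolorPath : List V → Prog (State V d) Unit
  | u :: w :: p => do
    uncolorEdge u w
    uncolorPath (w :: p)
  | _ => pure ()

/-- Color the edges of a path alternately by `γ, δ, γ, …`. -/
def colorPath (G : SimpleGraph V) (γ δ : Fin (d + 1)) : List V → Prog (State V d) Unit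
  | u :: w :: p => do
    colorEdge G u w γ
    colorPath G δ γ (w :: p)
  | _ => pure ()

/-- Flip the `αβ`-path that begins at `v`, where `α` or `β` is missing at `v`. Returns the other
end of the path. -/
def flipPath (G : SimpleGraph V) (α β : Fin (d + 1)) (v : V) : Prog (State V d) V := do
  let (γ, δ) := if ← isMissing α v then (β, α) else (α, β)
  let (p, w) ← walk v γ δ
  uncolorPath p
  colorPath G δ γ p
  return w

/-- The leaf that precedes `y` in a list of leaves. -/
def leafBefore (y : V) : List V → Prog (State V d) (Option V)
  | x :: x' :: xs => do
    tick
    if x' = y then return some x else leafBefore y (x' :: xs)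
  | _ => return none

end Paths

/-! ## Step 1: choosing the color -/

section Choose

variable {V : Type} [Fintype V] {d : ℕ}

/-- The list of vertices. -/
def vertexList (V : Type) [Fintype V] : List V := (Finset.univ : Finset V).toList

/-- The list of neighbors of `v` (that is, of edges incident to `v`). -/
def neighborList (G : SimpleGraph V) [DecidableRel G.Adj] (v : V) : List V :=
  (G.neighborFinset v).toList

open Classical in
/-- Find the set of vertices that are incident to an uncolored edge. -/
def findIncomplete (G : SimpleGraph V) [DecidableRel G.Adj] : Prog (State V d) (Set V) :=
  forList (vertexList V) ∅ (fun I v =>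
    forList (neighborList G v) I (fun I' u => do
      match ← readColor v u with
      | none => return insert v I'
      | some _ => return I'))

open Classical in
/-- For each color, count the edges of this color that are incident to a vertex in `I` (edges with
both ends in `I` are counted twice). -/
def countColors (G : SimpleGraph V) [DecidableRel G.Adj] (I : Set V) :
    Prog (State V d) (Fin (d + 1) → ℕ) :=
  forList (vertexList V) (fun _ => 0) (fun cnt v =>
    if v ∈ I then
      forList (neighborList G v) cnt (fun cnt' u => do
        match ← readColor v u with
        | none => return cnt'
        | some γ => return Function.update cnt' γ (cnt' γ + 1))
    else
      return cnt)

open Classical in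
/-- Choose a color `α` with lowest count (ties are broken arbitrarily), that is, with `|I_α|`
largest, and return it with the set `I_α`. -/
def chooseColor (G : SimpleGraph V) [DecidableRel G.Adj] :
    Prog (State V d) (Fin (d + 1) × Set V) := do
  let I ← findIncomplete G
  let cnt ← countColors G I
  let α ← forList (List.finRange (d + 1)) 0 (fun best γ =>
    if cnt γ < cnt best then return γ
    else if cnt γ = cnt best then pick {best, γ}
    else return best)
  let Iα ← forList (vertexList V) ∅ (fun J v => do
    if v ∈ I then
      if ← isMissing α v then return insert v J else return J
    else return J)
  return (α, Iα)

end Choose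

/-! ## Step 2: building the collection -/

section Build

variable {V : Type} [Fintype V] [DecidableEq V] {d : ℕ}

/-- Merge the c-fan `(α, v, xs)`, whose last leaf is `x`, with the fan `F` of the collection that
contains `x`. -/
def mergeFans (G : SimpleGraph V) (α : Fin (d + 1)) (v : V) (xs : List V) (x : V) (F : Fan V d) :
    Prog (State V d) Unit := do
  shift G v xs x
  match F with
  | .cfan u ys β =>
    if x = u then
      colorEdge G v x α
      removeFan (.cfan u ys β)
    else
      shift G u ys x
      removeFan (.cfan u ys β)
      addFan (.ufan x {u, v})
  | .ufan u L =>
    if x = u then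
      changeLeaves u L (insert v L)
    else
      colorEdge G v x α
      if (L.erase x).card < 2 then
        removeFan (.ufan u L)
      else
        changeLeaves u L (L.erase x)

/-- Attempt to build a primed c-fan centered at `v` that starts with the uncolored edge `vx₀`. The
loop variable consists of the leaves `x₀, …, x_{k-1}` and the last leaf `x_k`. (The test whether
`y` is a leaf already takes constant time as the leaves are marked.) -/
def makeCollectionFan (G : SimpleGraph V) (α : Fin (d + 1)) (v x₀ : V) : Prog (State V d) Unit :=
  loop (fun (p : List V × V) => do
    let (pre, x) := p
    let xs := pre ++ [x]
    match ← fanContaining x with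
    | some F =>
      mergeFans G α v xs x F
      return .inr ()
    | none =>
      if ← isMissing α x then
        shift G v xs x
        colorEdge G v x α
        removePending x
        return .inr ()
      else
        let β ← someMissing x
        if ← isMissing β v then
          addFan (.cfan v xs β)
          return .inr ()
        else
          match ← lookup v β with
          | none => abort
          | some y =>
            tick
            if y ∈ xs then
              addFan (.cfan v xs β)
              return .inr ()
            else
              return .inl (xs, y)) ([], x₀)

/-- Search the edges at `v` for an uncolored edge `vx`, and return `x`. -/
def uncoloredNeighbor (G : SimpleGraph V) [DecidableRel G.Adj] (v : V) : Prog (State V d) V := do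
  spend (G.degree v)
  let s ← getState
  pick {x | G.Adj v x ∧ s.color s(v, x) = none}

/-- Build an `α`-collection from the set `Iα`. -/
def buildCollection (G : SimpleGraph V) [DecidableRel G.Adj] (α : Fin (d + 1)) (Iα : Set V) :
    Prog (State V d) Unit := do
  let s ← getState
  setState { s with coll := ∅, pending := Iα }
  loop (fun (_ : Unit) => do
    match ← takePending with
    | none => return .inr ()
    | some v =>
      let x₀ ← uncoloredNeighbor G v
      makeCollectionFan G α v x₀
      return .inl ()) ()

end Build

/-! ## Step 3: activating the collection -/

section Activate

variable {V : Type} [Fintype V] [DecidableEq V] {d : ℕ}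

/-- Activate the c-fan `(α, v, xs)` primed by `β`. -/
def activateCFan (G : SimpleGraph V) (α : Fin (d + 1)) (v : V) (xs : List V) (β : Fin (d + 1)) :
    Prog (State V d) Unit := do
  match xs.getLast? with
  | none => abort
  | some xk =>
    if ← isMissing β v then
      shift G v xs xk
      colorEdge G v xk β
    else
      match ← lookup v β with
      | none => abort
      | some xj =>
        match ← leafBefore xj xs with
        | none => abort
        | some y =>
          let w ← flipPath G α β v
          if w ≠ y then
            shift G v xs y
            colorEdge G v y β
          else
            shift G v xs xk
            colorEdge G v xk β

/-- Activate the u-fan `(α, v, L)` with the color `β` missing at `v`. Returns the new set of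
leaves. -/
def activateUFan (G : SimpleGraph V) (α : Fin (d + 1)) (v : V) (L : Finset V) (β : Fin (d + 1)) :
    Prog (State V d) (Finset V) := do
  let w ← flipPath G α β v
  let L' := L.erase w
  let x ← pick {x | x ∈ L'}
  colorEdge G v x α
  return L'.erase x

open Classical in
/-- One iteration of the loop of `disconnectVertex`, for the end `w` of the current `αβ`-path, which
lies in the fan `F`. The set `P` consists of the vertices of the path; it is kept by marks at the
vertices. Returns the new end of the path on the side of `w`, and the new set of its vertices. -/
def disconnectStep (G : SimpleGraph V) (α β : Fin (d + 1)) (w : V) (F : Fan V d) (P : Set V) :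
    Prog (State V d) (V × Set V) := do
  match F with
  | .cfan u ys β' =>
    removeFan (.cfan u ys β')
    return (w, P)
  | .ufan u L =>
    if L.card ≤ 2 then
      removeFan (.ufan u L)
      return (w, P)
    else if w ≠ u then
      changeLeaves u L (L.erase w)
      return (w, P)
    else
      let x' ← pick {x | x ∈ L}
      let x ← (if x' ∈ P then pick {x | x ∈ L.erase x'} else pure x')
      changeLeaves u L (L.erase x)
      if ← isMissing α w then
        colorEdge G w x α
        let (p, e) ← walk x β α
        return (e, P ∪ {y | y ∈ p})
      else
        let _ ← flipPath G α β x
        colorEdge G w x β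
        let (p, e) ← walk x α β
        return (e, P ∪ {y | y ∈ p})

/-- Explore the `αβ`-path containing `v`, until neither of its ends lies in a fan of the
collection. -/
def disconnectVertex (G : SimpleGraph V) (α β : Fin (d + 1)) (v : V) : Prog (State V d) Unit := do
  let (p₁, a₁) ← walk v α β
  let (p₂, a₂) ← walk v β α
  loop (fun (q : V × V × Set V) => do
    let (e₁, e₂, P) := q
    let o₁ ← fanContaining e₁
    let o₂ ← fanContaining e₂
    match o₁, o₂ with
    | none, none => return .inr ()
    | some F₁, none =>
      let (e, P') ← disconnectStep G α β e₁ F₁ P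
      return .inl (e, e₂, P')
    | none, some F₂ =>
      let (e, P') ← disconnectStep G α β e₂ F₂ P
      return .inl (e₁, e, P')
    | some F₁, some F₂ =>
      if ← isDamagedAt α e₁ F₁ then
        let (e, P') ← disconnectStep G α β e₁ F₁ P
        return .inl (e, e₂, P')
      else
        let (e, P') ← disconnectStep G α β e₂ F₂ P
        return .inl (e₁, e, P')) (a₁, a₂, {y | y ∈ p₁} ∪ {y | y ∈ p₂})

/-- Set up the sets `Q` for all the stages: for every fan of the collection, time proportional to
the degree of its center is spent. -/
def setUpStages (G : SimpleGraph V) [DecidableRel G.Adj] : Prog (State V d) Unit :=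
  forList (vertexList V) () (fun _ v => do
    match ← fanContaining v with
    | none => return ()
    | some F => if F.center = v then spend (G.degree v + 1) else return ())

/-- Stage `β`: activate fans of the set `Q` for `β` until this set is empty. -/
def activationStage (G : SimpleGraph V) (α β : Fin (d + 1)) : Prog (State V d) Unit :=
  loop (fun (_ : Unit) => do
    match ← pickStageFan β with
    | none => return .inr ()
    | some (.cfan v xs β') =>
      activateCFan G α v xs β'
      removeFan (.cfan v xs β')
      disconnectVertex G α β v
      return .inl ()
    | some (.ufan v L) =>
      let L' ← activateUFan G α v L β
      if L'.card < 2 then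
        removeFan (.ufan v L)
      else
        changeLeaves v L L'
      disconnectVertex G α β v
      return .inl ()) ()

/-- Activate the `α`-collection, in one stage for each color other than `α`, the colors being in an
arbitrary order. -/
def activateCollection (G : SimpleGraph V) [DecidableRel G.Adj] (α : Fin (d + 1)) :
    Prog (State V d) Unit := do
  setUpStages G
  let stages ← pick {l : List (Fin (d + 1)) | l.Nodup ∧ ∀ γ, γ ∈ l ↔ γ ≠ α}
  forList stages () (fun _ β => activationStage G α β)

/-- Steps 1 and 2 of Color-Many. Returns the chosen color `α`. -/
def chooseAndBuild (G : SimpleGraph V) [DecidableRel G.Adj] :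
    Prog (State V d) (Fin (d + 1)) := do
  let (α, Iα) ← chooseColor G
  buildCollection G α Iα
  return α

/-- Color-Many. -/
def colorMany (G : SimpleGraph V) [DecidableRel G.Adj] : Prog (State V d) Unit := do
  let α ← chooseAndBuild G
  activateCollection G α

end Activate

end EdgeColoring

end

/-! The gain comes from an amortized count. Since there are `d + 1` colors, at each vertex more
colors are missing than edges are uncolored. Summing `|I_β|` over all `β` therefore gives at least
the number `ℓ` of uncolored edges, so `(d + 1) |I_α| ≥ ℓ` for the chosen `α`
(`ncard_uncoloredEdges_le_sum`), and it remains to color at least `|I_α| / 7` edges. Put a token on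
the center of every c-fan and on every leaf of every u-fan (`tok`). Each vertex taken from `I_α` in
Step 2 yields a new token, or else an edge is colored and at most two other tokens or pending
vertices are lost (`wp_mergeFans`, `wp_makeCollectionFan`). In Step 3 an activation colors an edge
and costs its own fan at most three tokens. The subsequent Disconnect-Vertex costs at most two
tokens net for each of the two ends of its path, because the case that moves an end also colors an
edge (`reserve`, `wp_disconnectStep`). Seven tokens per colored edge thus suffice. After all stages
no token is left: the color priming a c-fan has been used, and the center of a u-fan, having degree
at most `d`, misses some color.

The procedure stays legal because inner vertices of an `αβ`-path have both colors. A flip therefore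
changes the missing colors only at the ends, and a fan not containing the start is damaged at most
at the far end (`Fan.Good.weak_flipOn`). Shifts and single colorings touch only the fan that is
being treated, and fans are vertex-disjoint. Disconnect-Vertex keeps at most one end damaged and
stops when no end lies in a fan. All fans are then intact, and every explored fan vertex has both
`α` and `β` (`StageInv`).

This last property also controls the time. A path that starts at a fan vertex missing `α` or `β`
starts outside the explored set, which is a union of components, so the whole path is unexplored.
All its vertices except possibly its two ends are incident to color `β`, so a stage costs a multiple
of the number of vertices with `β`, plus an amount paid by the vertices leaving the fans
(`potential`). A stage for one color does not change the size of any color class other than `α` and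
`β` (`SameCounts`). Hence the stage for `β` costs in proportion to the size of the `β`-class when
Step 3 begins, and these classes have at most `m` edges together.

Programs are treated by a calculus of weakest preconditions `wp` for total correctness: a statement
`wp p t s Q` excludes illegal operations and exhaustion of the budget, for all nondeterministic
choices at once. -/

noncomputable section

namespace EdgeColoring
open Prog

/-! ### Total correctness of nondeterministic programs with a time budget -/

section WeakestPrecondition

variable {σ α β γ : Type}

/-- Every execution of `p` with `t` time units from `s` finishes, does not increase the time that is
left, and satisfies the postcondition `Q`. -/
def wp (p : Prog σ α) (t : ℕ) (s : σ) (Q : α → ℕ → σ → Prop) : Prop :=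
  ∀ o ∈ p.outcomes t s, ∃ a t' s', o = .finished a t' s' ∧ t' ≤ t ∧ Q a t' s'

variable {t : ℕ} {s : σ}

theorem wp_mono {p : Prog σ α} {Q Q' : α → ℕ → σ → Prop} (h : wp p t s Q)
    (hQ : ∀ a t' s', t' ≤ t → Q a t' s' → Q' a t' s') : wp p t s Q' := by
  intro o ho
  obtain ⟨a, t', s', rfl, ht, hq⟩ := h o ho
  exact ⟨a, t', s', rfl, ht, hQ _ _ _ ht hq⟩

theorem wp_pure {a : α} {Q : α → ℕ → σ → Prop} (h : Q a t s) :
    wp (pure a : Prog σ α) t s Q := by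
  intro o ho
  cases ho
  exact ⟨a, t, s, rfl, le_rfl, h⟩

theorem wp_bind {p : Prog σ α} {f : α → Prog σ β} {Q : β → ℕ → σ → Prop}
    (h : wp p t s (fun a t' s' => wp (f a) t' s' Q)) : wp (p >>= f) t s Q := by
  rintro o (⟨ho, rfl⟩ | ⟨a, t', s', ho, ho'⟩)
  · obtain ⟨_, _, _, h', _⟩ := h _ ho
    cases h'
  · obtain ⟨_, _, _, h', ht, hq⟩ := h _ ho
    cases h'
    obtain ⟨b, t'', s'', rfl, ht', hq'⟩ := hq _ ho'
    exact ⟨b, t'', s'', rfl, ht'.trans ht, hq'⟩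

theorem wp_spend {k : ℕ} {Q : Unit → ℕ → σ → Prop} (hk : k ≤ t) (h : Q () (t - k) s) :
    wp (spend k) t s Q := by
  intro o ho
  simp only [outcomes, spend, hk, if_true] at ho
  cases ho
  exact ⟨_, _, _, rfl, Nat.sub_le _ _, h⟩

theorem wp_tick {Q : Unit → ℕ → σ → Prop} (hk : 1 ≤ t) (h : Q () (t - 1) s) :
    wp tick t s Q := wp_spend hk h

theorem wp_getState {Q : σ → ℕ → σ → Prop} (h : Q s t s) : wp getState t s Q := by
  intro o ho
  cases ho
  exact ⟨_, _, _, rfl, le_rfl, h⟩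

theorem wp_setState {s' : σ} {Q : Unit → ℕ → σ → Prop} (h : Q () t s') :
    wp (setState s') t s Q := by
  intro o ho
  cases ho
  exact ⟨_, _, _, rfl, le_rfl, h⟩

theorem wp_pick {A : Set α} {Q : α → ℕ → σ → Prop} (hA : A.Nonempty) (h : ∀ a ∈ A, Q a t s) :
    wp (pick A) t s Q := by
  intro o ho
  simp only [outcomes, pick, hA, dif_pos] at ho
  obtain ⟨a, ha, rfl⟩ := ho
  exact ⟨_, _, _, rfl, le_rfl, h a ha⟩

/-- Each iteration consumes a tick and no program gains time, so a bound `n` that exceeds the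
remaining time is never exhausted, and the `abort` in the base case of `iter` is unreachable. -/
theorem wp_iter {body : β → Prog σ (β ⊕ γ)} {Q : γ → ℕ → σ → Prop} (Inv : β → ℕ → σ → Prop)
    (step : ∀ b t s, Inv b t s → 1 ≤ t ∧
      wp (body b) (t - 1) s (fun r t' s' => Sum.elim (fun b' => Inv b' t' s') (fun c => Q c t' s') r))
    (n : ℕ) : ∀ (b : β) (t : ℕ) (s : σ), t < n → Inv b t s → wp (iter body n b) t s Q := by
  induction n with
  | zero => intro b t s h; omega
  | succ n ih =>
    intro b t s hn hb
    obtain ⟨ht, hw⟩ := step b t s hb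
    refine wp_bind (wp_tick ht (wp_bind ?_))
    refine wp_mono hw ?_
    rintro (b' | c) t' s' ht' hq
    · exact ih b' t' s' (by omega) hq
    · exact wp_pure hq

theorem wp_loop {body : β → Prog σ (β ⊕ γ)} {Q : γ → ℕ → σ → Prop} {b : β}
    (Inv : β → ℕ → σ → Prop) (h0 : Inv b t s)
    (step : ∀ b t s, Inv b t s → 1 ≤ t ∧
      wp (body b) (t - 1) s
        (fun r t' s' => Sum.elim (fun b' => Inv b' t' s') (fun c => Q c t' s') r)) :
    wp (loop body b) t s Q :=
  wp_iter Inv step (t + 1) b t s (Nat.lt_succ_self t) h0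

/-- The invariant of `wp_forList` speaks about the elements that have still to be treated. -/
theorem wp_forList {f : β → α → Prog σ β} {Q : β → ℕ → σ → Prop}
    (Inv : List α → β → ℕ → σ → Prop)
    (step : ∀ a l b t s, Inv (a :: l) b t s → 1 ≤ t ∧
      wp (f b a) (t - 1) s (fun b' t' s' => Inv l b' t' s'))
    (fin : ∀ b t s, Inv [] b t s → Q b t s) (l : List α) :
    ∀ (b : β) (t : ℕ) (s : σ), Inv l b t s → wp (forList l b f) t s Q := by
  induction l with
  | nil => intro b t s h; exact wp_pure (fin _ _ _ h)
  | cons a l ih =>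
    intro b t s h
    obtain ⟨ht, hw⟩ := step a l b t s h
    refine wp_bind (wp_tick ht (wp_bind ?_))
    exact wp_mono hw fun b' t' s' _ h' => ih b' t' s' h'

end WeakestPrecondition

/-! ### Elementary operations -/

section Operations

variable {V : Type} {d : ℕ} {t : ℕ} {s : State V d}

open Classical in
/-- Set the color field of the edge `uw`. -/
noncomputable def recolor (c : Sym2 V → Option (Fin (d + 1))) (u w : V) (o : Option (Fin (d + 1))) :
    Sym2 V → Option (Fin (d + 1)) :=
  Function.update c s(u, w) o

theorem wp_readColor {u w : V} {Q : Option (Fin (d + 1)) → ℕ → State V d → Prop} (ht : 1 ≤ t)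
    (h : Q (s.color s(u, w)) (t - 1) s) : wp (readColor u w) t s Q :=
  wp_bind (wp_tick ht (wp_bind (wp_getState (wp_pure h))))

open Classical in
theorem wp_isMissing {γ : Fin (d + 1)} {v : V} {Q : Bool → ℕ → State V d → Prop} (ht : 1 ≤ t)
    (h₁ : γ ∈ missing s.color v → Q true (t - 1) s)
    (h₂ : γ ∉ missing s.color v → Q false (t - 1) s) : wp (isMissing γ v) t s Q := by
  refine wp_bind (wp_tick ht (wp_bind (wp_getState (wp_pure ?_))))
  by_cases h : γ ∈ missing s.color v
  · simpa [h] using h₁ h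
  · simpa [h] using h₂ h

theorem wp_someMissing {v : V} {Q : Fin (d + 1) → ℕ → State V d → Prop} (ht : 1 ≤ t)
    (hn : (missing s.color v).Nonempty) (h : ∀ γ ∈ missing s.color v, Q γ (t - 1) s) :
    wp (someMissing v) t s Q :=
  wp_bind (wp_tick ht (wp_bind (wp_getState (wp_pick hn h))))

theorem wp_lookup {v : V} {γ : Fin (d + 1)} {Q : Option V → ℕ → State V d → Prop} (ht : 1 ≤ t)
    (h₁ : ∀ w, s.color s(v, w) = some γ → Q (some w) (t - 1) s)
    (h₂ : γ ∈ missing s.color v → Q none (t - 1) s) : wp (lookup v γ) t s Q := by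
  refine wp_bind (wp_tick ht (wp_bind (wp_getState ?_)))
  by_cases h : ∃ w, s.color s(v, w) = some γ
  · simp only [h, if_true]
    exact wp_bind (wp_pick h fun w hw => wp_pure (h₁ w hw))
  · simp only [h, if_false]
    exact wp_pure (h₂ fun u hu => h ⟨u, hu⟩)

theorem wp_colorEdge {G : SimpleGraph V} {u w : V} {γ : Fin (d + 1)}
    {Q : Unit → ℕ → State V d → Prop} (ht : 1 ≤ t)
    (ha : G.Adj u w) (hn : s.color s(u, w) = none) (hu : γ ∈ missing s.color u)
    (hw : γ ∈ missing s.color w)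
    (h : Q () (t - 1) ⟨recolor s.color u w (some γ), s.coll, s.pending⟩) :
    wp (colorEdge G u w γ) t s Q := by
  refine wp_bind (wp_tick ht (wp_bind (wp_getState ?_)))
  simp only [ha, hn, hu, hw, and_self, if_true]
  exact wp_setState h

theorem wp_uncolorEdge {u w : V} {Q : Unit → ℕ → State V d → Prop} (ht : 1 ≤ t)
    (h : Q () (t - 1) ⟨recolor s.color u w none, s.coll, s.pending⟩) :
    wp (uncolorEdge u w) t s Q :=
  wp_bind (wp_tick ht (wp_bind (wp_getState (wp_setState h))))

theorem wp_fanContaining {x : V} {Q : Option (Fan V d) → ℕ → State V d → Prop} (ht : 1 ≤ t)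
    (h₁ : ∀ F ∈ s.coll, x ∈ F.verts → Q (some F) (t - 1) s)
    (h₂ : (∀ F ∈ s.coll, x ∉ F.verts) → Q none (t - 1) s) : wp (fanContaining x) t s Q := by
  refine wp_bind (wp_tick ht (wp_bind (wp_getState (wp_pick ?_ ?_))))
  · by_cases h : ∃ F ∈ s.coll, x ∈ F.verts
    · obtain ⟨F, hF⟩ := h
      exact ⟨some F, hF⟩
    · push Not at h
      exact ⟨none, h⟩
  · rintro (_ | F) h
    · exact h₂ h
    · exact h₁ F h.1 h.2

theorem wp_addFan {F : Fan V d} {Q : Unit → ℕ → State V d → Prop} (ht : F.size ≤ t)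
    (h : Q () (t - F.size) ⟨s.color, insert F s.coll, s.pending⟩) : wp (addFan F) t s Q :=
  wp_bind (wp_spend ht (wp_bind (wp_getState (wp_setState h))))

theorem wp_removeFan {F : Fan V d} {Q : Unit → ℕ → State V d → Prop} (ht : F.size ≤ t)
    (h : Q () (t - F.size) ⟨s.color, s.coll \ {F}, s.pending⟩) : wp (removeFan F) t s Q :=
  wp_bind (wp_spend ht (wp_bind (wp_getState (wp_setState h))))

theorem wp_changeLeaves {v : V} {L L' : Finset V} {Q : Unit → ℕ → State V d → Prop} (ht : 2 ≤ t)
    (h : Q () (t - 2) ⟨s.color, insert (.ufan v L') (s.coll \ {.ufan v L}), s.pending⟩) :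
    wp (changeLeaves v L L') t s Q :=
  wp_bind (wp_spend ht (wp_bind (wp_getState (wp_setState h))))

theorem wp_removePending {x : V} {Q : Unit → ℕ → State V d → Prop} (ht : 1 ≤ t)
    (h : Q () (t - 1) ⟨s.color, s.coll, s.pending \ {x}⟩) : wp (removePending x) t s Q :=
  wp_bind (wp_tick ht (wp_bind (wp_getState (wp_setState h))))

theorem wp_takePending {Q : Option V → ℕ → State V d → Prop} (ht : 1 ≤ t)
    (h₁ : ∀ v ∈ s.pending, Q (some v) (t - 1) ⟨s.color, s.coll, s.pending \ {v}⟩)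
    (h₂ : s.pending = ∅ → Q none (t - 1) s) : wp takePending t s Q := by
  refine wp_bind (wp_tick ht (wp_bind (wp_getState ?_)))
  by_cases h : s.pending.Nonempty
  · simp only [h, if_true]
    exact wp_bind (wp_pick h fun w hw => wp_bind (wp_setState (wp_pure (h₁ w hw))))
  · simp only [h, if_false]
    exact wp_pure (h₂ (Set.not_nonempty_iff_eq_empty.1 h))

open Classical in
theorem wp_isDamagedAt {α : Fin (d + 1)} {w : V} {F : Fan V d} {Q : Bool → ℕ → State V d → Prop}
    (ht : 1 ≤ t) (h₁ : F.DamagedAt s.color α w → Q true (t - 1) s)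
    (h₂ : ¬ F.DamagedAt s.color α w → Q false (t - 1) s) : wp (isDamagedAt α w F) t s Q := by
  refine wp_bind (wp_tick ht (wp_bind (wp_getState (wp_pure ?_))))
  by_cases h : F.DamagedAt s.color α w
  · simpa [h] using h₁ h
  · simpa [h] using h₂ h

theorem wp_pickStageFan {β : Fin (d + 1)} {Q : Option (Fan V d) → ℕ → State V d → Prop}
    (ht : 1 ≤ t) (h₁ : ∀ F ∈ stageFans s β, Q (some F) (t - 1) s)
    (h₂ : stageFans s β = ∅ → Q none (t - 1) s) : wp (pickStageFan β) t s Q := by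
  refine wp_bind (wp_tick ht (wp_bind (wp_getState ?_)))
  by_cases h : (stageFans s β).Nonempty
  · simp only [h, if_true]
    exact wp_bind (wp_pick h fun w hw => wp_pure (h₁ w hw))
  · simp only [h, if_false]
    exact wp_pure (h₂ (Set.not_nonempty_iff_eq_empty.1 h))

end Operations

/-! ### Recoloring single edges -/

section Recolor

variable {V : Type} {d : ℕ} {G : SimpleGraph V} {c : Sym2 V → Option (Fin (d + 1))}

theorem mk_ne_mk {v x y : V} (h : x ≠ y) : s(v, x) ≠ s(v, y) := by
  rwa [ne_eq, Sym2.congr_right]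

theorem recolor_self (u w : V) (o : Option (Fin (d + 1))) : recolor c u w o s(u, w) = o := by
  simp [recolor]

theorem recolor_of_ne {u w : V} {o : Option (Fin (d + 1))} {e : Sym2 V} (h : e ≠ s(u, w)) :
    recolor c u w o e = c e := by
  simp [recolor, h]

theorem IsPartialEdgeColoring.adj (hc : IsPartialEdgeColoring G c) {u w : V} {γ : Fin (d + 1)}
    (h : c s(u, w) = some γ) : G.Adj u w := by
  by_contra hn
  rw [hc.eq_none _ hn] at h
  cases h

theorem not_mem_missing {v : V} {γ : Fin (d + 1)} : γ ∉ missing c v ↔ ∃ u, c s(v, u) = some γ := by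
  simp [missing]

theorem IsPartialEdgeColoring.recolor_none (hc : IsPartialEdgeColoring G c) (u w : V) :
    IsPartialEdgeColoring G (recolor c u w none) := by
  have key : ∀ e γ, recolor c u w none e = some γ → c e = some γ := by
    intro e γ h
    by_cases he : e = s(u, w)
    · rw [he, recolor_self] at h; cases h
    · rwa [recolor_of_ne he] at h
  refine ⟨fun e he => ?_, fun v a b γ ha hb => hc.proper v a b γ (key _ _ ha) (key _ _ hb)⟩
  by_cases he' : e = s(u, w)
  · rw [he', recolor_self]
  · rw [recolor_of_ne he', hc.eq_none e he]

/-- By properness the edge that loses its color was the only edge of that color at both of its ends.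
-/
theorem mem_missing_recolor_none (hc : IsPartialEdgeColoring G c) {u w : V} {β : Fin (d + 1)}
    (h : c s(u, w) = some β) (x : V) (γ : Fin (d + 1)) :
    γ ∈ missing (recolor c u w none) x ↔ γ ∈ missing c x ∨ (γ = β ∧ (x = u ∨ x = w)) := by
  constructor
  · intro hm
    by_contra hcon
    push Not at hcon
    obtain ⟨h₁, h₂⟩ := hcon
    obtain ⟨y, hy⟩ := not_mem_missing.1 h₁
    have := hm y
    by_cases he : s(x, y) = s(u, w)
    · rw [he, h] at hy
      cases hy
      rcases Sym2.eq_iff.1 he with ⟨h', _⟩ | ⟨h', _⟩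
      · exact (h₂ rfl).1 h'
      · exact (h₂ rfl).2 h'
    · rw [recolor_of_ne he] at this
      exact this hy
  · rintro (hm | ⟨rfl, hx⟩) y hy
    · by_cases he : s(x, y) = s(u, w)
      · rw [he, recolor_self] at hy; cases hy
      · rw [recolor_of_ne he] at hy; exact hm y hy
    · by_cases he : s(x, y) = s(u, w)
      · rw [he, recolor_self] at hy; cases hy
      · rw [recolor_of_ne he] at hy
        rcases hx with rfl | rfl
        · exact he (by rw [hc.proper _ _ _ _ hy h])
        · rw [Sym2.eq_swap] at h
          exact he (by rw [hc.proper _ _ _ _ hy h, Sym2.eq_swap])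

theorem mem_missing_recolor_some {u w : V} {β : Fin (d + 1)}
    (h : c s(u, w) = none) (x : V) (γ : Fin (d + 1)) :
    γ ∈ missing (recolor c u w (some β)) x ↔ γ ∈ missing c x ∧ ¬ (γ = β ∧ (x = u ∨ x = w)) := by
  constructor
  · intro hm
    refine ⟨fun y hy => ?_, ?_⟩
    · by_cases he : s(x, y) = s(u, w)
      · rw [he, h] at hy; cases hy
      · exact hm y (by rwa [recolor_of_ne he])
    · rintro ⟨rfl, rfl | rfl⟩
      · exact hm w (recolor_self _ _ _)
      · exact hm u (by rw [Sym2.eq_swap, recolor_self])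
  · rintro ⟨hm, hn⟩ y hy
    by_cases he : s(x, y) = s(u, w)
    · rw [he, recolor_self] at hy
      cases hy
      refine hn ⟨rfl, ?_⟩
      rcases Sym2.eq_iff.1 he with ⟨h', _⟩ | ⟨h', _⟩
      · exact Or.inl h'
      · exact Or.inr h'
    · rw [recolor_of_ne he] at hy
      exact hm y hy

theorem missing_recolor_some_of_ne {u w : V} {β : Fin (d + 1)}
    (h : c s(u, w) = none) {x : V} (hu : x ≠ u) (hw : x ≠ w) :
    missing (recolor c u w (some β)) x = missing c x := by
  ext γ
  rw [mem_missing_recolor_some h]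
  simp [hu, hw]

theorem IsPartialEdgeColoring.recolor_some (hc : IsPartialEdgeColoring G c) {u w : V}
    {β : Fin (d + 1)} (ha : G.Adj u w) (hu : β ∈ missing c u) (hw : β ∈ missing c w) :
    IsPartialEdgeColoring G (recolor c u w (some β)) := by
  have key : ∀ v a b, s(v, a) = s(u, w) → c s(v, b) ≠ some β := by
    intro v a b h
    rcases Sym2.eq_iff.1 h with ⟨rfl, _⟩ | ⟨rfl, _⟩
    · exact hu b
    · exact hw b
  constructor
  · intro e he
    by_cases he' : e = s(u, w)
    · subst he'; exact absurd ha he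
    · rw [recolor_of_ne he', hc.eq_none e he]
  · intro v a b γ h₁ h₂
    by_cases e₁ : s(v, a) = s(u, w) <;> by_cases e₂ : s(v, b) = s(u, w)
    · have := e₁.trans e₂.symm
      exact Sym2.congr_right.1 this
    · rw [e₁, recolor_self] at h₁
      cases h₁
      rw [recolor_of_ne e₂] at h₂
      exact absurd h₂ (key _ _ _ e₁)
    · rw [e₂, recolor_self] at h₂
      cases h₂
      rw [recolor_of_ne e₁] at h₁
      exact absurd h₁ (key _ _ _ e₂)
    · rw [recolor_of_ne e₁] at h₁
      rw [recolor_of_ne e₂] at h₂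
      exact hc.proper _ _ _ _ h₁ h₂

/-- The number of edges with a given color (or without color). -/
def colorCount (G : SimpleGraph V) (c : Sym2 V → Option (Fin (d + 1))) (o : Option (Fin (d + 1))) :
    ℕ :=
  {e | e ∈ G.edgeSet ∧ c e = o}.ncard

theorem colorCount_none : colorCount G c none = (uncoloredEdges G c).ncard := rfl

theorem colorCount_recolor_some_none [Finite V] {u w : V} {β : Fin (d + 1)} (ha : G.Adj u w)
    (h : c s(u, w) = none) :
    colorCount G (recolor c u w (some β)) none + 1 = colorCount G c none := by
  have h₁ : {e | e ∈ G.edgeSet ∧ c e = none} =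
      insert s(u, w) {e | e ∈ G.edgeSet ∧ recolor c u w (some β) e = none} := by
    ext e
    by_cases he : e = s(u, w)
    · subst he; simp [h, ha]
    · simp [recolor_of_ne he, he]
  unfold colorCount
  rw [h₁, Set.ncard_insert_of_notMem _ (Set.toFinite _)]
  simp [recolor_self]

theorem colorCount_recolor_some_of_ne {u w : V} {β γ : Fin (d + 1)}
    (h : c s(u, w) = none) (hγ : γ ≠ β) :
    colorCount G (recolor c u w (some β)) (some γ) = colorCount G c (some γ) := by
  unfold colorCount
  congr 1
  ext e
  by_cases he : e = s(u, w)
  · subst he; simp [h, recolor_self, hγ.symm]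
  · simp [recolor_of_ne he]

-- One step of a shift exchanges the color fields of two edges, and a transposition of edges maps
-- color classes bijectively to each other. Shifts thus preserve every color count, also that of the
-- uncolored edges.
open Classical in
theorem colorCount_comp_swap {e₁ e₂ : Sym2 V} (h₁ : e₁ ∈ G.edgeSet) (h₂ : e₂ ∈ G.edgeSet)
    (o : Option (Fin (d + 1))) :
    colorCount G (c ∘ Equiv.swap e₁ e₂) o = colorCount G c o := by
  have hE : ∀ e, Equiv.swap e₁ e₂ e ∈ G.edgeSet ↔ e ∈ G.edgeSet := by
    intro e
    rcases Equiv.swap_apply_eq_iff.1 (rfl : Equiv.swap e₁ e₂ e = Equiv.swap e₁ e₂ e) with _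
    by_cases ha : e = e₁
    · subst ha; simp [h₁, h₂]
    · by_cases hb : e = e₂
      · subst hb; simp [h₁, h₂]
      · rw [Equiv.swap_apply_of_ne_of_ne ha hb]
  have : {e | e ∈ G.edgeSet ∧ c e = o} =
      Equiv.swap e₁ e₂ '' {e | e ∈ G.edgeSet ∧ (c ∘ Equiv.swap e₁ e₂) e = o} := by
    rw [Equiv.image_eq_preimage_symm]
    ext e
    simp [hE]
  unfold colorCount
  rw [this, Set.ncard_image_of_injective _ (Equiv.injective _)]

end Recolor

/-! ### Shifting -/

section Shift

variable {V : Type} {d : ℕ} {G : SimpleGraph V} {c c' : Sym2 V → Option (Fin (d + 1))}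

/-- The list of leaves of a part of a c-fan with center `v` that starts with the uncolored edge. -/
structure IsShiftable (G : SimpleGraph V) (c : Sym2 V → Option (Fin (d + 1))) (v : V)
    (xs : List V) : Prop where
  adj : ∀ x ∈ xs, G.Adj v x
  nodup : xs.Nodup
  head : ∀ x ∈ xs.head?, c s(v, x) = none
  chain : xs.IsChain (fun x y => ∃ γ, c s(v, y) = some γ ∧ γ ∈ missing c x)

/-- The coloring `c'` arises from `c` by shifting the fan with center `v` and leaves `xs` from its
last leaf `z`. -/
structure IsShifted (G : SimpleGraph V) (c c' : Sym2 V → Option (Fin (d + 1))) (v : V)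
    (xs : List V) (z : V) : Prop where
  isPartial : IsPartialEdgeColoring G c'
  last : c' s(v, z) = none
  count : ∀ o, colorCount G c' o = colorCount G c o
  missing_of_not_mem : ∀ u, u ∉ xs → missing c' u = missing c u
  subset_last : missing c z ⊆ missing c' z
  eq_of_ne : ∀ e, (∀ x ∈ xs, e ≠ s(v, x)) → c' e = c e
  eq_some_iff : ∀ γ, (∀ x ∈ xs, c s(v, x) ≠ some γ) → ∀ e, c' e = some γ ↔ c e = some γ
  origin : ∀ e γ, c' e = some γ → c e = some γ ∨
    ∃ l₁ x y l₂, xs = l₁ ++ x :: y :: l₂ ∧ c s(v, y) = some γ ∧ e = s(v, x)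

/-- A shift moves only colors of edges at the center; a color missing there keeps its edges. This is
applied to `α`, and to `β` once it is missing at the center. -/
theorem IsShifted.mem_missing_iff {v : V} {xs : List V} {z : V} (h : IsShifted G c c' v xs z)
    {γ : Fin (d + 1)} (hγ : γ ∈ missing c v) (u : V) : γ ∈ missing c' u ↔ γ ∈ missing c u := by
  have := h.eq_some_iff γ (fun x _ => hγ x)
  simp only [missing, Set.mem_ofPred_eq, ne_eq, this]

/-- The effect of the first step of a shift. -/
theorem IsShiftable.step {v x y : V} {xs : List V} (hc : IsPartialEdgeColoring G c)
    (h : IsShiftable G c v (x :: y :: xs)) {β : Fin (d + 1)} (hβ : c s(v, y) = some β)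
    (h' : c' = recolor (recolor c v y none) v x (some β)) :
    IsPartialEdgeColoring G c' ∧ c' s(v, y) = none ∧ c' s(v, x) = some β ∧
      (∀ o, colorCount G c' o = colorCount G c o) ∧
      (∀ e, e ≠ s(v, x) → e ≠ s(v, y) → c' e = c e) ∧
      (∀ u, u ≠ x → u ≠ y → missing c' u = missing c u) ∧ missing c y ⊆ missing c' y ∧
      β ∈ missing (recolor c v y none) v ∧ β ∈ missing (recolor c v y none) x ∧
      recolor c v y none s(v, x) = none ∧ IsShiftable G c' v (y :: xs) := by
  classical
  obtain ⟨adj, nodup, head, chain⟩ := h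
  have hx : c s(v, x) = none := head x rfl
  simp only [List.nodup_cons, List.mem_cons, not_or] at nodup
  obtain ⟨⟨hxy, hxxs⟩, hyxs, hxs⟩ := nodup
  have hvx := adj x (by simp)
  have hvy := adj y (by simp)
  rw [List.isChain_cons_cons] at chain
  obtain ⟨⟨β', hβ', hm⟩, chain⟩ := chain
  obtain rfl : β = β' := by rw [hβ] at hβ'; simpa using hβ'
  have hne : s(v, x) ≠ s(v, y) := mk_ne_mk hxy
  have hx' : recolor c v y none s(v, x) = none := by rw [recolor_of_ne hne, hx]
  have hmv : β ∈ missing (recolor c v y none) v := by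
    rw [mem_missing_recolor_none hc hβ]; simp
  have hmx : β ∈ missing (recolor c v y none) x := by
    rw [mem_missing_recolor_none hc hβ]; exact Or.inl hm
  have hmiss : ∀ u γ, γ ∈ missing c' u ↔
      (γ ∈ missing c u ∨ (γ = β ∧ (u = v ∨ u = y))) ∧ ¬ (γ = β ∧ (u = v ∨ u = x)) := by
    intro u γ
    rw [h', mem_missing_recolor_some hx', mem_missing_recolor_none hc hβ]
  have hy' : c' s(v, y) = none := by rw [h', recolor_of_ne hne.symm, recolor_self]
  have hout : ∀ e, e ≠ s(v, x) → e ≠ s(v, y) → c' e = c e := by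
    intro e h₁ h₂; rw [h', recolor_of_ne h₁, recolor_of_ne h₂]
  have hmu : ∀ u, u ≠ x → u ≠ y → missing c' u = missing c u := by
    intro u h₁ h₂
    ext γ
    rw [hmiss]
    by_cases huv : u = v
    · subst huv
      have : β ∉ missing c u := fun h => h _ hβ
      by_cases hγ : γ = β
      · subst hγ; simp [this]
      · simp [hγ]
    · simp [huv, h₁, h₂]
  have hsub : missing c y ⊆ missing c' y := by
    intro γ hγ
    rw [hmiss]
    refine ⟨Or.inl hγ, ?_⟩
    rintro ⟨_, h | h⟩
    · exact hvy.ne h.symm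
    · exact hxy h.symm
  refine ⟨by rw [h']; exact (hc.recolor_none v y).recolor_some hvx hmv hmx, hy',
    by rw [h', recolor_self], ?_, hout, hmu, hsub, hmv, hmx, hx', ?_⟩
  · intro o
    rw [← colorCount_comp_swap (c := c) (e₁ := s(v, x)) (e₂ := s(v, y)) hvx hvy]
    congr 1
    funext e
    by_cases h₁ : e = s(v, x)
    · subst h₁; simp [h', recolor_self, hβ]
    · by_cases h₂ : e = s(v, y)
      · subst h₂; simp [hy', hx]
      · rw [hout e h₁ h₂]; simp [Equiv.swap_apply_of_ne_of_ne h₁ h₂]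
  · refine ⟨fun z hz => adj z (List.mem_cons_of_mem _ hz), by simp [hyxs, hxs], ?_, ?_⟩
    · simp [hy']
    · have hk : ∀ a ∈ y :: xs, missing c a ⊆ missing c' a := by
        intro a ha
        rcases List.mem_cons.1 ha with rfl | ha
        · exact hsub
        · rw [hmu a (fun h => hxxs (h ▸ ha)) (fun h => hyxs (h ▸ ha))]
      have hk' : ∀ b ∈ xs, c' s(v, b) = c s(v, b) := by
        intro b hb
        exact hout _ (mk_ne_mk fun h => hxxs (h ▸ hb)) (mk_ne_mk fun h => hyxs (h ▸ hb))
      have : ∀ (l : List V) (a : V), (∀ b ∈ a :: l, missing c b ⊆ missing c' b) →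
          (∀ b ∈ l, c' s(v, b) = c s(v, b)) →
          (a :: l).IsChain (fun x y => ∃ γ, c s(v, y) = some γ ∧ γ ∈ missing c x) →
          (a :: l).IsChain (fun x y => ∃ γ, c' s(v, y) = some γ ∧ γ ∈ missing c' x) := by
        intro l
        induction l with
        | nil => intros; simp
        | cons b l ih =>
          intro a h₁ h₂ h₃
          rw [List.isChain_cons_cons] at h₃ ⊢
          obtain ⟨⟨γ, hγ, hγ'⟩, h₃⟩ := h₃
          exact ⟨⟨γ, by rw [h₂ b (by simp), hγ], h₁ a (by simp) hγ'⟩,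
            ih b (fun z hz => h₁ z (by simp [hz])) (fun z hz => h₂ z (by simp [hz])) h₃⟩
      exact this xs y hk hk' chain

variable [DecidableEq V]

/-- After one step the uncolored edge leads to the next leaf and the remaining list is shiftable for
the new coloring; so the induction runs over the leaves before `z`, for all colorings. The leaves in
`post` play no role. The factor 4 counts the tick, reading, uncoloring and coloring of one step. -/
theorem wp_shift (v z : V) (post : List V) (K : Set (Fan V d)) (S : Set V) (pre : List V) :
    ∀ (c : Sym2 V → Option (Fin (d + 1))) (t : ℕ) (Q : Unit → ℕ → State V d → Prop),
    IsPartialEdgeColoring G c → IsShiftable G c v (pre ++ [z]) → 4 * (pre.length + 1) ≤ t →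
    (∀ c' t', t ≤ t' + 4 * (pre.length + 1) → IsShifted G c c' v (pre ++ [z]) z →
      Q () t' ⟨c', K, S⟩) →
    wp (shift G v (pre ++ z :: post) z) t ⟨c, K, S⟩ Q := by
  induction pre with
  | nil =>
    intro c t Q hc h ht hQ
    have h0 : IsShifted G c c v ([] ++ [z]) z :=
      { isPartial := hc
        last := h.head z rfl
        count := fun _ => rfl
        missing_of_not_mem := fun _ _ => rfl
        subset_last := subset_rfl
        eq_of_ne := fun _ _ => rfl
        eq_some_iff := fun _ _ _ => Iff.rfl
        origin := fun _ _ h => Or.inl h }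
    cases post with
    | nil => exact wp_pure (hQ c t (by omega) h0)
    | cons y ys =>
      simp only [List.nil_append, shift, if_true]
      refine wp_bind (wp_tick (by simp at ht; omega) (wp_pure (hQ c _ ?_ h0)))
      omega
  | cons x pre ih =>
    intro c t Q hc h ht hQ
    obtain ⟨y, ys, hys⟩ : ∃ y ys, pre ++ [z] = y :: ys := by
      cases pre with
      | nil => exact ⟨z, [], rfl⟩
      | cons a l => exact ⟨a, l ++ [z], rfl⟩
    have hprog : x :: pre ++ z :: post = x :: y :: (ys ++ post) := by
      have : pre ++ z :: post = (pre ++ [z]) ++ post := by simp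
      rw [List.cons_append, this, hys]; rfl
    have hlist : x :: pre ++ [z] = x :: y :: ys := by rw [List.cons_append, hys]
    rw [hlist] at h
    have hxz : x ≠ z := by
      rintro rfl
      have := h.nodup
      rw [← hys] at this
      simp at this
    obtain ⟨β, hβ, -⟩ := (List.isChain_cons_cons.1 h.chain).1
    obtain ⟨hp, h1, h2, h3, h4, h5, h6, h7, h8, h9, h10⟩ := h.step hc hβ rfl
    have hvx := h.adj x (by simp)
    simp only [List.length_cons] at ht hQ
    rw [hprog]
    simp only [shift, hxz, if_false]
    refine wp_bind (wp_tick (by omega) (wp_bind (wp_readColor (by omega) ?_)))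
    simp only [hβ]
    refine wp_bind (wp_uncolorEdge (by omega) (wp_bind
      (wp_colorEdge (by omega) hvx h9 h7 h8 ?_)))
    have : y :: (ys ++ post) = pre ++ z :: post := by
      have : pre ++ z :: post = (pre ++ [z]) ++ post := by simp
      rw [this, hys]; rfl
    rw [this]
    refine ih _ _ _ hp (hys ▸ h10) (by omega) ?_
    intro c'' t' ht' hs
    refine hQ c'' t' (by omega) ?_
    have hnd := h.nodup
    rw [hlist]
    rw [hys] at hs
    dsimp only at hs
    simp only [List.nodup_cons, List.mem_cons, not_or] at hnd
    obtain ⟨⟨hxy, hxxs⟩, hyxs, hxs⟩ := hnd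
    have hx : c s(v, x) = none := h.head x rfl
    have hzmem : z ∈ y :: ys := by rw [← hys]; simp
    refine ⟨hs.isPartial, hs.last, fun o => (hs.count o).trans (h3 o), ?_, ?_, ?_, ?_, ?_⟩
    · intro u hu
      simp only [List.mem_cons, not_or] at hu
      rw [hs.missing_of_not_mem u (by simp [hu.2]), h5 u hu.1 hu.2.1]
    · refine subset_trans ?_ hs.subset_last
      by_cases hzy : z = y
      · rw [hzy]; exact h6
      · rw [h5 z hxz.symm hzy]
    · intro e he
      rw [hs.eq_of_ne e (fun a ha => he a (List.mem_cons_of_mem _ ha)),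
        h4 e (he x (by simp)) (he y (by simp))]
    · intro γ hγ e
      have hγβ : β ≠ γ := by
        rintro rfl; exact hγ y (by simp) hβ
      have hstep : ∀ e, recolor (recolor c v y none) v x (some β) e = some γ ↔ c e = some γ := by
        intro e
        by_cases e₁ : e = s(v, x)
        · subst e₁; rw [h2, hx]; simp [hγβ]
        · by_cases e₂ : e = s(v, y)
          · subst e₂; rw [h1, hβ]; simp [hγβ]
          · rw [h4 e e₁ e₂]
      rw [hs.eq_some_iff γ (fun a ha hcon => hγ a (List.mem_cons_of_mem _ ha)
        ((hstep _).1 hcon)), hstep]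
    · intro e γ he
      rcases hs.origin e γ he with h' | ⟨l₁, a, b, l₂, hl, hb, rfl⟩
      · by_cases e₁ : e = s(v, x)
        · subst e₁
          rw [h2] at h'
          cases h'
          exact Or.inr ⟨[], x, y, ys, rfl, hβ, rfl⟩
        · by_cases e₂ : e = s(v, y)
          · subst e₂; rw [h1] at h'; cases h'
          · rw [h4 e e₁ e₂] at h'; exact Or.inl h'
      · refine Or.inr ⟨x :: l₁, a, b, l₂, by rw [hl]; rfl, ?_, rfl⟩
        have hby : b ∈ ys := by
          cases l₁ with
          | nil => simp at hl; simp [hl.2]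
          | cons q l => simp at hl; simp [hl.2]
        rwa [h4 _ (mk_ne_mk fun h => hxxs (h ▸ hby))
          (mk_ne_mk fun h => hyxs (h ▸ hby))] at hb

end Shift

/-! ### Alternating paths -/

section AltPath

variable {V : Type} {d : ℕ} {G : SimpleGraph V} {c c' : Sym2 V → Option (Fin (d + 1))}

/-- The walk `p` with last vertex `w` follows edges with alternating colors `γ, δ, γ, …`, as far as
possible. -/
inductive AltPath (c : Sym2 V → Option (Fin (d + 1))) :
    Fin (d + 1) → Fin (d + 1) → List V → V → Prop
  | last (γ δ : Fin (d + 1)) (u : V) : γ ∈ missing c u → AltPath c γ δ [u] u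
  | cons (γ δ : Fin (d + 1)) (u x : V) (p : List V) (w : V) : c s(u, x) = some γ →
      AltPath c δ γ (x :: p) w → AltPath c γ δ (u :: x :: p) w

/-- The set `X` of vertices is a union of `αβ`-components. -/
def IsABClosed (c : Sym2 V → Option (Fin (d + 1))) (α β : Fin (d + 1)) (X : Set V) : Prop :=
  ∀ u ∈ X, ∀ w, (c s(u, w) = some α ∨ c s(u, w) = some β) → w ∈ X

theorem IsABClosed.symm {α β : Fin (d + 1)} {X : Set V} (h : IsABClosed c α β X) :
    IsABClosed c β α X :=
  fun u hu w hw => h u hu w hw.symm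

theorem IsABClosed.union {α β : Fin (d + 1)} {X Y : Set V} (h : IsABClosed c α β X)
    (h' : IsABClosed c α β Y) : IsABClosed c α β (X ∪ Y) :=
  fun u hu w hw => hu.imp (fun hu => h u hu w hw) (fun hu => h' u hu w hw)

/-- The walk cannot return to the set `A` of visited vertices: `γδ`-edges at vertices of `A` stay in
`A`, except for the edge by which `v` was reached, and that edge does not have color `γ`. Hence the
`γ`-edge at `v` leads to a new vertex; the induction is on the number of unvisited vertices. -/
theorem AltPath.exists_aux [Finite V] (hc : IsPartialEdgeColoring G c) (n : ℕ) :
    ∀ (γ δ : Fin (d + 1)) (v : V) (A : Set V), Aᶜ.ncard = n → v ∉ A →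
      (∀ a ∈ A, ∀ b, (c s(a, b) = some γ ∨ c s(a, b) = some δ) → b ∈ A ∨ (b = v ∧
        c s(a, b) ≠ some γ)) → (∀ b, c s(v, b) = some δ → b ∈ A) →
      ∃ p w, AltPath c γ δ (v :: p) w ∧ (v :: p).Nodup ∧ ∀ x ∈ v :: p, x ∉ A := by
  induction n using Nat.strong_induction_on with
  | _ n ih =>
    intro γ δ v A hn hv hA hδ
    by_cases h : γ ∈ missing c v
    · exact ⟨[], v, .last _ _ _ h, by simp, by simpa using hv⟩
    · obtain ⟨x, hx⟩ := not_mem_missing.1 h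
      have hxv : x ≠ v := (hc.adj hx).ne'
      have hxA : x ∉ A := by
        intro hxA
        have hx' : c s(x, v) = some γ := by rw [Sym2.eq_swap]; exact hx
        rcases hA x hxA v (Or.inl hx') with h' | ⟨-, h'⟩
        · exact hv h'
        · exact h' hx'
      obtain ⟨p, w, hp, hnd, hpA⟩ := ih (insert v A)ᶜ.ncard (by
          rw [← hn]
          refine Set.ncard_lt_ncard ⟨?_, ?_⟩ (Set.toFinite _)
          · intro y hy hyA; exact hy (Set.mem_insert_of_mem _ hyA)
          · intro hsub; exact hsub hv (Set.mem_insert _ _)) δ γ x (insert v A) rfl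
        (by simp [hxv, hxA]) (by
          rintro a (rfl | ha) b hb
          · rcases hb with hb | hb
            · exact Or.inl (Set.mem_insert_of_mem _ (hδ b hb))
            · have := hc.proper _ _ _ _ hb hx
              subst this
              by_cases hbd : c s(a, b) = some δ
              · exact absurd (hδ b hbd) hxA
              · exact Or.inr ⟨rfl, hbd⟩
          · rcases hA a ha b hb.symm with h' | ⟨rfl, -⟩
            · exact Or.inl (Set.mem_insert_of_mem _ h')
            · exact Or.inl (Set.mem_insert _ _)) (by
          intro b hb
          rw [Sym2.eq_swap] at hx
          rw [hc.proper _ _ _ _ hb hx]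
          exact Set.mem_insert _ _)
      refine ⟨x :: p, w, .cons _ _ _ _ _ _ hx hp, ?_, ?_⟩
      · rw [List.nodup_cons]
        exact ⟨fun hmem => hpA v hmem (Set.mem_insert _ _), hnd⟩
      · intro y hy
        rcases List.mem_cons.1 hy with rfl | hy
        · exact hv
        · exact fun hyA => hpA y hy (Set.mem_insert_of_mem _ hyA)

theorem AltPath.exists [Finite V] (hc : IsPartialEdgeColoring G c) {δ : Fin (d + 1)}
    (γ : Fin (d + 1)) {v : V} (h : δ ∈ missing c v) :
    ∃ p w, AltPath c γ δ (v :: p) w ∧ (v :: p).Nodup := by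
  obtain ⟨p, w, hp, hnd, -⟩ := AltPath.exists_aux hc _ γ δ v ∅ rfl (by simp) (by simp)
    (fun b hb => absurd hb (h b))
  exact ⟨p, w, hp, hnd⟩

/-- The edges of a path. -/
def pathEdges : List V → List (Sym2 V)
  | u :: w :: p => s(u, w) :: pathEdges (w :: p)
  | _ => []

theorem mem_of_mem_pathEdges {p : List V} {a : V} {e : Sym2 V} (he : e ∈ pathEdges p)
    (ha : a ∈ e) : a ∈ p := by
  induction p with
  | nil => simp [pathEdges] at he
  | cons u p ih =>
    cases p with
    | nil => simp [pathEdges] at he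
    | cons w p =>
      simp only [pathEdges, List.mem_cons] at he
      rcases he with rfl | he
      · rcases Sym2.mem_iff.1 ha with rfl | rfl <;> simp
      · exact List.mem_cons_of_mem _ (ih he)

variable {γ δ : Fin (d + 1)} {p : List V} {u w : V}

/-- The path is maximal only at its last vertex. At the first one nothing prevents a `δ`-edge that
leads elsewhere, hence the exceptional alternative. -/
theorem AltPath.mem_pathEdges (hc : IsPartialEdgeColoring G c) (h : AltPath c γ δ p w) :
    ∀ {u q a b ζ}, p = u :: q → a ∈ p → c s(a, b) = some ζ → (ζ = γ ∨ ζ = δ) →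
      s(a, b) ∈ pathEdges p ∨ (a = u ∧ ζ = δ) := by
  induction h with
  | last γ δ u hm =>
    intro u' q a b ζ hp ha hab hζ
    simp only [List.mem_singleton] at ha
    cases hp
    subst ha
    rcases hζ with rfl | rfl
    · exact absurd hab (hm b)
    · exact Or.inr ⟨rfl, rfl⟩
  | cons γ δ u x p w hx _ ih =>
    intro u' q a b ζ hp ha hab hζ
    cases hp
    rcases List.mem_cons.1 ha with rfl | ha
    · rcases hζ with rfl | rfl
      · rw [hc.proper _ _ _ _ hab hx]
        exact Or.inl (by simp [pathEdges])
      · exact Or.inr ⟨rfl, rfl⟩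
    · rcases ih rfl ha hab hζ.symm with h | ⟨rfl, rfl⟩
      · exact Or.inl (by simp [pathEdges, h])
      · rw [Sym2.eq_swap] at hx
        rw [hc.proper _ _ _ _ hab hx]
        exact Or.inl (by simp [pathEdges, Sym2.eq_swap])

theorem AltPath.mem_pathEdges_of_missing (hc : IsPartialEdgeColoring G c)
    (h : AltPath c γ δ (u :: p) w) (hu : δ ∈ missing c u) {a b : V} {ζ : Fin (d + 1)}
    (ha : a ∈ u :: p) (hab : c s(a, b) = some ζ) (hζ : ζ = γ ∨ ζ = δ) :
    s(a, b) ∈ pathEdges (u :: p) := by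
  rcases h.mem_pathEdges hc rfl ha hab hζ with h | ⟨rfl, rfl⟩
  · exact h
  · exact absurd hab (hu b)

/-- If `δ` is missing at the first vertex, the path can be extended at neither end and fills a whole
component. -/
theorem AltPath.isABClosed (hc : IsPartialEdgeColoring G c)
    (h : AltPath c γ δ (u :: p) w) (hu : δ ∈ missing c u) :
    IsABClosed c γ δ {x | x ∈ u :: p} := by
  intro a ha b hb
  have : s(a, b) ∈ pathEdges (u :: p) := by
    rcases hb with hb | hb
    · exact h.mem_pathEdges_of_missing hc hu ha hb (Or.inl rfl)
    · exact h.mem_pathEdges_of_missing hc hu ha hb (Or.inr rfl)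
  exact mem_of_mem_pathEdges this (by simp)

theorem AltPath.last_mem (h : AltPath c γ δ p w) : w ∈ p := by
  induction h with
  | last => simp
  | cons _ _ _ _ _ _ _ _ ih => exact List.mem_cons_of_mem _ ih

/-- An inner vertex is entered by one of the two colors and left by the other. So only the ends of a
path matter for the fans. -/
theorem AltPath.not_mem_missing (h : AltPath c γ δ p w) :
    ∀ {u q a}, p = u :: q → a ∈ p → a ≠ w → γ ∉ missing c a ∧ (a ≠ u → δ ∉ missing c a) := by
  induction h with
  | last =>
    intro u q a _ ha haw
    simp only [List.mem_singleton] at ha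
    exact absurd ha haw
  | cons γ δ u x p w hx _ ih =>
    intro u' q a hp ha haw
    cases hp
    rcases List.mem_cons.1 ha with rfl | ha
    · exact ⟨fun h => h _ hx, fun h => absurd rfl h⟩
    · obtain ⟨h₁, h₂⟩ := ih rfl ha haw
      refine ⟨?_, fun _ => h₁⟩
      by_cases hax : a = x
      · subst hax
        rw [Sym2.eq_swap] at hx
        exact fun h => h _ hx
      · exact h₂ hax

/-- The last vertex of a nontrivial path has the color by which it is entered and misses the color
that would continue the path. -/
theorem AltPath.missing_last (h : AltPath c γ δ p w) :
    (p = [w] ∧ γ ∈ missing c w) ∨ (γ ∈ missing c w ∧ δ ∉ missing c w) ∨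
      (δ ∈ missing c w ∧ γ ∉ missing c w) := by
  induction h with
  | last γ δ u hm => exact Or.inl ⟨rfl, hm⟩
  | cons γ δ u x p w hx _ ih =>
    rcases ih with ⟨hp, hm⟩ | h | h
    · cases hp
      rw [Sym2.eq_swap] at hx
      exact Or.inr (Or.inr ⟨hm, fun h => h _ hx⟩)
    · exact Or.inr (Or.inr h)
    · exact Or.inr (Or.inl h)

theorem AltPath.eq_singleton (h : AltPath c γ δ (u :: p) w) (hnd : (u :: p).Nodup) (huw : u = w) :
    p = [] := by
  cases h with
  | last => rfl
  | cons _ _ _ x p _ _ h =>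
    subst huw
    exact absurd h.last_mem (List.nodup_cons.1 hnd).1

theorem AltPath.subset (h : AltPath c γ δ p w) {X : Set V} :
    ∀ {u q}, p = u :: q → IsABClosed c γ δ X → u ∈ X → ∀ a ∈ p, a ∈ X := by
  induction h with
  | last =>
    intro u q hp _ hu a ha
    cases hp
    simp only [List.mem_singleton] at ha
    exact ha ▸ hu
  | cons γ δ u x p w hx _ ih =>
    intro u' q hp hX hu a ha
    cases hp
    rcases List.mem_cons.1 ha with rfl | ha
    · exact hu
    · exact ih rfl hX.symm (hX _ hu _ (Or.inl hx)) a ha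

/-- Used in contrapositive form: a path that begins outside the explored set avoids it completely.
-/
theorem AltPath.head_mem (h : AltPath c γ δ p w) {X : Set V} :
    ∀ {u q a}, p = u :: q → IsABClosed c γ δ X → a ∈ p → a ∈ X → u ∈ X := by
  induction h with
  | last =>
    intro u q a hp _ ha hu
    cases hp
    simp only [List.mem_singleton] at ha
    exact ha ▸ hu
  | cons γ δ u x p w hx _ ih =>
    intro u' q a hp hX ha haX
    cases hp
    rcases List.mem_cons.1 ha with rfl | ha
    · exact haX
    · rw [Sym2.eq_swap] at hx
      exact hX _ (ih rfl hX.symm ha haX) _ (Or.inl hx)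

theorem AltPath.congr (h : AltPath c γ δ p w)
    (hcc : ∀ a ∈ p, ∀ b ζ, (ζ = γ ∨ ζ = δ) → (c s(a, b) = some ζ ↔ c' s(a, b) = some ζ)) :
    AltPath c' γ δ p w := by
  induction h with
  | last γ δ u hm =>
    exact .last _ _ _ fun b hb => hm b ((hcc u (by simp) b γ (Or.inl rfl)).2 hb)
  | cons γ δ u x p w hx _ ih =>
    refine .cons _ _ _ _ _ _ ((hcc u (by simp) x γ (Or.inl rfl)).1 hx) (ih ?_)
    exact fun a ha b ζ hζ => hcc a (List.mem_cons_of_mem _ ha) b ζ hζ.symm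

theorem AltPath.mono (h : AltPath c γ δ p w) (he : ∀ e ζ, c e = some ζ → c' e = some ζ)
    (hm : ∀ ζ, (ζ = γ ∨ ζ = δ) → ζ ∈ missing c w → ζ ∈ missing c' w) :
    AltPath c' γ δ p w := by
  induction h with
  | last γ δ u hu => exact .last _ _ _ (hm _ (Or.inl rfl) hu)
  | cons γ δ u x p w hx _ ih =>
    exact .cons _ _ _ _ _ _ (he _ _ hx) (ih fun ζ hζ => hm ζ hζ.symm)

/-- A path from `u` that starts with color `γ` is not affected when an edge at `u` that does not
lead to this path is colored by `δ`. -/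
theorem AltPath.recolor {a b : V} (h : AltPath c γ δ (u :: p) w) (hnd : (u :: p).Nodup)
    (hγδ : γ ≠ δ) (hab : c s(a, b) = none) (ha : a ∉ p) (hb : b ∉ p) :
    AltPath (recolor c a b (some δ)) γ δ (u :: p) w := by
  have hmono : ∀ e ζ, c e = some ζ → EdgeColoring.recolor c a b (some δ) e = some ζ := by
    intro e ζ he
    rw [recolor_of_ne]
    · exact he
    · rintro rfl; rw [hab] at he; cases he
  by_cases huw : u = w
  · have := h.eq_singleton hnd huw
    subst this
    cases h with
    | last _ _ _ hm =>
      refine .last _ _ _ ?_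
      rw [mem_missing_recolor_some hab]
      exact ⟨hm, fun h => hγδ h.1⟩
  · refine h.mono hmono fun ζ _ hζ => ?_
    have hw : w ∈ p := (List.mem_cons.1 h.last_mem).resolve_left (Ne.symm huw)
    rw [missing_recolor_some_of_ne hab]
    · exact hζ
    · rintro rfl; exact ha hw
    · rintro rfl; exact hb hw

end AltPath

/-! ### Flipping -/

section Flip

variable {V : Type} {d : ℕ} {G : SimpleGraph V} {c : Sym2 V → Option (Fin (d + 1))}
  {α β : Fin (d + 1)} {K : Set V}

open Classical in
/-- Exchange `α` and `β` on the union `K` of `αβ`-components. -/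
def flipOn (c : Sym2 V → Option (Fin (d + 1))) (α β : Fin (d + 1)) (K : Set V) :
    Sym2 V → Option (Fin (d + 1)) :=
  fun e => if ∃ u ∈ K, u ∈ e then (c e).map (Equiv.swap α β) else c e

open Classical in
theorem map_swap_of_ne {o : Option (Fin (d + 1))} (hα : o ≠ some α) (hβ : o ≠ some β) :
    o.map (Equiv.swap α β) = o := by
  cases o with
  | none => rfl
  | some γ => simp [Equiv.swap_apply_of_ne_of_ne (a := α) (b := β) (x := γ)
      (fun h => hα (by rw [h])) (fun h => hβ (by rw [h]))]

-- An edge of color `α` or `β` with one end in the closed set `K` has both ends there, so it is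
-- enough to test one end of the edge.
open Classical in
theorem flipOn_mk (hK : IsABClosed c α β K) (u w : V) :
    flipOn c α β K s(u, w) =
      if u ∈ K then (c s(u, w)).map (Equiv.swap α β) else c s(u, w) := by
  unfold flipOn
  by_cases hu : u ∈ K
  · have : ∃ x ∈ K, x ∈ s(u, w) := ⟨u, hu, by simp⟩
    simp only [this, if_true, hu]
  · by_cases hw : w ∈ K
    · have : ∃ x ∈ K, x ∈ s(u, w) := ⟨w, hw, by simp⟩
      simp only [this, if_true, hu, if_false]
      apply map_swap_of_ne
      · exact fun h => hu (hK w hw u (Or.inl (by rwa [Sym2.eq_swap])))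
      · exact fun h => hu (hK w hw u (Or.inr (by rwa [Sym2.eq_swap])))
    · have : ¬ ∃ x ∈ K, x ∈ s(u, w) := by
        rintro ⟨x, hx, hm⟩
        rcases Sym2.mem_iff.1 hm with rfl | rfl
        · exact hu hx
        · exact hw hx
      simp only [this, hu, if_false]

open Classical in
theorem map_swap_eq_some {o : Option (Fin (d + 1))} {γ : Fin (d + 1)} :
    o.map (Equiv.swap α β) = some γ ↔ o = some (Equiv.swap α β γ) := by
  cases o with
  | none => simp
  | some ζ => simp [Equiv.swap_apply_eq_iff]

open Classical in
theorem flipOn_mk_eq_some (hK : IsABClosed c α β K) (u w : V) (γ : Fin (d + 1)) :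
    flipOn c α β K s(u, w) = some γ ↔
      c s(u, w) = some (if u ∈ K then Equiv.swap α β γ else γ) := by
  rw [flipOn_mk hK]
  by_cases hu : u ∈ K
  · simp only [hu, if_true, map_swap_eq_some]
  · simp only [hu, if_false]

open Classical in
theorem mem_missing_flipOn (hK : IsABClosed c α β K) (u : V) (γ : Fin (d + 1)) :
    γ ∈ missing (flipOn c α β K) u ↔ (if u ∈ K then Equiv.swap α β γ else γ) ∈ missing c u := by
  simp only [missing, Set.mem_ofPred_eq, ne_eq, flipOn_mk_eq_some hK]

theorem missing_flipOn_of_not_mem (hK : IsABClosed c α β K) {u : V} (hu : u ∉ K) :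
    missing (flipOn c α β K) u = missing c u := by
  ext γ
  simp [mem_missing_flipOn hK, hu]

theorem mem_missing_flipOn_of_ne (hK : IsABClosed c α β K) (u : V) {γ : Fin (d + 1)} (hα : γ ≠ α)
    (hβ : γ ≠ β) : γ ∈ missing (flipOn c α β K) u ↔ γ ∈ missing c u := by
  rw [mem_missing_flipOn hK]
  simp [Equiv.swap_apply_of_ne_of_ne hα hβ]

theorem mem_missing_flipOn_left (hK : IsABClosed c α β K) {u : V} (hu : u ∈ K) :
    α ∈ missing (flipOn c α β K) u ↔ β ∈ missing c u := by
  rw [mem_missing_flipOn hK]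
  simp [hu]

theorem mem_missing_flipOn_right (hK : IsABClosed c α β K) {u : V} (hu : u ∈ K) :
    β ∈ missing (flipOn c α β K) u ↔ α ∈ missing c u := by
  rw [mem_missing_flipOn hK]
  simp [hu]

/-- This covers the inner vertices of a flipped path: both colors remain present, so fans do not
notice the flip there. -/
theorem missing_flipOn_of_full (hK : IsABClosed c α β K) {u : V} (hα : α ∉ missing c u)
    (hβ : β ∉ missing c u) : missing (flipOn c α β K) u = missing c u := by
  by_cases hu : u ∈ K
  · ext γ
    by_cases h₁ : γ = α
    · subst h₁; simp [mem_missing_flipOn_left hK hu, hα, hβ]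
    · by_cases h₂ : γ = β
      · subst h₂; simp [mem_missing_flipOn_right hK hu, hα, hβ]
      · exact mem_missing_flipOn_of_ne hK u h₁ h₂
  · exact missing_flipOn_of_not_mem hK hu

theorem flipOn_eq_none {e : Sym2 V} : flipOn c α β K e = none ↔ c e = none := by
  unfold flipOn
  split_ifs <;> simp

theorem flipOn_eq_some_of_ne {e : Sym2 V} {γ : Fin (d + 1)} (hα : γ ≠ α) (hβ : γ ≠ β) :
    flipOn c α β K e = some γ ↔ c e = some γ := by
  unfold flipOn
  split_ifs
  · rw [map_swap_eq_some, Equiv.swap_apply_of_ne_of_ne hα hβ]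
  · rfl

/-- A flip does not alter the subgraph of `αβ`-edges, hence neither its components nor the
closedness of the explored set. -/
theorem flipOn_eq_or {e : Sym2 V} :
    (flipOn c α β K e = some α ∨ flipOn c α β K e = some β) ↔ (c e = some α ∨ c e = some β) := by
  unfold flipOn
  split_ifs
  · rw [map_swap_eq_some, map_swap_eq_some, Equiv.swap_apply_left, Equiv.swap_apply_right, or_comm]
  · rfl

theorem IsABClosed.flipOn {X : Set V} (hX : IsABClosed c α β X) :
    IsABClosed (flipOn c α β K) α β X :=
  fun u hu w hw => hX u hu w (flipOn_eq_or.1 hw)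

theorem IsPartialEdgeColoring.flipOn (hc : IsPartialEdgeColoring G c) (hK : IsABClosed c α β K) :
    IsPartialEdgeColoring G (flipOn c α β K) := by
  refine ⟨fun e he => flipOn_eq_none.2 (hc.eq_none e he), fun v u w γ hu hw => ?_⟩
  rw [flipOn_mk_eq_some hK] at hu hw
  exact hc.proper _ _ _ _ hu hw

theorem colorCount_flipOn_none : colorCount G (flipOn c α β K) none = colorCount G c none := by
  simp [colorCount, flipOn_eq_none]

theorem colorCount_flipOn_of_ne {γ : Fin (d + 1)} (hα : γ ≠ α) (hβ : γ ≠ β) :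
    colorCount G (flipOn c α β K) (some γ) = colorCount G c (some γ) := by
  simp [colorCount, flipOn_eq_some_of_ne hα hβ]

theorem flipOn_comm : flipOn c α β K = flipOn c β α K := by
  unfold flipOn
  rw [Equiv.swap_comm]

theorem AltPath.flipOn {γ δ : Fin (d + 1)} {p : List V} {w : V} (h : AltPath c γ δ p w) :
    ∀ {K : Set V}, IsABClosed c γ δ K → (∀ a ∈ p, a ∈ K) →
      AltPath (EdgeColoring.flipOn c γ δ K) δ γ p w := by
  induction h with
  | last γ δ u hm =>
    intro K hK hp
    exact .last _ _ _ ((mem_missing_flipOn_right hK (hp u (by simp))).2 hm)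
  | cons γ δ u x p w hx _ ih =>
    intro K hK hp
    refine .cons _ _ _ _ _ _ ?_ ?_
    · rw [flipOn_mk_eq_some hK]
      simp [hp u (by simp), hx]
    · rw [flipOn_comm]
      exact ih hK.symm fun a ha => hp a (List.mem_cons_of_mem _ ha)

end Flip

/-! ### Walking along alternating paths and flipping them -/

section Walk

variable {V : Type} {d : ℕ} {G : SimpleGraph V}
  {c : Sym2 V → Option (Fin (d + 1))} {K : Set (Fan V d)} {S : Set V}

theorem wp_walk (hc : IsPartialEdgeColoring G c) {γ δ : Fin (d + 1)} {v w : V} {p : List V}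
    (hp : AltPath c γ δ (v :: p) w) {t : ℕ} {Q : List V × V → ℕ → State V d → Prop}
    (ht : 2 * (p.length + 1) ≤ t)
    (hQ : ∀ t', t ≤ t' + 2 * (p.length + 1) → Q (v :: p, w) t' ⟨c, K, S⟩) :
    wp (walk v γ δ) t ⟨c, K, S⟩ Q := by
  refine wp_loop (fun (q : List V × V × Fin (d + 1) × Fin (d + 1)) t' s =>
    s = ⟨c, K, S⟩ ∧ ∃ rest, AltPath c q.2.2.1 q.2.2.2 (q.2.1 :: rest) w ∧
      q.1 ++ rest = v :: p ∧ 2 * (rest.length + 1) ≤ t' ∧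
      t + 2 * (rest.length + 1) ≤ t' + 2 * (p.length + 1)) ?_ ?_
  · exact ⟨rfl, p, hp, rfl, ht, by omega⟩
  · rintro ⟨vis, u, γ', δ'⟩ t' s ⟨rfl, rest, hr, hvis, h₁, h₂⟩
    refine ⟨by omega, wp_bind (wp_lookup (by omega) ?_ ?_)⟩
    · intro x hx
      refine wp_pure ⟨rfl, ?_⟩
      dsimp only at hr hvis hx ⊢
      cases hr with
      | last _ _ _ hm => exact absurd hx (hm x)
      | cons _ _ _ y rest _ hy h =>
        obtain rfl := hc.proper _ _ _ _ hx hy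
        simp only [List.length_cons] at h₁ h₂
        exact ⟨rest, h, by simpa using hvis, by omega, by omega⟩
    · intro hm
      refine wp_pure ?_
      dsimp only at hr hvis hm ⊢
      cases hr with
      | last _ _ _ _ =>
        simp only [List.append_nil] at hvis
        subst hvis
        exact hQ _ (by simp at h₂; omega)
      | cons _ _ _ y rest _ hy h => exact absurd hy (hm y)

open Classical in
theorem wp_uncolorPath (p : List V) : ∀ (c : Sym2 V → Option (Fin (d + 1))) {t : ℕ}
    {Q : Unit → ℕ → State V d → Prop}, p.length ≤ t →
    (∀ t', t ≤ t' + p.length →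
      Q () t' ⟨fun e => if e ∈ pathEdges p then none else c e, K, S⟩) →
    wp (uncolorPath p) t ⟨c, K, S⟩ Q := by
  induction p with
  | nil => intro c t Q ht hQ; exact wp_pure (by simpa [pathEdges] using hQ t (by omega))
  | cons u p ih =>
    intro c t Q ht hQ
    cases p with
    | nil => exact wp_pure (by simpa [pathEdges] using hQ t (by omega))
    | cons w p =>
      simp only [List.length_cons] at ht hQ ih
      refine wp_bind (wp_uncolorEdge (by omega) (ih _ (by omega) ?_))
      intro t' ht'
      have : (fun e => if e ∈ pathEdges (w :: p) then none else recolor c u w none e) =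
          (fun e => if e ∈ pathEdges (u :: w :: p) then none else c e) := by
        funext e
        by_cases he : e = s(u, w)
        · subst he; simp [pathEdges, recolor_self]
        · simp [pathEdges, recolor_of_ne he, he]
      dsimp only
      rw [this]
      exact hQ t' (by omega)

/-- The current coloring `c` agrees with the proper target `c₀` off the edges still to be colored
and is empty on them. So `c` is a restriction of `c₀`, and each coloring is legal because `c₀` is
proper. -/
theorem wp_colorPath {c₀ : Sym2 V → Option (Fin (d + 1))} (hc : IsPartialEdgeColoring G c₀)
    {γ δ : Fin (d + 1)} {p : List V} {w : V} (hp : AltPath c₀ γ δ p w) :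
    ∀ {c : Sym2 V → Option (Fin (d + 1))} {t : ℕ} {Q : Unit → ℕ → State V d → Prop},
    p.Nodup → (∀ e, e ∉ pathEdges p → c e = c₀ e) → (∀ e ∈ pathEdges p, c e = none) →
    p.length ≤ t → (∀ t', t ≤ t' + p.length → Q () t' ⟨c₀, K, S⟩) →
    wp (colorPath G γ δ p) t ⟨c, K, S⟩ Q := by
  induction hp with
  | last γ δ u hm =>
    intro c t Q _ h₁ _ _ hQ
    have : c = c₀ := funext fun e => h₁ e (by simp [pathEdges])
    subst this
    exact wp_pure (hQ t (by omega))
  | cons γ δ u x p w hx _ ih =>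
    intro c t Q hnd h₁ h₂ ht hQ
    simp only [List.length_cons] at ht hQ ih
    have hle : ∀ e ζ, c e = some ζ → c₀ e = some ζ := by
      intro e ζ he
      by_cases hm : e ∈ pathEdges (u :: x :: p)
      · rw [h₂ e hm] at he; cases he
      · rwa [← h₁ e hm]
    have hnone : c s(u, x) = none := h₂ _ (by simp [pathEdges])
    have hx' : c₀ s(x, u) = some γ := by rw [Sym2.eq_swap]; exact hx
    refine wp_bind (wp_colorEdge (by omega) (hc.adj hx) hnone ?_ ?_
      (ih (List.nodup_cons.1 hnd).2 ?_ ?_ (by omega) fun t' ht' => hQ t' (by omega)))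
    · intro b hb
      have hb : c s(u, b) = some γ := hb
      rw [hc.proper _ _ _ _ (hle _ _ hb) hx, hnone] at hb
      cases hb
    · intro b hb
      have hb : c s(x, b) = some γ := hb
      rw [hc.proper _ _ _ _ (hle _ _ hb) hx', Sym2.eq_swap, hnone] at hb
      cases hb
    · intro e he
      by_cases h : e = s(u, x)
      · subst h; rw [recolor_self, hx]
      · rw [recolor_of_ne h]
        exact h₁ e (by simp [pathEdges, h, he])
    · intro e he
      have : e ≠ s(u, x) := by
        rintro rfl
        exact (List.nodup_cons.1 hnd).1 (mem_of_mem_pathEdges he (by simp))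
      rw [recolor_of_ne this]
      exact h₂ e (by simp [pathEdges, he])

/-- Here `δ` is the color known to be missing at `v`, so the path is a whole component and the
flipped coloring is proper. The factor 4 is two for the walk and one each for uncoloring and
coloring. -/
theorem wp_flipPath (hc : IsPartialEdgeColoring G c) {α β γ δ : Fin (d + 1)} {v w : V}
    {p : List V}
    (hγδ : (γ = β ∧ δ = α ∧ α ∈ missing c v) ∨
      (γ = α ∧ δ = β ∧ α ∉ missing c v ∧ β ∈ missing c v))
    (hp : AltPath c γ δ (v :: p) w) (hnd : (v :: p).Nodup) {t : ℕ}
    {Q : V → ℕ → State V d → Prop} (ht : 4 * (p.length + 1) + 1 ≤ t)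
    (hQ : ∀ t', t ≤ t' + 4 * (p.length + 1) + 1 →
      Q w t' ⟨flipOn c α β {x | x ∈ v :: p}, K, S⟩) :
    wp (flipPath G α β v) t ⟨c, K, S⟩ Q := by
  classical
  have hδ : δ ∈ missing c v := by
    rcases hγδ with ⟨-, rfl, h⟩ | ⟨-, rfl, -, h⟩ <;> exact h
  have hK := hp.isABClosed hc hδ
  have hc₀ := hc.flipOn hK
  have hp₀ := hp.flipOn hK (fun a ha => ha)
  have hflip : flipOn c γ δ {x | x ∈ v :: p} = flipOn c α β {x | x ∈ v :: p} := by
    rcases hγδ with ⟨rfl, rfl, -⟩ | ⟨rfl, rfl, -, -⟩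
    · exact flipOn_comm
    · rfl
  have main : ∀ t', t ≤ t' + 1 → wp (do
      let (q, x) ← walk v γ δ
      uncolorPath q
      colorPath G δ γ q
      return x) t' ⟨c, K, S⟩ Q := by
    intro t' ht'
    refine wp_bind (wp_walk hc hp (by omega) fun t₁ h₁ => ?_)
    refine wp_bind (wp_uncolorPath _ _ (by simp only [List.length_cons]; omega) fun t₂ h₂ => ?_)
    simp only [List.length_cons] at h₂
    refine wp_bind (wp_colorPath hc₀ hp₀ hnd ?_ ?_ (by simp only [List.length_cons]; omega)
      fun t₃ h₃ => ?_)
    · intro e he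
      simp only [he, if_false]
      induction e with
      | _ a b =>
      rw [flipOn_mk hK]
      -- An edge at a vertex of the path that is not an edge of the path has neither color, so the
      -- flip leaves it unchanged.
      by_cases ha : a ∈ v :: p
      · rw [if_pos (show a ∈ {x | x ∈ v :: p} from ha), map_swap_of_ne]
        · exact fun h => he (hp.mem_pathEdges_of_missing hc hδ ha h (Or.inl rfl))
        · exact fun h => he (hp.mem_pathEdges_of_missing hc hδ ha h (Or.inr rfl))
      · rw [if_neg (show a ∉ {x | x ∈ v :: p} from ha)]
    · intro e he
      simp only [he, if_true]
    · simp only [List.length_cons] at h₃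
      rw [hflip]
      exact wp_pure (hQ t₃ (by omega))
  refine wp_bind (wp_isMissing (by omega) ?_ ?_)
  · intro h
    rcases hγδ with ⟨rfl, rfl, -⟩ | ⟨rfl, rfl, h', -⟩
    · exact main _ (by omega)
    · exact absurd h h'
  · intro h
    rcases hγδ with ⟨rfl, rfl, h'⟩ | ⟨rfl, rfl, -, -⟩
    · exact absurd h' h
    · exact main _ (by omega)

end Walk

/-! ### Choosing the color -/

section Choose

variable {V : Type} [Fintype V] {d : ℕ} {G : SimpleGraph V} [DecidableRel G.Adj]
  {s : State V d}

theorem length_neighborList (v : V) : (neighborList G v).length = G.degree v := by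
  simp [neighborList]

theorem sum_vertexList (f : V → ℕ) : ((vertexList V).map f).sum = ∑ v, f v := by
  simp [vertexList]

theorem countP_vertexList (p : V → Prop) [DecidablePred p] :
    (vertexList V).countP (fun v => decide (p v)) = {v | p v}.ncard := by
  rw [Set.ncard_eq_toFinset_card']
  have : {v | p v}.toFinset = Finset.univ.filter p := by ext; simp
  rw [this, Finset.card_def, Finset.filter_val, ← Multiset.countP_eq_card_filter,
    ← Finset.coe_toList, Multiset.coe_countP]
  rfl

/-- By properness the colors present at `v` correspond to the colored edges at `v`. -/
theorem ncard_not_missing_add {c : Sym2 V → Option (Fin (d + 1))} (hc : IsPartialEdgeColoring G c)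
    (v : V) :
    {γ | γ ∉ missing c v}.ncard + {u | G.Adj v u ∧ c s(v, u) = none}.ncard = G.degree v := by
  have h₁ : {γ | γ ∉ missing c v}.ncard = {u | ∃ γ, c s(v, u) = some γ}.ncard := by
    have hex : ∀ γ, γ ∈ {γ | γ ∉ missing c v} → ∃ u, c s(v, u) = some γ :=
      fun γ hγ => not_mem_missing.1 hγ
    refine Set.ncard_congr (fun γ hγ => (hex γ hγ).choose) (fun γ hγ => ⟨γ, (hex γ hγ).choose_spec⟩)
      (fun γ δ hγ hδ h => ?_) fun u ⟨γ, hγ⟩ => ?_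
    · have h₁ := (hex γ hγ).choose_spec
      have h₂ := (hex δ hδ).choose_spec
      rw [h, h₂] at h₁
      exact (Option.some.inj h₁).symm
    · have hm : γ ∈ {γ | γ ∉ missing c v} := not_mem_missing.2 ⟨u, hγ⟩
      exact ⟨γ, hm, hc.proper v _ _ γ (hex γ hm).choose_spec hγ⟩
  rw [h₁, ← Set.ncard_union_eq, ← G.card_neighborFinset_eq_degree, ← Set.ncard_coe_finset]
  · congr 1
    ext u
    simp only [Set.mem_union, Set.mem_ofPred_eq, SimpleGraph.coe_neighborFinset,
      SimpleGraph.mem_neighborSet]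
    constructor
    · rintro (⟨γ, hγ⟩ | h)
      exacts [hc.adj hγ, h.1]
    · intro h
      cases hcol : c s(v, u) with
      | none => exact Or.inr ⟨h, rfl⟩
      | some γ => exact Or.inl ⟨γ, rfl⟩
  · rw [Set.disjoint_left]
    rintro u ⟨γ, hγ⟩ ⟨-, hn⟩
    simp [hγ] at hn

/-- There are `d + 1` colors for at most `d` edges. This surplus makes every set of missing colors
nonempty and drives the averaging over the colors. -/
theorem ncard_missing_gt {c : Sym2 V → Option (Fin (d + 1))} (hc : IsPartialEdgeColoring G c)
    (hdeg : ∀ v, G.degree v ≤ d) (v : V) :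
    {u | G.Adj v u ∧ c s(v, u) = none}.ncard < (missing c v).ncard := by
  have h₁ := ncard_not_missing_add hc v
  have h₂ := Set.ncard_add_ncard_compl (missing c v)
  have h₃ : (missing c v)ᶜ = {γ | γ ∉ missing c v} := rfl
  rw [Nat.card_fin, h₃] at h₂
  have := hdeg v
  omega

theorem missing_nonempty {c : Sym2 V → Option (Fin (d + 1))} (hc : IsPartialEdgeColoring G c)
    (hdeg : ∀ v, G.degree v ≤ d) (v : V) : (missing c v).Nonempty :=
  (Set.ncard_pos (Set.toFinite _)).1 ((Nat.zero_le _).trans_lt (ncard_missing_gt hc hdeg v))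

/-- The vertices that are incident to an uncolored edge. -/
def incomplete (G : SimpleGraph V) (c : Sym2 V → Option (Fin (d + 1))) : Set V :=
  {v | ∃ u, G.Adj v u ∧ c s(v, u) = none}

theorem wp_findIncomplete {t : ℕ} {Q : Set V → ℕ → State V d → Prop}
    (ht : ∑ v, (1 + 2 * G.degree v) ≤ t)
    (hQ : ∀ t', t ≤ t' + ∑ v, (1 + 2 * G.degree v) → Q (incomplete G s.color) t' s) :
    wp (findIncomplete G) t s Q := by
  classical
  refine wp_forList (fun l I t' s' => s' = s ∧ I ⊆ incomplete G s.color ∧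
      (∀ v ∈ incomplete G s.color, v ∈ I ∨ v ∈ l) ∧
      (l.map fun v => 1 + 2 * G.degree v).sum ≤ t' ∧
      t + (l.map fun v => 1 + 2 * G.degree v).sum ≤ t' + ∑ v, (1 + 2 * G.degree v)) ?_ ?_ _ _ _ _ ?_
  · rintro v l I t' s' ⟨rfl, h₁, h₂, h₃, h₄⟩
    simp only [List.map_cons, List.sum_cons] at h₃ h₄
    refine ⟨by omega, ?_⟩
    refine wp_forList (fun l' I' t'' s'' => s'' = s' ∧ I ⊆ I' ∧ I' ⊆ incomplete G s'.color ∧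
      (∀ u, G.Adj v u → s'.color s(v, u) = none → v ∈ I' ∨ u ∈ l') ∧ (∀ u ∈ l', G.Adj v u) ∧
      2 * l'.length ≤ t'' ∧ t' - 1 + 2 * l'.length ≤ t'' + 2 * G.degree v) ?_ ?_ _ _ _ _ ?_
    · rintro u l' I' t'' s'' ⟨rfl, k₁, k₂, k₃, k₆, k₄, k₅⟩
      simp only [List.length_cons] at k₄ k₅
      refine ⟨by omega, wp_bind (wp_readColor (by omega) ?_)⟩
      cases hu : s''.color s(v, u) with
      | none =>
        refine wp_pure ⟨rfl, k₁.trans (Set.subset_insert _ _), ?_, ?_,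
          fun x hx => k₆ x (by simp [hx]), by omega, by omega⟩
        · rintro x (rfl | hx)
          · exact ⟨u, k₆ u (by simp), hu⟩
          · exact k₂ hx
        · intro _ _ _; exact Or.inl (Set.mem_insert _ _)
      | some γ =>
        refine wp_pure ⟨rfl, k₁, k₂, ?_, fun x hx => k₆ x (by simp [hx]), by omega, by omega⟩
        intro x hx hx'
        rcases k₃ x hx hx' with h | h
        · exact Or.inl h
        · rcases List.mem_cons.1 h with rfl | h
          · rw [hu] at hx'; cases hx'
          · exact Or.inr h
    · rintro I' t'' s'' ⟨rfl, k₁, k₂, k₃, -, k₄, k₅⟩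
      simp only [List.length_nil] at k₄ k₅
      refine ⟨rfl, k₂, ?_, by omega, by omega⟩
      intro x hx
      rcases h₂ x hx with h | h
      · exact Or.inl (k₁ h)
      · rcases List.mem_cons.1 h with rfl | h
        · obtain ⟨u, hu, hu'⟩ := hx
          exact Or.inl ((k₃ u hu hu').resolve_right (by simp))
        · exact Or.inr h
    · refine ⟨rfl, subset_rfl, h₁, fun u hu _ => Or.inr (by simpa [neighborList] using hu),
        fun u hu => by simpa [neighborList] using hu, ?_, ?_⟩
      · rw [length_neighborList]; omega
      · rw [length_neighborList]
  · rintro I t' s' ⟨rfl, h₁, h₂, -, h₄⟩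
    have : I = incomplete G s'.color :=
      h₁.antisymm fun v hv => (h₂ v hv).resolve_right (by simp)
    rw [this]
    exact hQ t' (by simpa using h₄)
  · refine ⟨rfl, Set.empty_subset _, fun v _ => Or.inr (by simp [vertexList]), ?_, ?_⟩
    · rw [sum_vertexList]; exact ht
    · rw [sum_vertexList]

-- A vertex contributes at most one edge to the count of a color, so counting edges amounts to
-- counting vertices at which the color is present.
open Classical in
theorem countP_neighborList (hc : IsPartialEdgeColoring G s.color) (v : V) (γ : Fin (d + 1)) :
    (neighborList G v).countP (fun u => decide (s.color s(v, u) = some γ)) =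
      if γ ∈ missing s.color v then 0 else 1 := by
  split_ifs with h
  · rw [List.countP_eq_zero]
    intro u _
    simpa using h u
  · obtain ⟨u, hu⟩ := not_mem_missing.1 h
    have hnd : (neighborList G v).Nodup := Finset.nodup_toList _
    have hmem : u ∈ neighborList G v := by simpa [neighborList] using hc.adj hu
    refine Eq.trans ?_ (List.count_eq_one_of_mem hnd hmem)
    refine List.countP_congr fun x _ => ?_
    simp only [decide_eq_true_eq, beq_iff_eq]
    exact ⟨fun hx => hc.proper _ _ _ _ hx hu, fun hx => hx ▸ hu⟩

open Classical in
theorem wp_countColors (hc : IsPartialEdgeColoring G s.color) {I : Set V} {t : ℕ}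
    {Q : (Fin (d + 1) → ℕ) → ℕ → State V d → Prop}
    (ht : ∑ v, (1 + 2 * G.degree v) ≤ t)
    (hQ : ∀ t', t ≤ t' + ∑ v, (1 + 2 * G.degree v) →
      Q (fun γ => {v | v ∈ I ∧ γ ∉ missing s.color v}.ncard) t' s) :
    wp (countColors G I) t s Q := by
  refine wp_forList (fun l cnt t' s' => s' = s ∧
      (∀ γ, cnt γ + l.countP (fun v => decide (v ∈ I ∧ γ ∉ missing s.color v)) =
        {v | v ∈ I ∧ γ ∉ missing s.color v}.ncard) ∧
      (l.map fun v => 1 + 2 * G.degree v).sum ≤ t' ∧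
      t + (l.map fun v => 1 + 2 * G.degree v).sum ≤ t' + ∑ v, (1 + 2 * G.degree v)) ?_ ?_ _ _ _ _ ?_
  · rintro v l cnt t' s' ⟨rfl, h₁, h₃, h₄⟩
    simp only [List.map_cons, List.sum_cons] at h₃ h₄
    refine ⟨by omega, ?_⟩
    by_cases hv : v ∈ I
    · simp only [hv, if_true]
      refine wp_forList (fun l' cnt' t'' s'' => s'' = s' ∧
        (∀ γ, cnt' γ + l'.countP (fun u => decide (s'.color s(v, u) = some γ)) =
          cnt γ + if γ ∈ missing s'.color v then 0 else 1) ∧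
        2 * l'.length ≤ t'' ∧ t' - 1 + 2 * l'.length ≤ t'' + 2 * G.degree v) ?_ ?_ _ _ _ _ ?_
      · rintro u l' cnt' t'' s'' ⟨rfl, k₁, k₄, k₅⟩
        simp only [List.length_cons] at k₄ k₅
        refine ⟨by omega, wp_bind (wp_readColor (by omega) ?_)⟩
        cases hu : s''.color s(v, u) with
        | none =>
          refine wp_pure ⟨rfl, fun γ => ?_, by omega, by omega⟩
          rw [← k₁ γ, List.countP_cons]
          simp [hu]
        | some ζ =>
          refine wp_pure ⟨rfl, fun γ => ?_, by omega, by omega⟩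
          rw [← k₁ γ, List.countP_cons]
          by_cases hγ : γ = ζ
          · subst hγ; simp [hu]; omega
          · simp [hu, hγ, Ne.symm hγ]
      · rintro cnt' t'' s'' ⟨rfl, k₁, k₄, k₅⟩
        simp only [List.length_nil] at k₄ k₅
        refine ⟨rfl, fun γ => ?_, by omega, by omega⟩
        have h := k₁ γ
        have h' := h₁ γ
        rw [List.countP_cons] at h'
        by_cases hm : γ ∈ missing s''.color v <;> simp_all <;> omega
      · refine ⟨rfl, fun γ => by rw [countP_neighborList hc], ?_, ?_⟩
        · rw [length_neighborList]; omega
        · rw [length_neighborList]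
    · simp only [hv, if_false]
      refine wp_pure ⟨rfl, fun γ => ?_, by omega, by omega⟩
      rw [← h₁ γ, List.countP_cons]
      simp [hv]
  · rintro cnt t' s' ⟨rfl, h₁, h₃, h₄⟩
    have : cnt = fun γ => {v | v ∈ I ∧ γ ∉ missing s'.color v}.ncard := by
      funext γ; simpa using h₁ γ
    rw [this]
    exact hQ t' (by simpa using h₄)
  · refine ⟨rfl, fun γ => ?_, ?_, ?_⟩
    · rw [countP_vertexList]; simp
    · rw [sum_vertexList]; exact ht
    · rw [sum_vertexList]

/-- The sum does not depend on `γ`; therefore a color with lowest count has the largest set of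
incomplete vertices missing it. -/
theorem ncard_incompleteMissing_add (G : SimpleGraph V) (c : Sym2 V → Option (Fin (d + 1))) (γ : Fin (d + 1)) :
    (incompleteMissing G c γ).ncard + {v | v ∈ incomplete G c ∧ γ ∉ missing c v}.ncard =
      (incomplete G c).ncard := by
  rw [← Set.ncard_union_eq]
  · congr 1
    ext v
    simp only [incompleteMissing, incomplete, Set.mem_union, Set.mem_ofPred_eq]
    rw [← and_or_left, and_iff_left (em _)]
  · rw [Set.disjoint_left]
    rintro v ⟨_, h⟩ ⟨_, h'⟩
    exact h' h

-- The budget consists of two passes over all edges at all vertices, one pass over the colors, and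
-- two units per vertex for forming `I_α`.
open Classical in
theorem wp_chooseColor (hc : IsPartialEdgeColoring G s.color) {t : ℕ}
    {Q : Fin (d + 1) × Set V → ℕ → State V d → Prop}
    (ht : 4 * Fintype.card V + 4 * ∑ v, G.degree v + d + 1 ≤ t)
    (hQ : ∀ α t', t ≤ t' + (4 * Fintype.card V + 4 * ∑ v, G.degree v + d + 1) →
      (∀ β, (incompleteMissing G s.color β).ncard ≤ (incompleteMissing G s.color α).ncard) →
      Q (α, incompleteMissing G s.color α) t' s) :
    wp (chooseColor G) t s Q := by
  have hsum : ∑ v, (1 + 2 * G.degree v) = Fintype.card V + 2 * ∑ v, G.degree v := by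
    simp [Finset.sum_add_distrib, Finset.mul_sum]
  refine wp_bind (wp_findIncomplete (by omega) fun t₁ h₁ => ?_)
  refine wp_bind (wp_countColors hc (by omega) fun t₂ h₂ => ?_)
  set cnt : Fin (d + 1) → ℕ :=
    fun γ => {v | v ∈ incomplete G s.color ∧ γ ∉ missing s.color v}.ncard with hcnt
  refine wp_bind (wp_forList (fun l best t' s' => s' = s ∧ (∀ γ, γ ∈ l ∨ cnt best ≤ cnt γ) ∧
    l.length ≤ t' ∧ t₂ + l.length ≤ t' + (d + 1)) ?_ ?_ _ _ _ _ ?_)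
  · rintro γ l best t' s' ⟨rfl, k₁, k₂, k₃⟩
    simp only [List.length_cons] at k₂ k₃
    refine ⟨by omega, ?_⟩
    have key : ∀ b, (cnt b ≤ cnt best) → cnt b ≤ cnt γ → ∀ γ', γ' ∈ l ∨ cnt b ≤ cnt γ' := by
      intro b hb hb' γ'
      rcases k₁ γ' with h | h
      · rcases List.mem_cons.1 h with rfl | h
        · exact Or.inr hb'
        · exact Or.inl h
      · exact Or.inr (hb.trans h)
    split_ifs with h h'
    · exact wp_pure ⟨rfl, key γ h.le le_rfl, by omega, by omega⟩
    · refine wp_pick ⟨best, by simp⟩ ?_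
      rintro b (rfl | rfl)
      · exact ⟨rfl, key b le_rfl h'.ge, by omega, by omega⟩
      · exact ⟨rfl, key b h'.le le_rfl, by omega, by omega⟩
    · exact wp_pure ⟨rfl, key best le_rfl (by omega), by omega, by omega⟩
  · rintro α t₃ s' ⟨rfl, k₁, k₂, k₃⟩
    simp only [List.length_nil] at k₂ k₃
    refine wp_bind (wp_forList (fun l J t' s'' => s'' = s' ∧ J ⊆ incompleteMissing G s'.color α ∧
      (∀ v ∈ incompleteMissing G s'.color α, v ∈ J ∨ v ∈ l) ∧
      2 * l.length ≤ t' ∧ t₃ + 2 * l.length ≤ t' + 2 * Fintype.card V) ?_ ?_ _ _ _ _ ?_)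
    · rintro v l J t' s'' ⟨rfl, m₁, m₂, m₃, m₄⟩
      simp only [List.length_cons] at m₃ m₄
      refine ⟨by omega, ?_⟩
      by_cases hv : v ∈ incomplete G s''.color
      · simp only [hv, if_true]
        refine wp_bind (wp_isMissing (by omega) ?_ ?_)
        · intro hm
          refine wp_pure ⟨rfl, ?_, ?_, by omega, by omega⟩
          · rintro x (rfl | hx)
            · exact ⟨hv, hm⟩
            · exact m₁ hx
          · intro x hx
            rcases m₂ x hx with h | h
            · exact Or.inl (Set.mem_insert_of_mem _ h)
            · rcases List.mem_cons.1 h with rfl | h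
              · exact Or.inl (Set.mem_insert _ _)
              · exact Or.inr h
        · intro hm
          refine wp_pure ⟨rfl, m₁, fun x hx => ?_, by omega, by omega⟩
          rcases m₂ x hx with h | h
          · exact Or.inl h
          · rcases List.mem_cons.1 h with rfl | h
            · exact absurd hx.2 hm
            · exact Or.inr h
      · simp only [hv, if_false]
        refine wp_pure ⟨rfl, m₁, fun x hx => ?_, by omega, by omega⟩
        rcases m₂ x hx with h | h
        · exact Or.inl h
        · rcases List.mem_cons.1 h with rfl | h
          · exact absurd hx.1 hv
          · exact Or.inr h
    · rintro J t₄ s'' ⟨rfl, m₁, m₂, m₃, m₄⟩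
      simp only [List.length_nil] at m₃ m₄
      refine wp_pure ?_
      have : J = incompleteMissing G s''.color α :=
        m₁.antisymm fun v hv => (m₂ v hv).resolve_right (by simp)
      rw [this]
      refine hQ α t₄ (by omega) fun β => ?_
      have h₁ := ncard_incompleteMissing_add G s''.color α
      have h₂ := ncard_incompleteMissing_add G s''.color β
      have h₃ : cnt α ≤ cnt β := (k₁ β).resolve_left (by simp)
      simp only [hcnt] at h₃
      omega
    · have : (vertexList V).length = Fintype.card V := by simp [vertexList]
      refine ⟨rfl, Set.empty_subset _, fun v _ => Or.inr (by simp [vertexList]), ?_, ?_⟩ <;> omega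
  · exact ⟨rfl, fun γ => Or.inl (List.mem_finRange γ), by simp; omega, by simp⟩

end Choose

/-! ### Fans -/

section Fans

variable {V : Type} {d : ℕ} {G : SimpleGraph V} {c c' : Sym2 V → Option (Fin (d + 1))}
  {α : Fin (d + 1)} {used : Set (Fin (d + 1))} {F : Fan V d}

/-- The edges to the later leaves are colored by the chain condition while the first one is
uncolored. So the first leaf also differs from the others, and the whole list has no repetition. -/
theorem isCFan_iff {v : V} {xs : List V} :
    IsCFan G c α v xs ↔ α ∈ missing c v ∧ xs ≠ [] ∧ IsShiftable G c v xs := by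
  constructor
  · rintro ⟨hα, hadj, ⟨x, ys, rfl, hnd, hx⟩, hch⟩
    refine ⟨hα, by simp, hadj, ?_, by simpa using hx, hch⟩
    have : ∀ (l : List V) (a : V),
        (a :: l).IsChain (fun x y => ∃ γ, c s(v, y) = some γ ∧ γ ∈ missing c x) →
        ∀ b ∈ l, c s(v, b) ≠ none := by
      intro l
      induction l with
      | nil => simp
      | cons y l ih =>
        intro a h b hb
        obtain ⟨⟨γ, hγ, -⟩, h⟩ := List.isChain_cons_cons.1 h
        rcases List.mem_cons.1 hb with rfl | hb
        · rw [hγ]; simp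
        · exact ih y h b hb
    exact List.nodup_cons.2 ⟨fun h => this ys x hch x h hx, hnd⟩
  · rintro ⟨hα, hne, hadj, hnd, hhead, hch⟩
    obtain ⟨x, ys, rfl⟩ := List.exists_cons_of_ne_nil hne
    exact ⟨hα, hadj, ⟨x, ys, rfl, (List.nodup_cons.1 hnd).2, hhead x rfl⟩, hch⟩

theorem IsShiftable.left_of_append {v : V} {l₁ l₂ : List V} (h : IsShiftable G c v (l₁ ++ l₂)) :
    IsShiftable G c v l₁ := by
  refine ⟨fun x hx => h.adj x (by simp [hx]), (List.nodup_append.1 h.nodup).1, ?_,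
    h.chain.left_of_append⟩
  intro x hx
  refine h.head x ?_
  cases l₁ with
  | nil => simp at hx
  | cons a l => simpa using hx

theorem IsShiftable.concat {v x y : V} {l : List V} (h : IsShiftable G c v (l ++ [x]))
    (hc : IsPartialEdgeColoring G c) {β : Fin (d + 1)} (hβ : β ∈ missing c x)
    (hy : c s(v, y) = some β) (hyl : y ∉ l ++ [x]) : IsShiftable G c v (l ++ [x] ++ [y]) := by
  refine ⟨?_, ?_, ?_, ?_⟩
  · intro z hz
    rcases List.mem_append.1 hz with hz | hz
    · exact h.adj z hz
    · rw [List.mem_singleton.1 hz]; exact hc.adj hy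
  · rw [List.nodup_append]
    refine ⟨h.nodup, by simp, ?_⟩
    rintro a ha b hb rfl
    exact hyl (List.mem_singleton.1 hb ▸ ha)
  · intro z hz
    refine h.head z ?_
    cases l <;> simpa using hz
  · rw [List.isChain_append]
    refine ⟨h.chain, by simp, ?_⟩
    intro a ha b hb
    simp at ha hb
    subst ha hb
    exact ⟨β, hy, hβ⟩

theorem IsShiftable.mono {v : V} {xs : List V} (h : IsShiftable G c v xs)
    (hm : ∀ x ∈ xs, missing c x ⊆ missing c' x) (he : ∀ x ∈ xs, c' s(v, x) = c s(v, x)) :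
    IsShiftable G c' v xs := by
  refine ⟨h.adj, h.nodup, fun x hx => ?_, ?_⟩
  · rw [he x (List.mem_of_mem_head? hx)]; exact h.head x hx
  · refine h.chain.imp_of_mem_imp fun a b ha hb ⟨γ, hγ, hγ'⟩ => ?_
    exact ⟨γ, by rw [he b hb, hγ], hm a ha hγ'⟩

theorem IsShiftable.center_not_mem {v : V} {xs : List V} (h : IsShiftable G c v xs) : v ∉ xs :=
  fun hv => (h.adj v hv).ne rfl

theorem IsPrimedCFan.mono {v : V} {xs : List V} {b : Fin (d + 1)} (h : IsPrimedCFan G c α v xs b)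
    (hv : missing c v ⊆ missing c' v)
    (hm : ∀ x ∈ xs, missing c x ⊆ missing c' x) (he : ∀ x ∈ xs, c' s(v, x) = c s(v, x)) :
    IsPrimedCFan G c' α v xs b := by
  obtain ⟨hf, ⟨xk, hxk, hb⟩, hp⟩ := h
  obtain ⟨hα, hne, hs⟩ := isCFan_iff.1 hf
  refine ⟨isCFan_iff.2 ⟨hv hα, hne, hs.mono hm he⟩,
    ⟨xk, hxk, hm xk (List.mem_of_getLast? hxk) hb⟩, hp.imp (fun h => hv h) ?_⟩
  rintro ⟨x, hx, hx'⟩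
  exact ⟨x, hx, by rw [he x hx, hx']⟩

theorem IsUFan.mono {v : V} {L : Finset V} (h : IsUFan G c α v L)
    (hm : ∀ u, u = v ∨ u ∈ L → (α ∈ missing c' u ↔ α ∈ missing c u))
    (he : ∀ x ∈ L, c' s(v, x) = c s(v, x)) : IsUFan G c' α v L := by
  obtain ⟨h₁, h₂, h₃⟩ := h
  refine ⟨h₁, fun x hx => ?_, by rwa [hm v (Or.inl rfl)]⟩
  obtain ⟨h₄, h₅, h₆⟩ := h₂ x hx
  exact ⟨h₄, by rw [he x hx, h₅], by rwa [hm x (Or.inr hx)]⟩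

theorem IsUFan.center_not_mem {v : V} {L : Finset V} (h : IsUFan G c α v L) : v ∉ L :=
  fun hv => (h.2.1 v hv).1.ne rfl

/-- The conditions on a fan of the collection after the stages for the colors in `used`. -/
def Fan.Good (G : SimpleGraph V) (c : Sym2 V → Option (Fin (d + 1))) (α : Fin (d + 1))
    (used : Set (Fin (d + 1))) : Fan V d → Prop
  | .cfan v xs b => IsPrimedCFan G c α v xs b ∧ b ≠ α ∧ b ∉ used
  | .ufan v L => IsUFan G c α v L ∧ ∀ γ ∈ used, γ ∉ missing c v

/-- The conditions on a fan of the collection if only its vertex `z` may be damaged. -/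
def Fan.Weak (G : SimpleGraph V) (c : Sym2 V → Option (Fin (d + 1))) (α : Fin (d + 1))
    (used : Set (Fin (d + 1))) (z : V) (F : Fan V d) : Prop :=
  F.verts.ncard = F.size ∧ match F with
    | .cfan v xs b => ¬ (Fan.cfan v xs b).DamagedAt c α z → (Fan.cfan v xs b).Good G c α used
    | .ufan v L => 2 ≤ L.card ∧ (∀ x ∈ L, G.Adj v x ∧ c s(v, x) = none) ∧
        (∀ x ∈ L, x ≠ z → α ∈ missing c x) ∧ (v ≠ z → α ∉ missing c v) ∧
        ∀ γ ∈ used, γ ∉ missing c v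

theorem Fan.center_mem_verts (F : Fan V d) : F.center ∈ F.verts := by
  cases F <;> exact Set.mem_insert _ _

theorem ncard_verts_cfan {v : V} {xs : List V} (b : Fin (d + 1)) (h : IsShiftable G c v xs) :
    (Fan.cfan v xs b).verts.ncard = xs.length + 1 := by
  classical
  have hset : {x | x ∈ xs} = (xs.toFinset : Set V) := by ext; simp
  have : v ∉ {x | x ∈ xs} := h.center_not_mem
  simp only [Fan.verts]
  rw [Set.ncard_insert_of_notMem this (by rw [hset]; exact xs.toFinset.finite_toSet), hset,
    Set.ncard_coe_finset, List.toFinset_card_of_nodup h.nodup]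

theorem ncard_verts_ufan {v : V} {L : Finset V} (h : v ∉ L) :
    (Fan.ufan v L : Fan V d).verts.ncard = L.card + 1 := by
  simp only [Fan.verts]
  rw [Set.ncard_insert_of_notMem (by simpa using h) L.finite_toSet, Set.ncard_coe_finset]

theorem Fan.Good.ncard_verts (h : F.Good G c α used) : F.verts.ncard = F.size := by
  cases F with
  | cfan v xs b => exact ncard_verts_cfan b (isCFan_iff.1 h.1.1).2.2
  | ufan v L => exact ncard_verts_ufan h.1.center_not_mem

theorem Fan.Good.weak (h : F.Good G c α used) (z : V) : F.Weak G c α used z := by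
  refine ⟨h.ncard_verts, ?_⟩
  cases F with
  | cfan v xs b => exact fun _ => h
  | ufan v L =>
    exact ⟨h.1.1, fun x hx => ⟨(h.1.2.1 x hx).1, (h.1.2.1 x hx).2.1⟩,
      fun x hx _ => (h.1.2.1 x hx).2.2, fun _ => h.1.2.2, h.2⟩

theorem Fan.DamagedAt.mem_verts {w : V} (h : F.DamagedAt c α w) : w ∈ F.verts := by
  cases F with
  | cfan v xs b =>
    rcases h with ⟨rfl, -⟩ | ⟨l₁, y, l₂, rfl, -⟩ | ⟨h, -⟩
    · exact Set.mem_insert _ _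
    · exact Set.mem_insert_of_mem _ (by simp)
    · exact Set.mem_insert_of_mem _ (List.mem_of_getLast? h)
  | ufan v L =>
    rcases h with ⟨rfl, -⟩ | ⟨h, -⟩
    · exact Set.mem_insert _ _
    · exact Set.mem_insert_of_mem _ h

theorem Fan.Good.not_damagedAt (h : F.Good G c α used) (w : V) :
    ¬ F.DamagedAt c α w := by
  cases F with
  | cfan v xs b =>
    obtain ⟨⟨hf, ⟨xk, hxk, hb⟩, hp⟩, -⟩ := h
    rintro (⟨rfl, h⟩ | ⟨l₁, y, l₂, hl, h⟩ | ⟨h, h'⟩)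
    · exact h ⟨hf.1, hp⟩
    · exact h (List.isChain_iff_forall_rel_of_append_cons_cons.1 hf.2.2.2 hl)
    · rw [Option.mem_def.1 hxk] at h
      cases h
      exact h' hb
  | ufan v L =>
    rintro (⟨rfl, h'⟩ | ⟨hw, h'⟩)
    · exact h.1.2.2 h'
    · exact h' (h.1.2.1 w hw).2.2

theorem Fan.Weak.good_of_not_damagedAt {z : V} (h : F.Weak G c α used z)
    (hz : ¬ F.DamagedAt c α z) : F.Good G c α used := by
  cases F with
  | cfan v xs b => exact h.2 hz
  | ufan v L =>
    obtain ⟨-, h₁, h₂, h₃, h₄, h₅⟩ := h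
    refine ⟨⟨h₁, fun x hx => ⟨(h₂ x hx).1, (h₂ x hx).2, ?_⟩, ?_⟩, h₅⟩
    · by_cases hxz : x = z
      · subst hxz
        by_contra hcon
        exact hz (Or.inr ⟨hx, hcon⟩)
      · exact h₃ x hx hxz
    · by_cases hvz : v = z
      · subst hvz
        exact fun hcon => hz (Or.inl ⟨rfl, hcon⟩)
      · exact h₄ hvz

theorem Fan.Weak.good {z : V} (h : F.Weak G c α used z) (hz : z ∉ F.verts) :
    F.Good G c α used :=
  h.good_of_not_damagedAt fun hd => hz hd.mem_verts

/-- The colorings `c` and `c'` do not differ as far as the fan `F` is concerned. -/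
def Fan.SameOn (c c' : Sym2 V → Option (Fin (d + 1))) (F : Fan V d) : Prop :=
  (∀ u ∈ F.verts, missing c' u = missing c u) ∧
    ∀ x ∈ F.verts, c' s(F.center, x) = c s(F.center, x)

theorem Fan.SameOn.trans {c'' : Sym2 V → Option (Fin (d + 1))} (h : F.SameOn c c')
    (h' : F.SameOn c' c'') : F.SameOn c c'' :=
  ⟨fun u hu => (h'.1 u hu).trans (h.1 u hu), fun x hx => (h'.2 x hx).trans (h.2 x hx)⟩

theorem Fan.SameOn.good (h : F.SameOn c c') (hF : F.Good G c α used) : F.Good G c' α used := by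
  cases F with
  | cfan v xs b =>
    refine ⟨hF.1.mono (h.1 v (Set.mem_insert _ _)).superset
      (fun x hx => (h.1 x (Set.mem_insert_of_mem _ hx)).superset)
      (fun x hx => h.2 x (Set.mem_insert_of_mem _ hx)), hF.2⟩
  | ufan v L =>
    have hv := h.1 v (Set.mem_insert _ _)
    refine ⟨hF.1.mono ?_ (fun x hx => h.2 x (Set.mem_insert_of_mem _ hx)), by rw [hv]; exact hF.2⟩
    rintro u (rfl | hu)
    · rw [hv]
    · rw [h.1 u (Set.mem_insert_of_mem _ hu)]

theorem Fan.SameOn.damagedAt {w : V} (h : F.SameOn c c') (hF : F.DamagedAt c α w) :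
    F.DamagedAt c' α w := by
  cases F with
  | cfan v xs b =>
    have hv := h.1 v (Set.mem_insert _ _)
    have hx : ∀ x ∈ xs, missing c' x = missing c x := fun x hx =>
      h.1 x (Set.mem_insert_of_mem _ hx)
    have he : ∀ x ∈ xs, c' s(v, x) = c s(v, x) := fun x hx => h.2 x (Set.mem_insert_of_mem _ hx)
    rcases hF with ⟨rfl, hn⟩ | ⟨l₁, y, l₂, hl, hn⟩ | ⟨hl, hn⟩
    · refine Or.inl ⟨rfl, fun hcon => hn ⟨hv ▸ hcon.1, hcon.2.imp (fun h => hv ▸ h) ?_⟩⟩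
      rintro ⟨x, hx, hx'⟩
      exact ⟨x, hx, by rw [← he x hx, hx']⟩
    · refine Or.inr (Or.inl ⟨l₁, y, l₂, hl, ?_⟩)
      rw [he y (by simp [hl]), hx w (by simp [hl])]
      exact hn
    · refine Or.inr (Or.inr ⟨hl, ?_⟩)
      rw [hx w (List.mem_of_getLast? hl)]
      exact hn
  | ufan v L =>
    rcases hF with ⟨rfl, hn⟩ | ⟨hw, hn⟩
    · exact Or.inl ⟨rfl, by rwa [h.1 w (Set.mem_insert _ _)]⟩
    · exact Or.inr ⟨hw, by rwa [h.1 w (Set.mem_insert_of_mem _ hw)]⟩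

theorem Fan.SameOn.weak {z : V} (h : F.SameOn c c') (hF : F.Weak G c α used z) :
    F.Weak G c' α used z := by
  refine ⟨hF.1, ?_⟩
  cases F with
  | cfan v xs b => exact fun hn => h.good (hF.2 fun hd => hn (h.damagedAt hd))
  | ufan v L =>
    obtain ⟨-, h₁, h₂, h₃, h₄, h₅⟩ := hF
    have hv := h.1 v (Set.mem_insert _ _)
    refine ⟨h₁, fun x hx => ⟨(h₂ x hx).1, ?_⟩, fun x hx hxz => ?_, ?_, ?_⟩
    · exact (h.2 x (Set.mem_insert_of_mem _ hx)).trans (h₂ x hx).2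
    · rw [h.1 x (Set.mem_insert_of_mem _ hx)]; exact h₃ x hx hxz
    · rw [hv]; exact h₄
    · rw [hv]; exact h₅

theorem Fan.sameOn_recolor {u w : V} {β : Fin (d + 1)} (h : c s(u, w) = none) (hu : u ∉ F.verts)
    (hw : w ∉ F.verts) : F.SameOn c (recolor c u w (some β)) := by
  refine ⟨fun x hx => missing_recolor_some_of_ne h (fun h => hu (h ▸ hx)) fun h => hw (h ▸ hx),
    fun x _ => recolor_of_ne fun he => ?_⟩
  rcases Sym2.eq_iff.1 he with ⟨h, -⟩ | ⟨h, -⟩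
  · exact hu (h ▸ F.center_mem_verts)
  · exact hw (h ▸ F.center_mem_verts)

/-- A shift affects only edges from the center to leaves, and missing colors only at leaves;
disjointness of the fans protects the others. -/
theorem IsShifted.sameOn {v z : V} {xs : List V} (h : IsShifted G c c' v xs z) (hv : v ∉ F.verts)
    (hxs : ∀ x ∈ xs, x ∉ F.verts) : F.SameOn c c' := by
  refine ⟨fun u hu => h.missing_of_not_mem u fun hx => hxs u hx hu,
    fun x hx => h.eq_of_ne _ fun y hy he => ?_⟩
  rcases Sym2.eq_iff.1 he with ⟨h, -⟩ | ⟨-, h⟩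
  · exact hv (h ▸ F.center_mem_verts)
  · exact hv (h ▸ hx)

/-- Flipping a path damages a fan at most at the other end of the path. -/
theorem Fan.Good.weak_flipOn (hc : IsPartialEdgeColoring G c) {β γ δ : Fin (d + 1)}
    (hγδ : (γ = α ∧ δ = β) ∨ (γ = β ∧ δ = α)) {x e : V} {p : List V}
    (hp : AltPath c γ δ (x :: p) e) (hx : δ ∈ missing c x) (hα : α ∉ used) (hβ : β ∉ used)
    (hF : F.Good G c α used) (hxF : x ∉ F.verts) :
    F.Weak G (flipOn c α β {a | a ∈ x :: p}) α used e := by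
  have hK : IsABClosed c α β {a | a ∈ x :: p} := by
    have := hp.isABClosed hc hx
    rcases hγδ with ⟨rfl, rfl⟩ | ⟨rfl, rfl⟩
    · exact this
    · exact this.symm
  have hfull : ∀ u ∈ F.verts, u ≠ e → u ∈ x :: p → α ∉ missing c u ∧ β ∉ missing c u := by
    intro u hu hue hup
    obtain ⟨h₁, h₂⟩ := hp.not_mem_missing rfl hup hue
    have h₂ := h₂ fun h => hxF (h ▸ hu)
    rcases hγδ with ⟨rfl, rfl⟩ | ⟨rfl, rfl⟩
    · exact ⟨h₁, h₂⟩
    · exact ⟨h₂, h₁⟩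
  have hsame : ∀ u ∈ F.verts, u ≠ e →
      missing (flipOn c α β {a | a ∈ x :: p}) u = missing c u := by
    intro u hu hue
    by_cases hup : u ∈ x :: p
    · obtain ⟨h₁, h₂⟩ := hfull u hu hue hup
      exact missing_flipOn_of_full hK h₁ h₂
    · exact missing_flipOn_of_not_mem hK hup
  refine ⟨hF.ncard_verts, ?_⟩
  set c' := flipOn c α β {a | a ∈ x :: p} with hc'
  cases F with
  | cfan v xs b =>
    intro hnd
    obtain ⟨⟨hf, ⟨xk, hxk, hb⟩, hp'⟩, hbα, hbp⟩ := hF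
    -- The center of a c-fan misses `α`. If it were the far end of the path it would have `β`, so
    -- after the flip it would have `α` and the fan would be damaged at `e`, contrary to `hnd`.
    have hve : v ≠ e := by
      rintro rfl
      have hvx : v ≠ x := fun h => hxF (h ▸ Set.mem_insert _ _)
      have hβv : β ∉ missing c v := by
        have hαv := hf.1
        rcases hp.missing_last with ⟨h, -⟩ | ⟨h₁, h₂⟩ | ⟨h₁, h₂⟩
        · exact absurd (by cases h; rfl) hvx
        · rcases hγδ with ⟨rfl, rfl⟩ | ⟨rfl, rfl⟩
          · exact h₂
          · exact absurd hαv h₂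
        · rcases hγδ with ⟨rfl, rfl⟩ | ⟨rfl, rfl⟩
          · exact absurd hαv h₂
          · exact h₂
      refine hnd (Or.inl ⟨rfl, fun h => hβv ?_⟩)
      exact (mem_missing_flipOn_left hK hp.last_mem).1 h.1
    have hvK : v ∉ x :: p := fun h => (hfull v (Set.mem_insert _ _) hve h).1 hf.1
    have hv := hsame v (Set.mem_insert _ _) hve
    have he : ∀ y, c' s(v, y) = c s(v, y) := by
      intro y
      rw [hc', flipOn_mk hK]
      exact if_neg hvK
    obtain ⟨hα', hadj, ⟨x₀, ys, hxs, hnd', hx₀⟩, hch⟩ := hf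
    refine ⟨⟨⟨hv ▸ hα', hadj, ⟨x₀, ys, hxs, hnd', by rw [he, hx₀]⟩, ?_⟩, ⟨xk, hxk, ?_⟩, ?_⟩,
      hbα, hbp⟩
    · rw [List.isChain_iff_forall_rel_of_append_cons_cons] at hch ⊢
      intro a y l₁ l₂ hl
      by_cases hae : a = e
      · subst hae
        by_contra hcon
        exact hnd (Or.inr (Or.inl ⟨l₁, y, l₂, hl, hcon⟩))
      · rw [he, hsame a (Set.mem_insert_of_mem _ (by simp [hl])) hae]
        exact hch hl
    · by_cases hke : xk = e
      · subst hke
        by_contra hcon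
        exact hnd (Or.inr (Or.inr ⟨hxk, hcon⟩))
      · rw [hsame xk (Set.mem_insert_of_mem _ (List.mem_of_getLast? hxk)) hke]
        exact hb
    · rw [hv]
      simpa only [he] using hp'
  | ufan v L =>
    obtain ⟨⟨h₁, h₂, h₃⟩, h₄⟩ := hF
    refine ⟨h₁, fun y hy => ⟨(h₂ y hy).1, flipOn_eq_none.2 (h₂ y hy).2.1⟩, fun y hy hye => ?_,
      fun hve => ?_, fun γ hγ => ?_⟩
    · rw [hsame y (Set.mem_insert_of_mem _ hy) hye]
      exact (h₂ y hy).2.2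
    · rw [hsame v (Set.mem_insert _ _) hve]
      exact h₃
    · rw [hc', mem_missing_flipOn_of_ne hK v (fun h => hα (h ▸ hγ)) (fun h => hβ (h ▸ hγ))]
      exact h₄ γ hγ

end Fans

/-! ### Collections -/

section Collections

variable {V : Type} {d : ℕ} {F : Fan V d} {K : Set (Fan V d)}

/-- The vertices of the fans of a collection. -/
def cover (K : Set (Fan V d)) : Set V := {u | ∃ F ∈ K, u ∈ F.verts}

/-- The vertices that are counted for a fan: the center of a c-fan, the leaves of a u-fan. -/
def Fan.tok : Fan V d → Set V
  | .cfan v _ _ => {v}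
  | .ufan _ L => L

/-- The vertices that are counted for a collection. -/
def tok (K : Set (Fan V d)) : Set V := {u | ∃ F ∈ K, u ∈ F.tok}

theorem Fan.tok_subset (F : Fan V d) : F.tok ⊆ F.verts := by
  cases F with
  | cfan => exact Set.singleton_subset_iff.2 (Set.mem_insert _ _)
  | ufan => exact Set.subset_insert _ _

theorem not_mem_of_disjoint_cover (h : ∀ u ∈ F.verts, u ∉ cover K) : F ∉ K :=
  fun hF => h F.center F.center_mem_verts ⟨F, hF, F.center_mem_verts⟩

theorem insert_diff_of_disjoint_cover (h : ∀ u ∈ F.verts, u ∉ cover K) :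
    insert F K \ {F} = K :=
  Set.insert_sdiff_self_of_notMem (not_mem_of_disjoint_cover h)

theorem cover_insert : cover (insert F K) = F.verts ∪ cover K := by
  ext u
  simp [cover]

theorem tok_insert : tok (insert F K) = F.tok ∪ tok K := by
  ext u
  simp [tok]

theorem tok_subset_cover : tok K ⊆ cover K :=
  fun _ ⟨F, hF, hu⟩ => ⟨F, hF, F.tok_subset hu⟩

theorem ncard_cover_insert [Finite V] (h : ∀ u ∈ F.verts, u ∉ cover K) :
    (cover (insert F K)).ncard = F.verts.ncard + (cover K).ncard := by
  rw [cover_insert, Set.ncard_union_eq (Set.disjoint_left.2 h)]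

theorem ncard_tok_insert [Finite V] (h : ∀ u ∈ F.verts, u ∉ cover K) :
    (tok (insert F K)).ncard = F.tok.ncard + (tok K).ncard := by
  rw [tok_insert, Set.ncard_union_eq (Set.disjoint_left.2 fun u hu hu' =>
    h u (F.tok_subset hu) (tok_subset_cover hu'))]

theorem pairwiseDisjoint_insert (hK : K.PairwiseDisjoint Fan.verts)
    (h : ∀ u ∈ F.verts, u ∉ cover K) : (insert F K).PairwiseDisjoint Fan.verts :=
  hK.insert fun F' hF' _ => Set.disjoint_left.2 fun u hu hu' => h u hu ⟨F', hF', hu'⟩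

theorem exists_eq_insert {K' : Set (Fan V d)} (hK : K'.PairwiseDisjoint Fan.verts) (hF : F ∈ K') :
    ∃ K, K' = insert F K ∧ K.PairwiseDisjoint Fan.verts ∧ ∀ u ∈ F.verts, u ∉ cover K := by
  refine ⟨K' \ {F}, by simp [Set.insert_eq_of_mem hF], hK.subset Set.sdiff_subset, ?_⟩
  rintro u hu ⟨F', ⟨hF', hne⟩, hu'⟩
  exact Set.disjoint_left.1 (hK hF' hF hne) hu' hu

theorem ncard_tok_cfan (v : V) (xs : List V) (b : Fin (d + 1)) :
    (Fan.cfan v xs b).tok.ncard = 1 := Set.ncard_singleton v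

theorem ncard_tok_ufan (v : V) (L : Finset V) : (Fan.ufan v L : Fan V d).tok.ncard = L.card :=
  Set.ncard_coe_finset L

end Collections

/-! ### Building the collection -/

section Build

variable {V : Type} {d : ℕ} {G : SimpleGraph V} {c c' : Sym2 V → Option (Fin (d + 1))}
  {α : Fin (d + 1)} {K : Set (Fan V d)} {S : Set V}

/-- The color `α` is present at all the leaves of the c-fan. -/
def Fan.Fresh (c : Sym2 V → Option (Fin (d + 1))) (α : Fin (d + 1)) : Fan V d → Prop
  | .cfan _ xs _ => ∀ x ∈ xs, α ∉ missing c x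
  | .ufan _ _ => True

theorem Fan.SameOn.fresh {F : Fan V d} (h : F.SameOn c c') (hF : F.Fresh c α) :
    F.Fresh c' α := by
  cases F with
  | cfan v xs b =>
    intro x hx
    rw [h.1 x (Set.mem_insert_of_mem _ hx)]
    exact hF x hx
  | ufan => trivial

/-- The invariant of Build-Collection. -/
structure BuildInv (G : SimpleGraph V) (c : Sym2 V → Option (Fin (d + 1))) (α : Fin (d + 1))
    (K : Set (Fan V d)) (S : Set V) : Prop where
  isPartial : IsPartialEdgeColoring G c
  disjoint : K.PairwiseDisjoint Fan.verts
  good : ∀ F ∈ K, F.Good G c α ∅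
  fresh : ∀ F ∈ K, F.Fresh c α
  pending : ∀ v ∈ S, v ∉ cover K ∧ α ∈ missing c v ∧ ∃ u, G.Adj v u ∧ c s(v, u) = none

theorem BuildInv.transfer (h : BuildInv G c α K S) (hc' : IsPartialEdgeColoring G c')
    {K' : Set (Fan V d)} {S' : Set V} (hK : K' ⊆ K) (hS : S' ⊆ S)
    (hF : ∀ F ∈ K', F.SameOn c c')
    (hw : ∀ w ∈ S', (α ∈ missing c w → α ∈ missing c' w) ∧ ∀ u, c' s(w, u) = c s(w, u)) :
    BuildInv G c' α K' S' := by
  refine ⟨hc', h.disjoint.subset hK, fun F hF' => (hF F hF').good (h.good F (hK hF')),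
    fun F hF' => (hF F hF').fresh (h.fresh F (hK hF')), fun w hwS => ?_⟩
  obtain ⟨h₁, h₂, u, hu, hu'⟩ := h.pending w (hS hwS)
  refine ⟨?_, (hw w hwS).1 h₂, u, hu, by rw [(hw w hwS).2, hu']⟩
  rintro ⟨F, hF', hm⟩
  exact h₁ ⟨F, hK hF', hm⟩

theorem BuildInv.insert (h : BuildInv G c α K S) {F : Fan V d} (hF : F.Good G c α ∅)
    (hF' : F.Fresh c α) (hd : ∀ u ∈ F.verts, u ∉ cover K) (hS : ∀ u ∈ F.verts, u ∉ S) :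
    BuildInv G c α (insert F K) S := by
  refine ⟨h.isPartial, pairwiseDisjoint_insert h.disjoint hd, ?_, ?_, fun w hw => ⟨?_, ?_⟩⟩
  · rintro F' (rfl | hF'')
    · exact hF
    · exact h.good F' hF''
  · rintro F' (rfl | hF'')
    · exact hF'
    · exact h.fresh F' hF''
  · rw [cover_insert]
    rintro (hw' | hw')
    · exact hS w hw' hw
    · exact (h.pending w hw).1 hw'
  · exact (h.pending w hw).2

theorem IsShifted.mk_eq {v z w : V} {xs : List V} (h : IsShifted G c c' v xs z) (hv : w ≠ v)
    (hxs : w ∉ xs) (u : V) : c' s(w, u) = c s(w, u) := by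
  refine h.eq_of_ne _ fun y hy he => ?_
  rcases Sym2.eq_iff.1 he with ⟨h, -⟩ | ⟨h, -⟩
  · exact hv h
  · exact hxs (h ▸ hy)

theorem recolor_mk_of_ne {u w a : V} {o : Option (Fin (d + 1))} (hu : a ≠ u) (hw : a ≠ w) (b : V) :
    recolor c u w o s(a, b) = c s(a, b) := by
  refine recolor_of_ne fun he => ?_
  rcases Sym2.eq_iff.1 he with ⟨h, -⟩ | ⟨h, -⟩
  · exact hu h
  · exact hw h

theorem BuildInv.shift (h : BuildInv G c α K S) {v z : V} {xs : List V}
    (hs : IsShifted G c c' v xs z) {K' : Set (Fan V d)} {S' : Set V} (hK : K' ⊆ K) (hS : S' ⊆ S)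
    (hvα : α ∈ missing c v) (hv : v ∉ cover K') (hxs : ∀ x ∈ xs, x ∉ cover K')
    (hvS : v ∉ S') (hxS : ∀ x ∈ xs, x ∉ S') : BuildInv G c' α K' S' := by
  refine h.transfer hs.isPartial hK hS (fun F hF => hs.sameOn (fun h => hv ⟨F, hF, h⟩)
    fun x hx h => hxs x hx ⟨F, hF, h⟩) fun w hw => ⟨(hs.mem_missing_iff hvα w).2, ?_⟩
  exact hs.mk_eq (fun h => hvS (h ▸ hw)) fun h => hxS w h hw

theorem BuildInv.recolor (h : BuildInv G c α K S) {v x : V} (hadj : G.Adj v x)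
    (hn : c s(v, x) = none) (hvα : α ∈ missing c v) (hxα : α ∈ missing c x)
    (hv : v ∉ cover K) (hx : x ∉ cover K) (hvS : v ∉ S) (hxS : x ∉ S) :
    BuildInv G (recolor c v x (some α)) α K S := by
  refine h.transfer (h.isPartial.recolor_some hadj hvα hxα) subset_rfl subset_rfl
    (fun F hF => Fan.sameOn_recolor hn (fun h => hv ⟨F, hF, h⟩) fun h => hx ⟨F, hF, h⟩)
    fun w hw => ?_
  have h₁ : w ≠ v := fun h => hvS (h ▸ hw)
  have h₂ : w ≠ x := fun h => hxS (h ▸ hw)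
  rw [missing_recolor_some_of_ne hn h₁ h₂]
  exact ⟨id, recolor_mk_of_ne h₁ h₂⟩

variable [Fintype V]

theorem IsShiftable.length_le [DecidableRel G.Adj] {v : V} {xs : List V}
    (h : IsShiftable G c v xs) : xs.length ≤ G.degree v := by
  classical
  rw [← List.toFinset_card_of_nodup h.nodup, ← SimpleGraph.card_neighborFinset_eq_degree]
  refine Finset.card_le_card fun x hx => ?_
  rw [SimpleGraph.mem_neighborFinset]
  exact h.adj x (by simpa using hx)

/-- What is needed to continue after a fan with center `v` has been built and treated. -/
def BuildPost (G : SimpleGraph V) (c : Sym2 V → Option (Fin (d + 1))) (α : Fin (d + 1))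
    (K : Set (Fan V d)) (S : Set V) (t k : ℕ) (Q : Unit → ℕ → State V d → Prop) : Prop :=
  ∀ c' K' S' t', BuildInv G c' α K' S' → S' ⊆ S →
    t + 5 * (cover K').ncard ≤ t' + 5 * (cover K).ncard + k →
    1 + S.ncard + (tok K).ncard + 7 * colorCount G c' none ≤
      S'.ncard + (tok K').ncard + 7 * colorCount G c none →
    Q () t' ⟨c', K', S'⟩

open Classical in
/-- The sum of the degrees of the vertices in `S`. -/
def degSum (G : SimpleGraph V) [DecidableRel G.Adj] (S : Set V) : ℕ :=
  ∑ v, if v ∈ S then G.degree v else 0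

theorem degSum_mono [DecidableRel G.Adj] {S S' : Set V} (h : S' ⊆ S) :
    degSum G S' ≤ degSum G S := by
  refine Finset.sum_le_sum fun v _ => ?_
  by_cases hv : v ∈ S'
  · simp [hv, h hv]
  · simp [hv]

theorem degSum_diff [DecidableRel G.Adj] {v : V} (h : v ∈ S) :
    degSum G (S \ {v}) + G.degree v = degSum G S := by
  classical
  have h₁ : degSum G S = ∑ u, ((if u ∈ S \ {v} then G.degree u else 0) +
      if u = v then G.degree u else 0) := by
    refine Finset.sum_congr rfl fun u _ => ?_
    by_cases huv : u = v
    · subst huv; simp [h]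
    · by_cases hu : u ∈ S <;> simp [huv, hu]
  rw [h₁, Finset.sum_add_distrib]
  simp [degSum]

variable [DecidableEq V]

/-- The vertex `v`, already removed from `S`, must be compensated. Turning a c-fan into a u-fan
raises its one token to two, and a new leaf of a u-fan is a new token. In the two other cases an
edge is colored, which is worth 7, and at most two tokens disappear. Shifting and discarding `F`
costs up to 5 per vertex; this is released by the covered vertices. -/
theorem wp_mergeFans {v x : V} {pre : List V} {F : Fan V d} {t : ℕ}
    {Q : Unit → ℕ → State V d → Prop} (h : BuildInv G c α K S) (hF : F ∈ K) (hx : x ∈ F.verts)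
    (hs : IsShiftable G c v (pre ++ [x])) (hvα : α ∈ missing c v) (hvS : v ∉ S)
    (hvK : v ∉ cover K) (hpre : ∀ y ∈ pre, y ∉ cover K ∧ α ∉ missing c y)
    (ht : 4 * (pre.length + 1) + 5 * (cover K).ncard + 10 ≤ t)
    (hQ : BuildPost G c α K S t (4 * (pre.length + 1) + 20) Q) :
    wp (mergeFans G α v (pre ++ [x]) x F) t ⟨c, K, S⟩ Q := by
  obtain ⟨K₀, rfl, hK₀, hd⟩ := exists_eq_insert h.disjoint hF
  have hgood := h.good F hF
  have hfresh := h.fresh F hF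
  have hcov := ncard_cover_insert hd
  have htok := ncard_tok_insert hd
  have hsub : K₀ ⊆ insert F K₀ := Set.subset_insert _ _
  have hdiff := insert_diff_of_disjoint_cover hd
  have hvK₀ : v ∉ cover K₀ := fun hv => hvK (cover_insert ▸ Or.inr hv)
  have hvF : v ∉ F.verts := fun hv => hvK (cover_insert ▸ Or.inl hv)
  have hpreF : ∀ y ∈ pre, y ∉ F.verts := fun y hy hy' =>
    (hpre y hy).1 (cover_insert ▸ Or.inl hy')
  have hxK₀ : x ∉ cover K₀ := hd x hx
  have hFS : ∀ y ∈ F.verts, y ∉ S := fun y hy hyS =>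
    (h.pending y hyS).1 (cover_insert ▸ Or.inl hy)
  have hxsK₀ : ∀ y ∈ pre ++ [x], y ∉ cover K₀ := by
    intro y hy
    rcases List.mem_append.1 hy with hy | hy
    · exact fun hy' => (hpre y hy).1 (cover_insert ▸ Or.inr hy')
    · rw [List.mem_singleton.1 hy]; exact hxK₀
  -- Pending vertices miss `α`, whereas `α` is present at the earlier leaves.
  have hxsS : ∀ y ∈ pre ++ [x], y ∉ S := by
    intro y hy
    rcases List.mem_append.1 hy with hy | hy
    · exact fun hy' => (hpre y hy).2 (h.pending y hy').2.1
    · rw [List.mem_singleton.1 hy]; exact hFS x hx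
  have hadj : G.Adj v x := hs.adj x (by simp)
  refine wp_bind (wp_shift v x [] _ S pre c t _ h.isPartial hs (by omega) ?_)
  intro c₁ t₁ ht₁ hs₁
  have h₁ : BuildInv G c₁ α K₀ S := h.shift hs₁ hsub subset_rfl hvα hvK₀ hxsK₀ hvS hxsS
  have hα₁ := hs₁.mem_missing_iff hvα
  have hv₁ : α ∈ missing c₁ v := (hα₁ v).2 hvα
  have hxv : x ≠ v := hadj.ne'
  have hsize := hgood.ncard_verts
  have hcount₁ := hs₁.count none
  -- the edges of `F` at its center and the missing colors of `F`
  have hmk : ∀ a ∈ F.verts, ∀ b ∈ F.verts, c₁ s(a, b) = c s(a, b) := by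
    intro a ha b hb
    refine hs₁.eq_of_ne _ fun y _ he => ?_
    rcases Sym2.eq_iff.1 he with ⟨h, -⟩ | ⟨-, h⟩
    · exact hvF (h ▸ ha)
    · exact hvF (h ▸ hb)
  have hmiss : ∀ a ∈ F.verts, missing c a ⊆ missing c₁ a := by
    intro a ha
    by_cases hax : a = x
    · subst hax; exact hs₁.subset_last
    · refine (hs₁.missing_of_not_mem a ?_).superset
      intro hmem
      rcases List.mem_append.1 hmem with hm | hm
      · exact hpreF a hm ha
      · exact hax (List.mem_singleton.1 hm)
  cases F with
  | cfan u ys b =>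
    rw [ncard_tok_cfan] at htok
    simp only [Fan.size] at hsize
    dsimp only
    by_cases hxu : x = u
    · rw [if_pos hxu]
      subst hxu
      have hxα : α ∈ missing c₁ x := (hα₁ x).2 hgood.1.1.1
      refine wp_bind (wp_colorEdge (by omega) hadj hs₁.last hv₁ hxα ?_)
      refine wp_removeFan (by simp only [Fan.size]; omega) ?_
      dsimp only
      rw [hdiff]
      have := colorCount_recolor_some_none (β := α) hadj hs₁.last
      exact hQ _ _ _ _ (h₁.recolor hadj hs₁.last hv₁ hxα hvK₀ hxK₀ hvS (hFS x hx)) subset_rfl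
        (by simp only [Fan.size]; omega) (by omega)
    · rw [if_neg hxu]
      have hxys : x ∈ ys := hx.resolve_left hxu
      obtain ⟨l₁, l₂, rfl⟩ := List.append_of_mem hxys
      simp only [List.length_append, List.length_cons] at hsize
      have hu : u ∈ (Fan.cfan u (l₁ ++ x :: l₂) b).verts := Set.mem_insert _ _
      have hys : ∀ y ∈ l₁ ++ x :: l₂, y ∈ (Fan.cfan u (l₁ ++ x :: l₂) b).verts := fun y hy =>
        Set.mem_insert_of_mem _ hy
      have hys' : ∀ y ∈ l₁ ++ [x], y ∈ l₁ ++ x :: l₂ := by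
        intro y hy
        simp only [List.mem_append, List.mem_cons, List.not_mem_nil, or_false] at hy ⊢
        tauto
      obtain ⟨huα, -, hsh⟩ := isCFan_iff.1 hgood.1.1
      have hsh₁ : IsShiftable G c₁ u (l₁ ++ [x]) := by
        have : l₁ ++ x :: l₂ = (l₁ ++ [x]) ++ l₂ := by simp
        rw [this] at hsh
        refine hsh.left_of_append.mono (fun y hy => hmiss y (hys y (hys' y hy)))
          fun y hy => hmk _ hu y (hys y (hys' y hy))
      have huα₁ : α ∈ missing c₁ u := (hα₁ u).2 huα
      have huv : u ≠ v := fun h => hvF (h ▸ hu)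
      refine wp_bind (wp_shift u x l₂ _ S l₁ c₁ t₁ _ h₁.isPartial hsh₁ (by omega) ?_)
      intro c₂ t₂ ht₂ hs₂
      have h₂ : BuildInv G c₂ α K₀ S := h₁.shift hs₂ subset_rfl subset_rfl huα₁ (hd u hu)
        (fun y hy => hd y (hys y (hys' y hy))) (hFS u hu) (fun y hy => hFS y (hys y (hys' y hy)))
      have hα₂ := hs₂.mem_missing_iff huα₁
      have hcount₂ := hs₂.count none
      refine wp_bind (wp_removeFan (by
        simp only [Fan.size, List.length_append, List.length_cons]
        omega) ?_)
      have hcard : ({u, v} : Finset V).card = 2 := Finset.card_pair huv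
      refine wp_addFan (by
        simp only [Fan.size, List.length_append, List.length_cons, hcard]
        omega) ?_
      dsimp only
      rw [hdiff]
      have hvx₂ : c₂ s(x, v) = none := by
        rw [hs₂.eq_of_ne, Sym2.eq_swap]
        · exact hs₁.last
        · intro y _ he
          rcases Sym2.eq_iff.1 he with ⟨h, -⟩ | ⟨-, h⟩
          · exact hxu h
          · exact huv h.symm
      have hgood' : (Fan.ufan x {u, v} : Fan V d).Good G c₂ α ∅ := by
        refine ⟨⟨hcard.ge, ?_, ?_⟩, by simp⟩
        · intro y hy
          rcases Finset.mem_insert.1 hy with rfl | hy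
          · exact ⟨(hsh₁.adj x (by simp)).symm, by rw [Sym2.eq_swap]; exact hs₂.last,
              (hα₂ y).2 huα₁⟩
          · rw [Finset.mem_singleton.1 hy]
            exact ⟨hadj.symm, hvx₂, (hα₂ v).2 hv₁⟩
        -- This is what freshness is for: the new center was a leaf of a c-fan and must have `α`.
        · rw [hα₂, hα₁]
          exact hfresh x hxys
      have hverts : ∀ w ∈ (Fan.ufan x {u, v} : Fan V d).verts, w = x ∨ w = u ∨ w = v := by
        intro w hw
        simpa [Fan.verts] using hw
      have hd' : ∀ w ∈ (Fan.ufan x {u, v} : Fan V d).verts, w ∉ cover K₀ := by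
        intro w hw
        rcases hverts w hw with rfl | rfl | rfl
        · exact hxK₀
        · exact hd _ hu
        · exact hvK₀
      have hcov' := ncard_cover_insert hd'
      have htok' := ncard_tok_insert hd'
      rw [hgood'.ncard_verts] at hcov'
      rw [ncard_tok_ufan, hcard] at htok'
      simp only [Fan.size, hcard] at hcov'
      refine hQ _ _ _ _ (h₂.insert hgood' trivial hd' ?_) subset_rfl ?_ (by omega)
      · intro w hw
        rcases hverts w hw with rfl | rfl | rfl
        · exact hFS _ hx
        · exact hFS _ hu
        · exact hvS
      · simp only [Fan.size, List.length_append, List.length_cons, hcard]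
        omega
  | ufan u L =>
    rw [ncard_tok_ufan] at htok
    simp only [Fan.size] at hsize
    obtain ⟨hL, hLx, huα⟩ := hgood.1
    have hu : u ∈ (Fan.ufan u L : Fan V d).verts := Set.mem_insert _ _
    have hLF : ∀ y ∈ L, y ∈ (Fan.ufan u L : Fan V d).verts := fun y hy =>
      Set.mem_insert_of_mem _ hy
    dsimp only
    by_cases hxu : x = u
    · rw [if_pos hxu]
      subst hxu
      refine wp_changeLeaves (by omega) ?_
      dsimp only
      rw [hdiff]
      have hvL : v ∉ L := fun h => hvF (hLF v h)
      have hcard : (insert v L).card = L.card + 1 := Finset.card_insert_of_notMem hvL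
      have hgood' : (Fan.ufan x (insert v L) : Fan V d).Good G c₁ α ∅ := by
        refine ⟨⟨by omega, ?_, by rwa [hα₁]⟩, by simp⟩
        intro y hy
        rcases Finset.mem_insert.1 hy with rfl | hy
        · exact ⟨hadj.symm, by rw [Sym2.eq_swap]; exact hs₁.last, hv₁⟩
        · obtain ⟨k₁, k₂, k₃⟩ := hLx y hy
          exact ⟨k₁, by rw [hmk x hx y (hLF y hy), k₂], (hα₁ y).2 k₃⟩
      have hverts : ∀ w ∈ (Fan.ufan x (insert v L) : Fan V d).verts,
          w = v ∨ w ∈ (Fan.ufan x L : Fan V d).verts := by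
        intro w hw
        simp only [Fan.verts, Finset.coe_insert, Set.mem_insert_iff] at hw ⊢
        tauto
      have hd' : ∀ w ∈ (Fan.ufan x (insert v L) : Fan V d).verts, w ∉ cover K₀ := by
        intro w hw
        rcases hverts w hw with rfl | hw
        · exact hvK₀
        · exact hd w hw
      have hcov' := ncard_cover_insert hd'
      have htok' := ncard_tok_insert hd'
      rw [hgood'.ncard_verts] at hcov'
      rw [ncard_tok_ufan, hcard] at htok'
      simp only [Fan.size, hcard] at hcov'
      refine hQ _ _ _ _ (h₁.insert hgood' trivial hd' ?_) subset_rfl (by omega) (by omega)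
      intro w hw
      rcases hverts w hw with rfl | hw
      · exact hvS
      · exact hFS w hw
    · rw [if_neg hxu]
      have hxL : x ∈ L := hx.resolve_left hxu
      have hxα : α ∈ missing c₁ x := (hα₁ x).2 (hLx x hxL).2.2
      have huv : u ≠ v := fun h => hvF (h ▸ hu)
      have h₂ := h₁.recolor hadj hs₁.last hv₁ hxα hvK₀ hxK₀ hvS (hFS x hx)
      have hcount₂ := colorCount_recolor_some_none (β := α) hadj hs₁.last
      have hcard : (L.erase x).card + 1 = L.card := Finset.card_erase_add_one hxL
      refine wp_bind (wp_colorEdge (by omega) hadj hs₁.last hv₁ hxα ?_)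
      split_ifs with hlt
      · refine wp_removeFan (by simp only [Fan.size]; omega) ?_
        dsimp only
        rw [hdiff]
        exact hQ _ _ _ _ h₂ subset_rfl (by simp only [Fan.size]; omega) (by omega)
      · refine wp_changeLeaves (by omega) ?_
        dsimp only
        rw [hdiff]
        have hgood' : (Fan.ufan u (L.erase x) : Fan V d).Good G
            (EdgeColoring.recolor c₁ v x (some α)) α ∅ := by
          refine ⟨⟨by omega, ?_, ?_⟩, by simp⟩
          · intro y hy
            obtain ⟨hyx, hy⟩ := Finset.mem_erase.1 hy
            obtain ⟨k₁, k₂, k₃⟩ := hLx y hy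
            refine ⟨k₁, ?_, ?_⟩
            · rw [recolor_mk_of_ne huv (Ne.symm hxu), hmk u hu y (hLF y hy), k₂]
            · rw [missing_recolor_some_of_ne hs₁.last (fun h => hvF (h ▸ hLF y hy)) hyx, hα₁]
              exact k₃
          · rw [missing_recolor_some_of_ne hs₁.last huv (Ne.symm hxu), hα₁]
            exact huα
        have hverts : ∀ w ∈ (Fan.ufan u (L.erase x) : Fan V d).verts,
            w ∈ (Fan.ufan u L : Fan V d).verts := by
          intro w hw
          simp only [Fan.verts, Finset.coe_erase, Set.mem_insert_iff] at hw ⊢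
          exact hw.imp_right fun h => h.1
        have hd' : ∀ w ∈ (Fan.ufan u (L.erase x) : Fan V d).verts, w ∉ cover K₀ :=
          fun w hw => hd w (hverts w hw)
        have hcov' := ncard_cover_insert hd'
        have htok' := ncard_tok_insert hd'
        rw [hgood'.ncard_verts] at hcov'
        rw [ncard_tok_ufan] at htok'
        simp only [Fan.size] at hcov'
        exact hQ _ _ _ _ (h₂.insert hgood' trivial hd' fun w hw => hFS w (hverts w hw)) subset_rfl
          (by omega) (by omega)

/-- The leaves are distinct neighbors of `v`, so there are at most `G.degree v` iterations.
Appending a leaf takes seven elementary operations, within the 8 per leaf allowed by the invariant.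
-/
theorem wp_makeCollectionFan [DecidableRel G.Adj] (hdeg : ∀ v, G.degree v ≤ d) {v x₀ : V} {t : ℕ}
    {Q : Unit → ℕ → State V d → Prop} (h : BuildInv G c α K S) (hadj : G.Adj v x₀)
    (hx₀ : c s(v, x₀) = none) (hvα : α ∈ missing c v) (hvS : v ∉ S) (hvK : v ∉ cover K)
    (ht : 60 * G.degree v + 5 * (cover K).ncard ≤ t)
    (hQ : BuildPost G c α K S t (60 * G.degree v) Q) :
    wp (makeCollectionFan G α v x₀) t ⟨c, K, S⟩ Q := by
  refine wp_loop (fun (q : List V × V) t' s => s = ⟨c, K, S⟩ ∧ IsShiftable G c v (q.1 ++ [q.2]) ∧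
    (∀ y ∈ q.1, y ∉ cover K ∧ α ∉ missing c y) ∧ t ≤ t' + 8 * q.1.length) ?_ ?_
  · refine ⟨rfl, ⟨?_, by simp, ?_, by simp⟩, by simp, by simp⟩
    · intro x hx
      rw [List.mem_singleton.1 hx]; exact hadj
    · simpa using hx₀
  · rintro ⟨pre, x⟩ t' s ⟨rfl, hs, hpre, ht'⟩
    dsimp only at hs hpre ht'
    have hlen := hs.length_le
    simp only [List.length_append, List.length_singleton] at hlen
    refine ⟨by omega, wp_bind (wp_fanContaining (by omega) ?_ ?_)⟩
    · intro F hF hx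
      refine wp_bind (wp_mergeFans h hF hx hs hvα hvS hvK hpre (by omega) ?_)
      intro c' K' S' t'' h₁ h₂ h₃ h₄
      exact wp_pure (hQ _ _ _ _ h₁ h₂ (by omega) h₄)
    · intro hx
      have hxK : x ∉ cover K := fun ⟨F, hF, hxF⟩ => hx F hF hxF
      have hxsK : ∀ y ∈ pre ++ [x], y ∉ cover K := by
        intro y hy
        rcases List.mem_append.1 hy with hy | hy
        · exact (hpre y hy).1
        · rw [List.mem_singleton.1 hy]; exact hxK
      refine wp_bind (wp_isMissing (by omega) ?_ ?_)
      · intro hxα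
        simp only [if_true]
        refine wp_bind (wp_shift v x [] _ S pre c _ _ h.isPartial hs (by omega) ?_)
        intro c₁ t₁ ht₁ hs₁
        have hadj' : G.Adj v x := hs.adj x (by simp)
        have hv₁ := (hs₁.mem_missing_iff hvα v).2 hvα
        have hx₁ := (hs₁.mem_missing_iff hvα x).2 hxα
        refine wp_bind (wp_colorEdge (by omega) hadj' hs₁.last hv₁ hx₁ ?_)
        refine wp_bind (wp_removePending (by omega) (wp_pure ?_))
        have hcount₁ := hs₁.count none
        have hcount₂ := colorCount_recolor_some_none (β := α) hadj' hs₁.last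
        -- The vertex `x` need not be pending; at most one further pending vertex is lost, and the
        -- colored edge pays for it.
        have hS : S.ncard ≤ (S \ {x}).ncard + 1 := by
          have := Set.ncard_le_ncard (s := S) (t := insert x (S \ {x}))
            (fun y hy => by by_cases hyx : y = x <;> simp [hyx, hy]) (Set.toFinite _)
          exact this.trans (Set.ncard_insert_le _ _)
        have hsub : S \ {x} ⊆ S := Set.sdiff_subset
        refine hQ _ _ _ _ (BuildInv.recolor (h.shift hs₁ subset_rfl hsub hvα hvK hxsK
          (fun h => hvS h.1) ?_) hadj' hs₁.last hv₁ hx₁ hvK hxK (fun h => hvS h.1)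
          (fun h => h.2 rfl)) hsub (by dsimp only; omega) (by dsimp only; omega)
        intro y hy hyS
        rcases List.mem_append.1 hy with hy | hy
        · exact (hpre y hy).2 (h.pending y hyS.1).2.1
        · exact hyS.2 (List.mem_singleton.1 hy)
      · intro hxα
        have hxsα : ∀ y ∈ pre ++ [x], α ∉ missing c y := by
          intro y hy
          rcases List.mem_append.1 hy with hy | hy
          · exact (hpre y hy).2
          · rw [List.mem_singleton.1 hy]; exact hxα
        have add : ∀ b ∈ missing c x, (b ∈ missing c v ∨ ∃ y ∈ pre ++ [x], c s(v, y) = some b) →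
            ∀ t₁, t' ≤ t₁ + 7 → wp (do
              addFan (.cfan v (pre ++ [x]) b)
              return Sum.inr () : Prog (State V d) ((List V × V) ⊕ Unit)) t₁ ⟨c, K, S⟩
              (fun r t' s' => Sum.elim (fun q => s' = ⟨c, K, S⟩ ∧
                IsShiftable G c v (q.1 ++ [q.2]) ∧ (∀ y ∈ q.1, y ∉ cover K ∧ α ∉ missing c y) ∧
                t ≤ t' + 8 * q.1.length) (fun a => Q a t' s') r) := by
          intro b hb hb' t₁ ht₁
          have hgood : (Fan.cfan v (pre ++ [x]) b).Good G c α ∅ := by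
            refine ⟨⟨isCFan_iff.2 ⟨hvα, by simp, hs⟩, ⟨x, by simp, hb⟩, hb'⟩, ?_, by simp⟩
            rintro rfl
            exact hxα hb
          have hd : ∀ u ∈ (Fan.cfan v (pre ++ [x]) b).verts, u ∉ cover K := by
            rintro u (rfl | hu)
            · exact hvK
            · exact hxsK u hu
          have hcov := ncard_cover_insert hd
          have htok := ncard_tok_insert hd
          rw [hgood.ncard_verts] at hcov
          rw [ncard_tok_cfan] at htok
          simp only [Fan.size, List.length_append, List.length_singleton] at hcov
          refine wp_bind (wp_addFan (by
            simp only [Fan.size, List.length_append, List.length_singleton]; omega) (wp_pure ?_))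
          refine hQ _ _ _ _ (h.insert hgood hxsα hd ?_) subset_rfl ?_ (by dsimp only; omega)
          · rintro u (rfl | hu) huS
            · exact hvS huS
            · exact hxsα u hu (h.pending u huS).2.1
          · simp only [Fan.size, List.length_append, List.length_singleton]
            omega
        simp only [Bool.false_eq_true, if_false]
        refine wp_bind (wp_someMissing (by omega) ?_ ?_)
        · exact missing_nonempty h.isPartial hdeg x
        · intro b hb
          refine wp_bind (wp_isMissing (by omega) ?_ ?_)
          · intro hbv
            simp only [if_true]
            exact add b hb (Or.inl hbv) _ (by omega)
          · intro hbv
            simp only [Bool.false_eq_true, if_false]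
            refine wp_bind (wp_lookup (by omega) ?_ fun hcon => absurd hcon hbv)
            intro y hy
            refine wp_bind (wp_tick (by omega) ?_)
            by_cases hyxs : y ∈ pre ++ [x]
            · simp only [hyxs, if_true]
              exact add b hb (Or.inr ⟨y, hyxs, hy⟩) _ (by omega)
            · simp only [hyxs, if_false]
              refine wp_pure ⟨rfl, hs.concat h.isPartial hb hy hyxs,
                fun z hz => ⟨hxsK z hz, hxsα z hz⟩, ?_⟩
              simp only [List.length_append, List.length_singleton]
              omega

theorem wp_buildCollection [DecidableRel G.Adj] (hdeg : ∀ v, G.degree v ≤ d)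
    (hpos : ∀ v, 0 < G.degree v) (hc : IsPartialEdgeColoring G c) {K : Set (Fan V d)} {S : Set V}
    {t : ℕ} {Q : Unit → ℕ → State V d → Prop} (ht : 65 * ∑ v, G.degree v + 2 ≤ t)
    (hQ : ∀ c' K' t', t ≤ t' + 65 * ∑ v, G.degree v + 2 → BuildInv G c' α K' ∅ →
      (incompleteMissing G c α).ncard + 7 * colorCount G c' none ≤
        (tok K').ncard + 7 * colorCount G c none → Q () t' ⟨c', K', ∅⟩) :
    wp (buildCollection G α (incompleteMissing G c α)) t ⟨c, K, S⟩ Q := by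
  refine wp_bind (wp_getState (wp_bind (wp_setState ?_)))
  have hle : degSum G (incompleteMissing G c α) ≤ ∑ v, G.degree v := by
    refine Finset.sum_le_sum fun v _ => ?_
    split_ifs <;> simp
  have hcov : cover (∅ : Set (Fan V d)) = ∅ := by ext; simp [cover]
  have htok : tok (∅ : Set (Fan V d)) = ∅ := by ext; simp [tok]
  -- A pending vertex `v` holds 65 units per incident edge: 60 for its fan, one for the search of an
  -- uncolored edge, and the rest absorbs the constant overhead since the degree is positive.
  refine wp_loop (fun (_ : Unit) t' s => BuildInv G s.color α s.coll s.pending ∧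
    65 * degSum G s.pending + 5 * (cover s.coll).ncard + 2 ≤ t' ∧
    t + 65 * degSum G s.pending + 5 * (cover s.coll).ncard ≤ t' + 65 * ∑ v, G.degree v ∧
    (incompleteMissing G c α).ncard + 7 * colorCount G s.color none ≤
        s.pending.ncard + (tok s.coll).ncard + 7 * colorCount G c none) ?_ ?_
  · refine ⟨⟨hc, by simp, by simp, by simp, ?_⟩, ?_, ?_, ?_⟩
    · rintro v ⟨hv, hv'⟩
      exact ⟨by simp [hcov], hv', hv⟩
    · simp only [hcov, Set.ncard_empty]; omega
    · simp only [hcov, Set.ncard_empty]; omega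
    · simp
  · rintro _ t' ⟨c₁, K₁, S₁⟩ ⟨h, h₁, h₂, h₃⟩
    dsimp only at h h₁ h₂ h₃
    refine ⟨by omega, wp_bind (wp_takePending (by omega) ?_ ?_)⟩
    · intro v hv
      dsimp only at hv ⊢
      have hdiff := degSum_diff (G := G) hv
      have hposv := hpos v
      obtain ⟨hvK, hvα, hvu⟩ := h.pending v hv
      refine wp_bind (wp_bind (wp_spend (by omega) (wp_bind (wp_getState (wp_pick hvu ?_)))))
      rintro x₀ ⟨hx₀, hx₀'⟩
      have hinv : BuildInv G c₁ α K₁ (S₁ \ {v}) :=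
        { h with pending := fun w hw => h.pending w hw.1 }
      have hcard : (S₁ \ {v}).ncard + 1 = S₁.ncard := Set.ncard_sdiff_singleton_add_one hv
      refine wp_bind (wp_makeCollectionFan hdeg hinv hx₀ hx₀' hvα (fun h => h.2 rfl) hvK
        (by omega) ?_)
      intro c₂ K₂ S₂ t₂ k₁ k₂ k₃ k₄
      have := degSum_mono (G := G) k₂
      refine wp_pure ⟨k₁, ?_, ?_, ?_⟩ <;> dsimp only <;> omega
    · intro hS
      dsimp only at hS
      subst hS
      refine wp_pure (hQ _ _ _ (by omega) h ?_)
      simpa using h₃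

end Build

/-! ### Disconnecting a vertex -/

section Disconnect

variable {V : Type} {d : ℕ} {G : SimpleGraph V} {c c' : Sym2 V → Option (Fin (d + 1))}
  {α β γ δ : Fin (d + 1)} {used : Set (Fin (d + 1))} {K : Set (Fan V d)} {S : Set V}

/-- The vertices at which `β` occurs. -/
def present (c : Sym2 V → Option (Fin (d + 1))) (β : Fin (d + 1)) : Set V :=
  {u | β ∉ missing c u}

/-- The potential of a stage, when the vertices in `X` have been explored. -/
def potential (c : Sym2 V → Option (Fin (d + 1))) (β : Fin (d + 1)) (K : Set (Fan V d))
    (X : Set V) : ℕ :=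
  10 * (present c β \ X).ncard + 200 * (cover K).ncard

theorem AltPath.present_or (hγδ : (γ = α ∧ δ = β) ∨ (γ = β ∧ δ = α)) {x e : V} {p : List V}
    (h : AltPath c γ δ (x :: p) e) {a : V} (ha : a ∈ x :: p) :
    a = x ∨ a = e ∨ (α ∉ missing c a ∧ β ∉ missing c a) := by
  by_cases hax : a = x
  · exact Or.inl hax
  by_cases hae : a = e
  · exact Or.inr (Or.inl hae)
  obtain ⟨h₁, h₂⟩ := h.not_mem_missing rfl ha hae
  rcases hγδ with ⟨rfl, rfl⟩ | ⟨rfl, rfl⟩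
  · exact Or.inr (Or.inr ⟨h₁, h₂ hax⟩)
  · exact Or.inr (Or.inr ⟨h₂ hax, h₁⟩)

/-- All vertices of the path except possibly its two ends have `β`. So exploring a new path lowers
the number of unexplored vertices with `β` by the length of the path up to 1, which pays for the
exploration. -/
theorem AltPath.length_add_le [Finite V] (hγδ : (γ = α ∧ δ = β) ∨ (γ = β ∧ δ = α)) {x e : V}
    {p : List V} (h : AltPath c γ δ (x :: p) e) (hnd : (x :: p).Nodup) {X : Set V}
    (hX : ∀ a ∈ x :: p, a ∉ X) :
    p.length + (present c β \ (X ∪ {a | a ∈ x :: p})).ncard ≤ (present c β \ X).ncard + 1 := by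
  classical
  have h₁ : {a | a ∈ x :: p}.ncard = p.length + 1 := by
    have : {a | a ∈ x :: p} = ((x :: p).toFinset : Set V) := by ext; simp
    rw [this, Set.ncard_coe_finset, List.toFinset_card_of_nodup hnd, List.length_cons]
  have h₂ : {a | a ∈ x :: p} ⊆ insert x (insert e (present c β ∩ {a | a ∈ x :: p})) := by
    intro a ha
    rcases h.present_or hγδ ha with rfl | rfl | h'
    · exact Set.mem_insert _ _
    · exact Set.mem_insert_of_mem _ (Set.mem_insert _ _)
    · exact Set.mem_insert_of_mem _ (Set.mem_insert_of_mem _ ⟨h'.2, ha⟩)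
  have h₃ := (Set.ncard_le_ncard h₂ (Set.toFinite _)).trans ((Set.ncard_insert_le _ _).trans
    (Nat.succ_le_succ (Set.ncard_insert_le _ _)))
  have h₄ : (present c β \ (X ∪ {a | a ∈ x :: p})).ncard +
      (present c β ∩ {a | a ∈ x :: p}).ncard ≤ (present c β \ X).ncard := by
    rw [← Set.ncard_union_eq]
    · refine Set.ncard_le_ncard ?_ (Set.toFinite _)
      rintro a (⟨ha, ha'⟩ | ⟨ha, ha'⟩)
      · exact ⟨ha, fun h => ha' (Or.inl h)⟩
      · exact ⟨ha, hX a ha'⟩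
    · rw [Set.disjoint_left]
      rintro a ⟨-, ha⟩ ⟨-, ha'⟩
      exact ha (Or.inr ha')
  omega

theorem IsABClosed.recolor {X : Set V} (hX : IsABClosed c α β X) {u x : V}
    {o : Option (Fin (d + 1))} (hu : u ∈ X) (hx : x ∈ X) :
    IsABClosed (recolor c u x o) α β X := by
  intro a ha b hb
  by_cases he : s(a, b) = s(u, x)
  · rcases Sym2.eq_iff.1 he with ⟨-, rfl⟩ | ⟨-, rfl⟩
    · exact hx
    · exact hu
  · rw [recolor_of_ne he] at hb
    exact hX a ha b hb

theorem IsABClosed.of_or (h : (γ = α ∧ δ = β) ∨ (γ = β ∧ δ = α)) {X : Set V} :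
    IsABClosed c γ δ X ↔ IsABClosed c α β X := by
  rcases h with ⟨rfl, rfl⟩ | ⟨rfl, rfl⟩
  · rfl
  · exact ⟨IsABClosed.symm, IsABClosed.symm⟩

/-- The path that begins at `x` is appended to the set `X` by coloring the edge `ux`. -/
structure IsAppended (G : SimpleGraph V) (c c'' : Sym2 V → Option (Fin (d + 1)))
    (α β γ δ : Fin (d + 1)) (u x e : V) (p : List V) (X : Set V) : Prop where
  isPartial : IsPartialEdgeColoring G c''
  closed : IsABClosed c'' α β (X ∪ {a | a ∈ x :: p})
  path : AltPath c'' γ δ (x :: p) e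
  path' : AltPath c'' δ γ (u :: x :: p) e
  end_iff : α ∈ missing c'' e ↔ β ∉ missing c'' e
  full : ∀ a ∈ x :: p, a ≠ e → α ∉ missing c'' a ∧ β ∉ missing c'' a
  not_mem : ∀ a ∈ x :: p, a ∉ X
  missing_eq : ∀ a, a ≠ u → a ≠ x → missing c'' a = missing c a
  mem_missing_iff : ∀ a ζ, ζ ∈ missing c'' a ↔ ζ ∈ missing c a ∧ ¬ (ζ = δ ∧ (a = u ∨ a = x))

/-- The path begins outside the closed set `X` and hence avoids it. Coloring the edge from `u` to
`x` by `δ`, missing at both, joins two path ends, so the union is again closed and only `e` remains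
as an end on this side. -/
theorem AltPath.isAppended (hc : IsPartialEdgeColoring G c)
    (hγδ : (γ = α ∧ δ = β) ∨ (γ = β ∧ δ = α)) (hαβ : α ≠ β) {u x e : V} {p : List V} {X : Set V}
    (hX : IsABClosed c α β X) (hu : u ∈ X) (hx : x ∉ X) (huδ : δ ∈ missing c u)
    (hxδ : δ ∈ missing c x) (hadj : G.Adj u x) (hn : c s(u, x) = none)
    (h : AltPath c γ δ (x :: p) e) (hnd : (x :: p).Nodup) :
    IsAppended G c (EdgeColoring.recolor c u x (some δ)) α β γ δ u x e p X := by
  have hne : γ ≠ δ := by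
    rcases hγδ with ⟨rfl, rfl⟩ | ⟨rfl, rfl⟩
    · exact hαβ
    · exact hαβ.symm
  have hpX : ∀ a ∈ x :: p, a ∉ X := fun a ha haX =>
    hx (h.head_mem rfl ((IsABClosed.of_or hγδ).2 hX) ha haX)
  have hP : IsABClosed c α β {a | a ∈ x :: p} :=
    (IsABClosed.of_or hγδ).1 (h.isABClosed hc hxδ)
  have hmiss := fun a ζ => mem_missing_recolor_some (c := c) (β := δ) hn a ζ
  have hup : u ∉ x :: p := fun h => hpX u h hu
  have hpath : AltPath (EdgeColoring.recolor c u x (some δ)) γ δ (x :: p) e :=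
    h.recolor hnd hne hn (fun h => hup (List.mem_cons_of_mem _ h)) (List.nodup_cons.1 hnd).1
  have hsame : ∀ a, a ≠ u → a ≠ x →
      missing (EdgeColoring.recolor c u x (some δ)) a = missing c a :=
    fun a h₁ h₂ => missing_recolor_some_of_ne hn h₁ h₂
  refine ⟨hc.recolor_some hadj huδ hxδ, (hX.union hP).recolor (Or.inl hu) (Or.inr (by simp)),
    hpath, .cons _ _ _ _ _ _ (recolor_self _ _ _) hpath, ?_, ?_, hpX, hsame, hmiss⟩
  · have hex : (γ ∈ missing (EdgeColoring.recolor c u x (some δ)) e ↔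
        δ ∉ missing (EdgeColoring.recolor c u x (some δ)) e) := by
      rcases hpath.missing_last with ⟨hp, hm⟩ | ⟨h₁, h₂⟩ | ⟨h₁, h₂⟩
      · simp only [List.cons.injEq] at hp
        obtain ⟨rfl, -⟩ := hp
        rw [hmiss x δ]
        simp [hm]
      · tauto
      · tauto
    rcases hγδ with ⟨rfl, rfl⟩ | ⟨rfl, rfl⟩ <;> tauto
  · intro a ha hae
    obtain ⟨h₁, h₂⟩ := hpath.not_mem_missing rfl ha hae
    have h₃ : δ ∉ missing (EdgeColoring.recolor c u x (some δ)) a := by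
      by_cases hax : a = x
      · subst hax
        rw [hmiss]; simp
      · exact h₂ hax
    rcases hγδ with ⟨rfl, rfl⟩ | ⟨rfl, rfl⟩
    · exact ⟨h₁, h₃⟩
    · exact ⟨h₃, h₁⟩

/-- The invariant of Disconnect-Vertex without the conditions on single fans: `e₁` and `e₂` are the
ends of the current path, `P` is the set of the marked vertices and `X` is the set of all vertices
explored in this stage. -/
structure DiscBase (G : SimpleGraph V) (c : Sym2 V → Option (Fin (d + 1))) (α β : Fin (d + 1))
    (K : Set (Fan V d)) (e₁ e₂ : V) (P X : Set V) : Prop where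
  isPartial : IsPartialEdgeColoring G c
  disjoint : K.PairwiseDisjoint Fan.verts
  closed : IsABClosed c α β X
  subset : P ⊆ X
  mem₁ : e₁ ∈ P
  mem₂ : e₂ ∈ P
  ne : e₁ ≠ e₂
  full : ∀ u ∈ X, u ∈ cover K → u ≠ e₁ → u ≠ e₂ → α ∉ missing c u ∧ β ∉ missing c u
  end₁ : α ∈ missing c e₁ ↔ β ∉ missing c e₁
  end₂ : α ∈ missing c e₂ ↔ β ∉ missing c e₂

theorem DiscBase.symm {e₁ e₂ : V} {P X : Set V} (h : DiscBase G c α β K e₁ e₂ P X) :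
    DiscBase G c α β K e₂ e₁ P X :=
  ⟨h.isPartial, h.disjoint, h.closed, h.subset, h.mem₂, h.mem₁, h.ne.symm,
    fun u hu hK h₁ h₂ => h.full u hu hK h₂ h₁, h.end₂, h.end₁⟩

/-- Only one of the ends of the current path may be damaged. -/
def EndWeak (G : SimpleGraph V) (c : Sym2 V → Option (Fin (d + 1))) (α : Fin (d + 1))
    (used : Set (Fin (d + 1))) (K : Set (Fan V d)) (e₁ e₂ : V) : Prop :=
  ∃ z, (z = e₁ ∨ z = e₂) ∧ ∀ F ∈ K, F.Weak G c α used z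

theorem EndWeak.symm {e₁ e₂ : V} (h : EndWeak G c α used K e₁ e₂) :
    EndWeak G c α used K e₂ e₁ :=
  let ⟨z, hz, hF⟩ := h
  ⟨z, hz.symm, hF⟩

theorem DiscBase.anti {e₁ e₂ : V} {P X : Set V} (h : DiscBase G c α β K e₁ e₂ P X)
    {K' : Set (Fan V d)} (hd : K'.PairwiseDisjoint Fan.verts) (hK : cover K' ⊆ cover K) :
    DiscBase G c α β K' e₁ e₂ P X :=
  { h with disjoint := hd, full := fun u hu hu' => h.full u hu (hK hu') }

open Classical in
/-- The part of the balance of Color-Many that is reserved for an end of the current path. -/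
def reserve (K : Set (Fan V d)) (e : V) : ℕ := if e ∈ cover K then 2 else 0

theorem reserve_le (K : Set (Fan V d)) (e : V) : reserve K e ≤ 2 := by
  unfold reserve; split_ifs <;> simp

theorem reserve_of_mem {e : V} (h : e ∈ cover K) : reserve K e = 2 := if_pos h

theorem reserve_of_not_mem {e : V} (h : e ∉ cover K) : reserve K e = 0 := if_neg h

theorem reserve_mono {K' : Set (Fan V d)} (h : cover K' ⊆ cover K) (e : V) :
    reserve K' e ≤ reserve K e := by
  by_cases he : e ∈ cover K'
  · rw [reserve_of_mem he, reserve_of_mem (h he)]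
  · rw [reserve_of_not_mem he]; exact Nat.zero_le _

theorem verts_ufan_erase [DecidableEq V] {u x : V} {L : Finset V} :
    (Fan.ufan u (L.erase x) : Fan V d).verts ⊆ (Fan.ufan u L : Fan V d).verts := by
  intro w hw
  simp only [Fan.verts, Finset.coe_erase, Set.mem_insert_iff] at hw ⊢
  exact hw.imp_right fun h => h.1

/-- The coloring of an edge by `α` or `β` and a flip do not change the number of edges with another
color. -/
def SameCounts (G : SimpleGraph V) (α β : Fin (d + 1)) (c c' : Sym2 V → Option (Fin (d + 1))) :
    Prop :=
  ∀ γ, γ ≠ α → γ ≠ β → colorCount G c' (some γ) = colorCount G c (some γ)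

theorem SameCounts.trans {c'' : Sym2 V → Option (Fin (d + 1))} (h : SameCounts G α β c c')
    (h' : SameCounts G α β c' c'') : SameCounts G α β c c'' :=
  fun γ h₁ h₂ => (h' γ h₁ h₂).trans (h γ h₁ h₂)

theorem sameCounts_flipOn {X : Set V} : SameCounts G α β c (flipOn c α β X) :=
  fun _ h₁ h₂ => colorCount_flipOn_of_ne h₁ h₂

theorem sameCounts_recolor {u x : V} (hδ : δ = α ∨ δ = β) (hn : c s(u, x) = none) :
    SameCounts G α β c (recolor c u x (some δ)) :=
  fun _ h₁ h₂ => colorCount_recolor_some_of_ne hn (by rcases hδ with rfl | rfl <;> assumption)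

variable [Fintype V] [DecidableEq V]

/-- Either `w` leaves the cover and its reserve pays for the lost tokens, or `w` is the center of a
u-fan and an edge gets colored. Intactness of `F` itself is required only if `F` is a u-fan, since a
c-fan is simply discarded. This weaker form is needed when both ends of the path lie in one damaged
c-fan. -/
theorem wp_disconnectStep (hαβ : α ≠ β) (hα : α ∉ used) (hβ : β ∉ used) {w o : V} {P X : Set V}
    {F : Fan V d} {t : ℕ} {Q : V × Set V → ℕ → State V d → Prop}
    (h : DiscBase G c α β K w o P X) (hF : F ∈ K) (hw : w ∈ F.verts)
    (hgood : ∀ F' ∈ K, F' ≠ F → F'.Good G c α used) (hsize : F.verts.ncard = F.size)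
    (hweak : ∀ u L, F = .ufan u L → F.Weak G c α used w) (ht : potential c β K X ≤ t + 5)
    (hQ : ∀ c' K' w' P' X' t', DiscBase G c' α β K' w' o P' X' → EndWeak G c' α used K' w' o →
      t + potential c' β K' X' + 5 ≤ t' + potential c β K X →
      7 * colorCount G c' none + reserve K' w' + reserve K' o + (tok K).ncard ≤
        7 * colorCount G c none + reserve K w + reserve K o + (tok K').ncard →
      SameCounts G α β c c' → Q (w', P') t' ⟨c', K', S⟩) :
    wp (disconnectStep G α β w F P) t ⟨c, K, S⟩ Q := by
  classical
  obtain ⟨K₀, rfl, hK₀, hd⟩ := exists_eq_insert h.disjoint hF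
  have hcov := ncard_cover_insert hd
  have htok := ncard_tok_insert hd
  have hdiff := insert_diff_of_disjoint_cover hd
  have hgood₀ : ∀ F' ∈ K₀, F'.Good G c α used := fun F' hF' =>
    hgood F' (Or.inr hF') fun he => not_mem_of_disjoint_cover hd (he ▸ hF')
  have hwK₀ : w ∉ cover K₀ := hd w hw
  have hsub : cover K₀ ⊆ cover (insert F K₀) := by
    rw [cover_insert]; exact Set.subset_union_right
  have hresw : reserve (insert F K₀) w = 2 :=
    reserve_of_mem (by rw [cover_insert]; exact Or.inl hw)
  have hpos : 0 < F.size := by cases F <;> simp [Fan.size]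
  have hreso := reserve_mono hsub o
  unfold potential at ht hQ
  -- At most two tokens are lost, which is the reserve of `w`; afterwards `w` lies in no fan.
  have remove : ∀ r : V × Set V, r = (w, P) → F.tok.ncard ≤ 2 →
      wp (do removeFan F; return r) t ⟨c, insert F K₀, S⟩ Q := by
    rintro _ rfl htok₂
    refine wp_bind (wp_removeFan (by omega) (wp_pure ?_))
    dsimp only
    rw [hdiff]
    refine hQ _ _ _ _ X _ (h.anti hK₀ hsub) ⟨w, Or.inl rfl, fun F' hF' =>
      (hgood₀ F' hF').weak w⟩ (by omega) ?_ fun _ _ _ => rfl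
    rw [reserve_of_not_mem hwK₀]
    omega
  cases F with
  | cfan u ys b => exact remove _ rfl (by rw [ncard_tok_cfan]; simp)
  | ufan u L =>
    unfold disconnectStep
    dsimp only
    by_cases hL : L.card ≤ 2
    · rw [if_pos hL]
      exact remove _ rfl (by rwa [ncard_tok_ufan])
    rw [if_neg hL]
    obtain ⟨-, hcard, hLx, hLα, huα, hproc⟩ := hweak u L rfl
    rw [ncard_tok_ufan] at htok
    simp only [Fan.size] at hsize
    by_cases hwu : w = u
    swap
    · rw [if_pos hwu]
      have hwL : w ∈ L := hw.resolve_left hwu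
      have hce : (L.erase w).card + 1 = L.card := Finset.card_erase_add_one hwL
      refine wp_bind (wp_changeLeaves (by omega) (wp_pure ?_))
      dsimp only
      rw [hdiff]
      have hg : (Fan.ufan u (L.erase w) : Fan V d).Good G c α used := by
        refine ⟨⟨by omega, fun y hy => ?_, huα (Ne.symm hwu)⟩, hproc⟩
        obtain ⟨hyw, hy⟩ := Finset.mem_erase.1 hy
        exact ⟨(hLx y hy).1, (hLx y hy).2, hLα y hy hyw⟩
      have hd' : ∀ y ∈ (Fan.ufan u (L.erase w) : Fan V d).verts, y ∉ cover K₀ :=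
        fun y hy => hd y (verts_ufan_erase hy)
      have hcov' := ncard_cover_insert hd'
      have htok' := ncard_tok_insert hd'
      rw [hg.ncard_verts] at hcov'
      rw [ncard_tok_ufan] at htok'
      simp only [Fan.size] at hcov'
      have hsub' : cover (insert (Fan.ufan u (L.erase w)) K₀) ⊆ cover (insert (Fan.ufan u L) K₀) := by
        rw [cover_insert, cover_insert]
        exact Set.union_subset_union_left _ verts_ufan_erase
      have hw' : w ∉ cover (insert (Fan.ufan u (L.erase w)) K₀) := by
        rw [cover_insert]
        rintro (hm | hm)
        · rcases hm with hm | hm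
          · exact hwu hm
          · simp at hm
        · exact hwK₀ hm
      have hreso' := reserve_mono hsub' o
      refine hQ _ _ _ _ X _ (h.anti (pairwiseDisjoint_insert hK₀ hd') hsub')
        ⟨w, Or.inl rfl, ?_⟩ (by omega) ?_ fun _ _ _ => rfl
      · rintro F' (rfl | hF')
        · exact hg.weak w
        · exact (hgood₀ F' hF').weak w
      · rw [reserve_of_not_mem hw']
        omega
    · rw [if_neg (not_not.2 hwu)]
      subst hwu
      have hwL : w ∉ L := fun hm => (hLx w hm).1.ne rfl
      have hLF : ∀ y ∈ L, y ∈ cover (insert (Fan.ufan w L) K₀) := fun y hy => by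
        rw [cover_insert]; exact Or.inl (Or.inr hy)
      have hLα' : ∀ y ∈ L, α ∈ missing c y := fun y hy => hLα y hy fun he => hwL (he ▸ hy)
      -- Leaves miss `α`, while explored fan vertices other than the two ends have both colors. So
      -- at most one leaf is explored.
      have hLX : ∀ y ∈ L, y ∈ X → y = o := by
        intro y hy hyX
        by_contra hyo
        exact (h.full y hyX (hLF y hy) (fun he => hwL (he ▸ hy)) hyo).1 (hLα' y hy)
      have hwX : w ∈ X := h.subset h.mem₁
      -- the rest of the step for a leaf that is not on the path
      have key : ∀ x ∈ L, x ∉ X → wp (do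
          changeLeaves w L (L.erase x)
          if ← isMissing α w then
            colorEdge G w x α
            let (p, e) ← walk x β α
            return (e, P ∪ {y | y ∈ p})
          else
            let _ ← flipPath G α β x
            colorEdge G w x β
            let (p, e) ← walk x α β
            return (e, P ∪ {y | y ∈ p})) t ⟨c, insert (Fan.ufan w L) K₀, S⟩ Q := by
        intro x hx hxX
        obtain ⟨hadj, hn⟩ := hLx x hx
        have hxα := hLα' x hx
        have hxw : x ≠ w := fun he => hwL (he ▸ hx)
        have hce : (L.erase x).card + 1 = L.card := Finset.card_erase_add_one hx
        have hd' : ∀ y ∈ (Fan.ufan w (L.erase x) : Fan V d).verts, y ∉ cover K₀ :=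
          fun y hy => hd y (verts_ufan_erase hy)
        have hcov' := ncard_cover_insert hd'
        have htok' := ncard_tok_insert hd'
        rw [ncard_verts_ufan (fun hm => hwL (Finset.mem_of_mem_erase hm))] at hcov'
        rw [ncard_tok_ufan] at htok'
        have hsub' : cover (insert (Fan.ufan w (L.erase x)) K₀) ⊆
            cover (insert (Fan.ufan w L) K₀) := by
          rw [cover_insert, cover_insert]
          exact Set.union_subset_union_left _ verts_ufan_erase
        have hreso' := reserve_mono hsub' o
        have hxK₀ : x ∉ cover K₀ := hd x (Or.inr hx)
        have hoX : o ∈ X := h.subset h.mem₂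
        have hoP : ∀ Y : Set V, o ∈ P ∪ Y := fun Y => Or.inl h.mem₂
        obtain ⟨p, e, hp, hnd⟩ := AltPath.exists h.isPartial β hxα
        have hor : (β = α ∧ α = β) ∨ (β = β ∧ α = α) := Or.inr ⟨rfl, rfl⟩
        have hpX : ∀ a ∈ x :: p, a ∉ X := fun a ha haX =>
          hxX (hp.head_mem rfl h.closed.symm ha haX)
        have hlen := hp.length_add_le hor hnd hpX
        -- everything that has to be checked after the edge has been colored by `δ`
        have finish : ∀ (c₁ : Sym2 V → Option (Fin (d + 1))) (γ δ : Fin (d + 1)) (t' : ℕ),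
            IsAppended G c₁ (recolor c₁ w x (some δ)) α β γ δ w x e p X →
            (∀ a ∉ x :: p, missing c₁ a = missing c a) → c₁ s(w, x) = none → δ = α ∨ δ = β →
            (γ ∉ missing c w ∧ γ ≠ δ ∧ (γ = α ∨ γ = β)) → SameCounts G α β c c₁ →
            colorCount G c₁ none = colorCount G c none →
            (∀ F' ∈ insert (Fan.ufan w (L.erase x)) K₀,
              F'.Weak G (recolor c₁ w x (some δ)) α used e) →
            t ≤ t' + 6 * p.length + 20 →
            Q (e, P ∪ {y | y ∈ x :: p}) t' ⟨recolor c₁ w x (some δ),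
              insert (Fan.ufan w (L.erase x)) K₀, S⟩ := by
          intro c₁ γ δ t' happ hsame hn₁ hδ hγ hcounts hnone hwk ht'
          have hwp : w ∉ x :: p := fun hm => hpX w hm hwX
          have hM : ∀ a, a ∉ x :: p → a ≠ w →
              missing (recolor c₁ w x (some δ)) a = missing c a := by
            intro a ha haw
            rw [happ.missing_eq a haw fun he => ha (he ▸ List.mem_cons_self), hsame a ha]
          have hfull : ∀ u ∈ X, u ∈ cover (insert (Fan.ufan w (L.erase x)) K₀) → u ≠ o →
              α ∉ missing (recolor c₁ w x (some δ)) u ∧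
              β ∉ missing (recolor c₁ w x (some δ)) u := by
            intro u hu huK huo
            by_cases huw : u = w
            · subst huw
              have h₁ : δ ∉ missing (recolor c₁ u x (some δ)) u := by
                rw [happ.mem_missing_iff]; simp
              have h₂ : γ ∉ missing (recolor c₁ u x (some δ)) u := by
                rw [happ.mem_missing_iff, hsame u hwp]
                exact fun hcon => hγ.1 hcon.1
              obtain ⟨-, hne, h₃⟩ := hγ
              rcases hδ with rfl | rfl <;> rcases h₃ with rfl | rfl
              · exact absurd rfl hne
              · exact ⟨h₁, h₂⟩
              · exact ⟨h₂, h₁⟩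
              · exact absurd rfl hne
            · rw [hM u (fun hm => hpX u hm hu) huw]
              exact h.full u hu (hsub' huK) huw huo
          have hop : o ∉ x :: p := fun hm => hpX o hm hoX
          have heX : e ∉ X := hpX e hp.last_mem
          have hcount := colorCount_recolor_some_none (β := δ) hadj hn₁
          have hpres : present (recolor c₁ w x (some δ)) β \ (X ∪ {a | a ∈ x :: p}) ⊆
              present c β \ (X ∪ {a | a ∈ x :: p}) := by
            rintro a ⟨ha, ha'⟩
            refine ⟨?_, ha'⟩
            have h₁ : a ∉ x :: p := fun hm => ha' (Or.inr hm)
            have h₂ : a ≠ w := fun he => ha' (Or.inl (he ▸ hwX))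
            have ha : β ∉ missing (recolor c₁ w x (some δ)) a := ha
            rw [hM a h₁ h₂] at ha
            exact ha
          have hpres' := Set.ncard_le_ncard hpres (Set.toFinite _)
          -- The colored edge is worth 7; it covers the removed leaf and the reserve of the new end
          -- `e`.
          have hrese := reserve_le (insert (Fan.ufan w (L.erase x)) K₀) e
          refine hQ _ _ _ _ (X ∪ {a | a ∈ x :: p}) _ ⟨happ.isPartial,
            pairwiseDisjoint_insert hK₀ hd', happ.closed,
            Set.union_subset_union_left _ h.subset, Or.inr hp.last_mem, Or.inl h.mem₂,
            fun he => heX (he ▸ hoX), ?_, happ.end_iff, ?_⟩ ⟨e, Or.inl rfl, hwk⟩ (by omega)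
            (by omega) (hcounts.trans (sameCounts_recolor hδ hn₁))
          · rintro u (hu | hu) huK hue huo
            · exact hfull u hu huK huo
            · exact happ.full u hu hue
          · rw [hM o hop h.ne.symm]
            exact h.end₂
        refine wp_bind (wp_changeLeaves (by omega) (wp_bind (wp_isMissing (by omega) ?_ ?_)))
        · intro hwα
          dsimp only at hwα ⊢
          have hwβ : β ∉ missing c w := h.end₁.1 hwα
          have happ := hp.isAppended h.isPartial hor hαβ h.closed hwX hxX hwα hxα hadj hn hnd
          rw [hdiff, if_pos rfl]
          refine wp_bind (wp_colorEdge (by omega) hadj hn hwα hxα ?_)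
          refine wp_bind (wp_walk happ.isPartial happ.path (by omega) fun t' ht' => wp_pure ?_)
          refine finish c β α t' happ (fun _ _ => rfl) hn (Or.inl rfl)
            ⟨hwβ, hαβ.symm, Or.inr rfl⟩ (fun _ _ _ => rfl) rfl ?_ (by omega)
          rintro F' (rfl | hF')
          · suffices hg : (Fan.ufan w (L.erase x) : Fan V d).Good G
                (recolor c w x (some α)) α used from hg.weak e
            refine ⟨⟨by omega, fun y hy => ?_, ?_⟩, fun ζ hζ hm => ?_⟩
            · obtain ⟨hyx, hy⟩ := Finset.mem_erase.1 hy
              refine ⟨(hLx y hy).1, ?_, ?_⟩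
              · rw [recolor_of_ne (mk_ne_mk hyx)]; exact (hLx y hy).2
              · rw [happ.missing_eq y (fun he => hwL (he ▸ hy)) hyx]
                exact hLα' y hy
            · rw [happ.mem_missing_iff]; simp
            · rw [happ.mem_missing_iff] at hm
              exact hproc ζ hζ hm.1
          · exact (Fan.sameOn_recolor hn (fun hm => hwK₀ ⟨F', hF', hm⟩)
              fun hm => hxK₀ ⟨F', hF', hm⟩).weak ((hgood₀ F' hF').weak e)
        · intro hwα
          dsimp only at hwα ⊢
          have hwβ : β ∈ missing c w := by
            by_contra hcon
            exact hwα (h.end₁.2 hcon)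
          rw [hdiff, if_neg (by simp)]
          refine wp_bind (wp_flipPath h.isPartial (Or.inl ⟨rfl, rfl, hxα⟩) hp hnd (by omega)
            fun t₁ ht₁ => ?_)
          have hKc : IsABClosed c α β {a | a ∈ x :: p} :=
            (hp.isABClosed h.isPartial hxα).symm
          have hp₁ : AltPath (flipOn c α β {a | a ∈ x :: p}) α β (x :: p) e := by
            rw [flipOn_comm]
            exact hp.flipOn hKc.symm fun a ha => ha
          have hwp : w ∉ x :: p := fun hm => hpX w hm hwX
          have hsame : ∀ a ∉ x :: p, missing (flipOn c α β {a | a ∈ x :: p}) a = missing c a :=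
            fun a ha => missing_flipOn_of_not_mem hKc ha
          have hn₁ : flipOn c α β {a | a ∈ x :: p} s(w, x) = none := flipOn_eq_none.2 hn
          have hwβ₁ : β ∈ missing (flipOn c α β {a | a ∈ x :: p}) w := by rwa [hsame w hwp]
          have hxβ₁ : β ∈ missing (flipOn c α β {a | a ∈ x :: p}) x :=
            (mem_missing_flipOn_right hKc List.mem_cons_self).2 hxα
          have happ := hp₁.isAppended (h.isPartial.flipOn hKc) (Or.inl ⟨rfl, rfl⟩) hαβ
            h.closed.flipOn hwX hxX hwβ₁ hxβ₁ hadj hn₁ hnd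
          refine wp_bind (wp_colorEdge (by omega) hadj hn₁ hwβ₁ hxβ₁ ?_)
          refine wp_bind (wp_walk happ.isPartial happ.path (by omega) fun t' ht' => wp_pure ?_)
          refine finish (flipOn c α β {a | a ∈ x :: p}) α β t' happ hsame hn₁ (Or.inr rfl)
            ⟨hwα, hαβ, Or.inl rfl⟩ sameCounts_flipOn colorCount_flipOn_none ?_ (by omega)
          rintro F' (rfl | hF')
          -- The flipped path may end at another leaf of the same u-fan, which then has `α`; so this
          -- fan, too, is only `Weak` at `e`.
          · refine ⟨ncard_verts_ufan (fun hm => hwL (Finset.mem_of_mem_erase hm)), by omega,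
              fun y hy => ?_, fun y hy hye => ?_, fun _ => ?_, fun ζ hζ hm => ?_⟩
            · obtain ⟨hyx, hy⟩ := Finset.mem_erase.1 hy
              refine ⟨(hLx y hy).1, ?_⟩
              rw [recolor_of_ne (mk_ne_mk hyx), flipOn_eq_none]
              exact (hLx y hy).2
            · obtain ⟨hyx, hy⟩ := Finset.mem_erase.1 hy
              have hyp : y ∉ x :: p := by
                intro hm
                rcases hp.present_or hor hm with he | he | he
                · exact hyx he
                · exact hye he
                · exact he.1 (hLα' y hy)
              rw [happ.missing_eq y (fun he => hwL (he ▸ hy)) hyx, hsame y hyp]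
              exact hLα' y hy
            · rw [happ.mem_missing_iff, hsame w hwp]
              exact fun hm => hwα hm.1
            · rw [happ.mem_missing_iff, hsame w hwp] at hm
              exact hproc ζ hζ hm.1
          · have hwk := (hgood₀ F' hF').weak_flipOn h.isPartial (Or.inr ⟨rfl, rfl⟩) hp hxα hα hβ
              fun hm => hxK₀ ⟨F', hF', hm⟩
            exact (Fan.sameOn_recolor hn₁ (fun hm => hwK₀ ⟨F', hF', hm⟩)
              fun hm => hxK₀ ⟨F', hF', hm⟩).weak hwk
      refine wp_bind (wp_pick (Finset.card_pos.1 (by omega)) ?_)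
      intro x' hx'
      have hx' : x' ∈ L := hx'
      by_cases hxP : x' ∈ P
      · rw [if_pos hxP]
        have hx'o := hLX x' hx' (h.subset hxP)
        refine wp_bind (wp_pick (A := {x | x ∈ L.erase x'}) ?_ ?_)
        · have : (L.erase x').Nonempty := by
            rw [← Finset.card_pos, Finset.card_erase_of_mem hx']; omega
          exact this
        · intro x hx
          obtain ⟨hxx', hx⟩ := Finset.mem_erase.1 hx
          exact key x hx fun hxX => hxx' ((hLX x hx hxX).trans hx'o.symm)
      · rw [if_neg hxP]
        refine wp_bind (wp_pure ?_)
        -- The marks record only `P`, but this suffices: a leaf in `X` would be `o`, which lies in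
        -- `P`.
        exact key x' hx' fun hxX => hxP (hLX x' hx' hxX ▸ h.mem₂)

end Disconnect

/-! ### Disconnect-Vertex: exploring until neither end lies in a fan -/

section DisconnectVertex

variable {V : Type} {d : ℕ} {G : SimpleGraph V} {c c' : Sym2 V → Option (Fin (d + 1))}
  {α β γ δ : Fin (d + 1)} {used : Set (Fin (d + 1))} {K : Set (Fan V d)} {S : Set V}

/-- The invariant of a stage: `X` is the set of all vertices explored in this stage. -/
structure StageInv (G : SimpleGraph V) (c : Sym2 V → Option (Fin (d + 1))) (α β : Fin (d + 1))
    (used : Set (Fin (d + 1))) (K : Set (Fan V d)) (X : Set V) : Prop where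
  isPartial : IsPartialEdgeColoring G c
  disjoint : K.PairwiseDisjoint Fan.verts
  closed : IsABClosed c α β X
  full : ∀ u ∈ X, u ∈ cover K → α ∉ missing c u ∧ β ∉ missing c u
  good : ∀ F ∈ K, F.Good G c α used

variable [Fintype V] [DecidableEq V]

theorem wp_disconnectLoop_body (hαβ : α ≠ β) (hα : α ∉ used) (hβ : β ∉ used) {w o : V}
    {P X : Set V} {F : Fan V d} {t : ℕ} {Q : V × Set V → ℕ → State V d → Prop}
    (h : DiscBase G c α β K w o P X) (hF : F ∈ K) (hw : w ∈ F.verts)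
    (hweak : ∀ F' ∈ K, F'.Weak G c α used w) (ht : potential c β K X ≤ t + 5)
    (hQ : ∀ c' K' w' P' X' t', DiscBase G c' α β K' w' o P' X' → EndWeak G c' α used K' w' o →
      t + potential c' β K' X' + 5 ≤ t' + potential c β K X →
      7 * colorCount G c' none + reserve K' w' + reserve K' o + (tok K).ncard ≤
        7 * colorCount G c none + reserve K w + reserve K o + (tok K').ncard →
      SameCounts G α β c c' → Q (w', P') t' ⟨c', K', S⟩) :
    wp (disconnectStep G α β w F P) t ⟨c, K, S⟩ Q := by
  refine wp_disconnectStep hαβ hα hβ h hF hw ?_ (hweak F hF).1 (fun _ _ _ => hweak F hF) ht hQ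
  intro F' hF' hne
  exact (hweak F' hF').good fun hw' =>
    Set.disjoint_left.1 (h.disjoint hF' hF hne) hw' hw

/-- At most one end of the current path is damaged throughout. When the loop stops, neither end lies
in a fan: hence no fan is damaged, and the explored fan vertices all have both colors. The 4 in the
balance is the sum of the two initial reserves. -/
theorem wp_disconnectVertex (hαβ : α ≠ β) (hα : α ∉ used) (hβ : β ∉ used) {v a₁ a₂ : V}
    {q₁ q₂ : List V} {X : Set V} {t : ℕ} {Q : Unit → ℕ → State V d → Prop}
    (hq₁ : AltPath c α β (v :: q₁) a₁) (hq₂ : AltPath c β α (v :: q₂) a₂)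
    (h : DiscBase G c α β K a₁ a₂ ({y | y ∈ v :: q₁} ∪ {y | y ∈ v :: q₂}) X)
    (hweak : EndWeak G c α used K a₁ a₂)
    (ht : potential c β K X + 2 * (q₁.length + q₂.length) + 15 ≤ t)
    (hQ : ∀ c' K' X' t', StageInv G c' α β used K' X' →
      t + potential c' β K' X' ≤ t' + potential c β K X + 2 * (q₁.length + q₂.length) + 15 →
      7 * colorCount G c' none + (tok K).ncard ≤
        7 * colorCount G c none + 4 + (tok K').ncard →
      SameCounts G α β c c' → Q () t' ⟨c', K', S⟩) :
    wp (disconnectVertex G α β v) t ⟨c, K, S⟩ Q := by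
  refine wp_bind (wp_walk h.isPartial hq₁ (by omega) fun t₁ ht₁ => ?_)
  refine wp_bind (wp_walk h.isPartial hq₂ (by omega) fun t₂ ht₂ => ?_)
  refine wp_loop (fun (q : V × V × Set V) t' s => ∃ X', DiscBase G s.color α β s.coll q.1 q.2.1
    q.2.2 X' ∧ EndWeak G s.color α used s.coll q.1 q.2.1 ∧ s.pending = S ∧
    t₂ + potential s.color β s.coll X' ≤ t' + potential c β K X ∧
    7 * colorCount G s.color none + reserve s.coll q.1 + reserve s.coll q.2.1 + (tok K).ncard ≤
      7 * colorCount G c none + reserve K a₁ + reserve K a₂ + (tok s.coll).ncard ∧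
    SameCounts G α β c s.color) ⟨X, h, hweak, rfl, le_rfl, le_rfl, fun _ _ _ => rfl⟩ ?_
  rintro ⟨e₁, e₂, P⟩ t' ⟨c₁, K₁, S₁⟩ ⟨X₁, h₁, ⟨z, hz, hwk⟩, hS, h₂, h₃, h₄⟩
  dsimp only at h₁ hz hwk hS h₂ h₃ h₄
  subst hS
  have step₁ : ∀ F ∈ K₁, e₁ ∈ F.verts → (∀ F' ∈ K₁, F' ≠ F → F'.Good G c₁ α used) →
      F.verts.ncard = F.size → (∀ u L, F = .ufan u L → F.Weak G c₁ α used e₁) →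
      ∀ t'', t' ≤ t'' + 4 → wp (do
        let (e, P') ← disconnectStep G α β e₁ F P
        return Sum.inl (e, e₂, P') : Prog (State V d) ((V × V × Set V) ⊕ Unit)) t''
        ⟨c₁, K₁, S₁⟩ (fun r t' s => Sum.elim (fun q => ∃ X', DiscBase G s.color α β s.coll q.1 q.2.1
    q.2.2 X' ∧ EndWeak G s.color α used s.coll q.1 q.2.1 ∧ s.pending = S₁ ∧
    t₂ + potential s.color β s.coll X' ≤ t' + potential c β K X ∧
    7 * colorCount G s.color none + reserve s.coll q.1 + reserve s.coll q.2.1 + (tok K).ncard ≤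
      7 * colorCount G c none + reserve K a₁ + reserve K a₂ + (tok s.coll).ncard ∧
    SameCounts G α β c s.color) (fun a => Q a t' s) r) := by
    intro F hF he hgood hsize hweak t'' ht''
    refine wp_bind (wp_disconnectStep hαβ hα hβ h₁ hF he hgood hsize hweak (by omega) ?_)
    intro c₂ K₂ w' P' X' t₃ k₁ k₂ k₃ k₄ k₅
    exact wp_pure ⟨X', k₁, k₂, rfl, by dsimp only; omega, by dsimp only; omega, h₄.trans k₅⟩
  have step₂ : ∀ F ∈ K₁, e₂ ∈ F.verts → (∀ F' ∈ K₁, F'.Weak G c₁ α used e₂) →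
      ∀ t'', t' ≤ t'' + 4 → wp (do
        let (e, P') ← disconnectStep G α β e₂ F P
        return Sum.inl (e₁, e, P') : Prog (State V d) ((V × V × Set V) ⊕ Unit)) t''
        ⟨c₁, K₁, S₁⟩ (fun r t' s => Sum.elim (fun q => ∃ X', DiscBase G s.color α β s.coll q.1 q.2.1
    q.2.2 X' ∧ EndWeak G s.color α used s.coll q.1 q.2.1 ∧ s.pending = S₁ ∧
    t₂ + potential s.color β s.coll X' ≤ t' + potential c β K X ∧
    7 * colorCount G s.color none + reserve s.coll q.1 + reserve s.coll q.2.1 + (tok K).ncard ≤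
      7 * colorCount G c none + reserve K a₁ + reserve K a₂ + (tok s.coll).ncard ∧
    SameCounts G α β c s.color) (fun a => Q a t' s) r) := by
    intro F hF he hweak t'' ht''
    refine wp_bind (wp_disconnectLoop_body hαβ hα hβ h₁.symm hF he hweak (by omega) ?_)
    intro c₂ K₂ w' P' X' t₃ k₁ k₂ k₃ k₄ k₅
    exact wp_pure ⟨X', k₁.symm, k₂.symm, rfl, by dsimp only; omega, by dsimp only; omega,
      h₄.trans k₅⟩
  have step₁' : ∀ F ∈ K₁, e₁ ∈ F.verts → (∀ F' ∈ K₁, F'.Weak G c₁ α used e₁) →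
      (∀ F' ∈ K₁, F' ≠ F → F'.Good G c₁ α used) ∧ F.verts.ncard = F.size ∧
      (∀ u L, F = .ufan u L → F.Weak G c₁ α used e₁) := by
    intro F hF he hweak
    refine ⟨fun F' hF' hne => (hweak F' hF').good fun hw' =>
      Set.disjoint_left.1 (h₁.disjoint hF' hF hne) hw' he, (hweak F hF).1, fun _ _ _ => hweak F hF⟩
  refine ⟨by omega, wp_bind (wp_fanContaining (by omega) ?_ ?_)⟩
  · intro F₁ hF₁ he₁
    refine wp_bind (wp_fanContaining (by omega) ?_ ?_)
    · intro F₂ hF₂ he₂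
      refine wp_bind (wp_isDamagedAt (by omega) ?_ ?_)
      · intro hdam
        simp only [if_true]
        rcases hz with rfl | rfl
        · obtain ⟨k₁, k₂, k₃⟩ := step₁' F₁ hF₁ he₁ hwk
          exact step₁ F₁ hF₁ he₁ k₁ k₂ k₃ _ (by omega)
        -- Only `z = e₂` may be damaged, yet `F₁` is damaged at `e₁`; this forces `z` into `F₁`, so
        -- all other fans are intact. A u-fan that is `Weak` at `z` cannot be damaged at `e₁`, so
        -- `F₁` is a c-fan and will be discarded.
        · have hzF : z ∈ F₁.verts := by
            by_contra hcon
            exact ((hwk F₁ hF₁).good hcon).not_damagedAt e₁ hdam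
          refine step₁ F₁ hF₁ he₁ (fun F' hF' hne => (hwk F' hF').good fun hw' =>
            Set.disjoint_left.1 (h₁.disjoint hF' hF₁ hne) hw' hzF) (hwk F₁ hF₁).1 ?_ _ (by omega)
          rintro u L rfl
          obtain ⟨-, -, -, m₁, m₂, -⟩ := hwk _ hF₁
          rcases hdam with ⟨rfl, hm⟩ | ⟨hm, hm'⟩
          · exact absurd hm (m₂ h₁.ne)
          · exact absurd (m₁ _ hm h₁.ne) hm'
      · intro hdam
        simp only [Bool.false_eq_true, if_false]
        rcases hz with rfl | rfl
        -- The only vertex that could be damaged is not, so all fans are good and may be regarded as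
        -- `Weak` at `e₂`.
        · refine step₂ F₂ hF₂ he₂ (fun F' hF' => ?_) _ (by omega)
          refine Fan.Good.weak ?_ _
          by_cases hne : F' = F₁
          · subst hne
            exact (hwk F' hF').good_of_not_damagedAt hdam
          · exact (hwk F' hF').good fun hw' =>
              Set.disjoint_left.1 (h₁.disjoint hF' hF₁ hne) hw' he₁
        · exact step₂ F₂ hF₂ he₂ hwk _ (by omega)
    · intro he₂
      have hall : ∀ F' ∈ K₁, F'.Weak G c₁ α used e₁ := by
        rcases hz with rfl | rfl
        · exact hwk
        · exact fun F' hF' => ((hwk F' hF').good (he₂ F' hF')).weak e₁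
      obtain ⟨k₁, k₂, k₃⟩ := step₁' F₁ hF₁ he₁ hall
      exact step₁ F₁ hF₁ he₁ k₁ k₂ k₃ _ (by omega)
  · intro he₁
    refine wp_bind (wp_fanContaining (by omega) ?_ ?_)
    · intro F₂ hF₂ he₂
      refine step₂ F₂ hF₂ he₂ ?_ _ (by omega)
      rcases hz with rfl | rfl
      · exact fun F' hF' => ((hwk F' hF').good (he₁ F' hF')).weak e₂
      · exact hwk
    · intro he₂
      have hc₁ : e₁ ∉ cover K₁ := fun ⟨F, hF, hm⟩ => he₁ F hF hm
      have hc₂ : e₂ ∉ cover K₁ := fun ⟨F, hF, hm⟩ => he₂ F hF hm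
      have hr₁ := reserve_le K a₁
      have hr₂ := reserve_le K a₂
      refine wp_pure (hQ c₁ K₁ X₁ _ ⟨h₁.isPartial, h₁.disjoint, h₁.closed, fun u hu huK => ?_,
        fun F hF => ?_⟩ (by omega) (by omega) h₄)
      · exact h₁.full u hu huK (fun he => hc₁ (he ▸ huK)) fun he => hc₂ (he ▸ huK)
      · refine (hwk F hF).good ?_
        rcases hz with rfl | rfl
        · exact he₁ F hF
        · exact he₂ F hF


/-- Coloring an edge `vx` by `δ`, where `v` is an end of a path in the set `X` of explored vertices
and `x` is not in `X`, prepares a call of Disconnect-Vertex. -/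
theorem AltPath.exists_discBase (hc : IsPartialEdgeColoring G c)
    (hγδ : (γ = α ∧ δ = β) ∨ (γ = β ∧ δ = α)) (hαβ : α ≠ β) {v x e : V} {p : List V}
    {X : Set V} (hX : IsABClosed c α β X) (hpX : ∀ a ∈ v :: p, a ∈ X) (hx : x ∉ X)
    (hvδ : δ ∈ missing c v) (hxδ : δ ∈ missing c x) (hadj : G.Adj v x) (hn : c s(v, x) = none)
    (hp : AltPath c γ δ (v :: p) e) (hnd : (v :: p).Nodup) (hK : K.PairwiseDisjoint Fan.verts)
    (hfull : ∀ u ∈ X, u ∈ cover K → u ≠ e → u ≠ v → α ∉ missing c u ∧ β ∉ missing c u)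
    (h' : c' = EdgeColoring.recolor c v x (some δ)) :
    ∃ q₁ a₁ q₂ a₂ Y, AltPath c' α β (v :: q₁) a₁ ∧ AltPath c' β α (v :: q₂) a₂ ∧
      DiscBase G c' α β K a₁ a₂ ({y | y ∈ v :: q₁} ∪ {y | y ∈ v :: q₂}) Y ∧
      (e = a₁ ∨ e = a₂) ∧
      10 * (present c' β \ Y).ncard + 4 * (q₁.length + q₂.length) ≤
        10 * (present c' β \ X).ncard + 4 * p.length + 20 := by
  subst h'
  have hne : γ ≠ δ := by
    rcases hγδ with ⟨rfl, rfl⟩ | ⟨rfl, rfl⟩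
    · exact hαβ
    · exact hαβ.symm
  have hvX : v ∈ X := hpX v (by simp)
  -- The new edge joins the old path, from `v` to `e` inside `X`, to the path from `x` to `e₂`
  -- outside `X`; the ends of the result are `e` and `e₂`.
  obtain ⟨p₂, e₂, hp₂, hnd₂⟩ := AltPath.exists hc γ hxδ
  have happ := hp₂.isAppended hc hγδ hαβ hX hvX hx hvδ hxδ hadj hn hnd₂
  have hp₁ := hp.recolor hnd hne hn (List.nodup_cons.1 hnd).1
    (fun hm => hx (hpX x (List.mem_cons_of_mem _ hm)))
  have hlen := happ.path.length_add_le hγδ hnd₂ happ.not_mem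
  have hvδ' : δ ∉ missing (EdgeColoring.recolor c v x (some δ)) v := by
    rw [happ.mem_missing_iff]; simp
  have hend : α ∈ missing (EdgeColoring.recolor c v x (some δ)) e ↔
      β ∉ missing (EdgeColoring.recolor c v x (some δ)) e := by
    have hex : (γ ∈ missing (EdgeColoring.recolor c v x (some δ)) e ↔
        δ ∉ missing (EdgeColoring.recolor c v x (some δ)) e) := by
      rcases hp₁.missing_last with ⟨hp, hm⟩ | ⟨h₁, h₂⟩ | ⟨h₁, h₂⟩
      · simp only [List.cons.injEq] at hp
        obtain ⟨rfl, -⟩ := hp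
        exact ⟨fun _ => hvδ', fun _ => hm⟩
      · tauto
      · tauto
    rcases hγδ with ⟨rfl, rfl⟩ | ⟨rfl, rfl⟩ <;> tauto
  have base : ∀ P : Set V, P ⊆ X ∪ {a | a ∈ x :: p₂} → e ∈ P → e₂ ∈ P →
      DiscBase G (EdgeColoring.recolor c v x (some δ)) α β K e e₂ P (X ∪ {a | a ∈ x :: p₂}) := by
    intro P hP h₁ h₂
    refine ⟨happ.isPartial, hK, happ.closed, hP, h₁, h₂, ?_, ?_, hend, happ.end_iff⟩
    · rintro rfl
      exact happ.not_mem e hp₂.last_mem (hpX e hp.last_mem)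
    · rintro u (hu | hu) huK hue hue₂
      · by_cases huv : u = v
        · subst huv
          have h₃ := (hp₁.not_mem_missing rfl List.mem_cons_self hue).1
          rcases hγδ with ⟨rfl, rfl⟩ | ⟨rfl, rfl⟩
          · exact ⟨h₃, hvδ'⟩
          · exact ⟨hvδ', h₃⟩
        · rw [happ.missing_eq u huv fun he => hx (he ▸ hu)]
          exact hfull u hu huK hue huv
      · exact happ.full u hu hue₂
  have hsub₁ : {y | y ∈ v :: p} ⊆ X ∪ {a | a ∈ x :: p₂} := fun a ha => Or.inl (hpX a ha)
  have hsub₂ : {y | y ∈ v :: x :: p₂} ⊆ X ∪ {a | a ∈ x :: p₂} := by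
    intro a ha
    rcases List.mem_cons.1 ha with rfl | ha
    · exact Or.inl hvX
    · exact Or.inr ha
  have hm₂ : e₂ ∈ v :: x :: p₂ := happ.path'.last_mem
  rcases hγδ with ⟨rfl, rfl⟩ | ⟨rfl, rfl⟩
  · refine ⟨p, e, x :: p₂, e₂, _, hp₁, happ.path', base _ (Set.union_subset hsub₁ hsub₂)
      (Or.inl hp.last_mem) (Or.inr hm₂), Or.inl rfl, ?_⟩
    simp only [List.length_cons]
    omega
  · refine ⟨x :: p₂, e₂, p, e, _, happ.path', hp₁, (base _ (Set.union_subset hsub₂ hsub₁)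
      (Or.inr hp.last_mem) (Or.inl hm₂)).symm, Or.inr rfl, ?_⟩
    simp only [List.length_cons]
    omega

end DisconnectVertex

/-! ### Preparing the call of Disconnect-Vertex after an activation -/

section ActivateFan

variable {V : Type} {d : ℕ} {G : SimpleGraph V} {c c₁ c₂ c' : Sym2 V → Option (Fin (d + 1))}
  {α β γ δ : Fin (d + 1)} {used : Set (Fin (d + 1))} {K : Set (Fan V d)} {S : Set V}

/-- Only the link at the `β`-colored edge `vy` is affected: `vy` becomes `α`, so the preceding leaf
has to lie in `X` as well, where missing `β` turns into missing `α`. On a list without `β`-edge the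
condition `hβ` is vacuous. -/
theorem IsShiftable.flipOn {X : Set V} {v : V} {xs : List V} (h : IsShiftable G c v xs)
    (hX : IsABClosed c α β X) (hv : v ∈ X) (hα : α ∈ missing c v)
    (hβ : ∀ l₁ x y l₂, xs = l₁ ++ x :: y :: l₂ → c s(v, y) = some β → x ∈ X) :
    IsShiftable G (flipOn c α β X) v xs := by
  refine ⟨h.adj, h.nodup, fun x hx => flipOn_eq_none.2 (h.head x hx), ?_⟩
  have hchain := h.chain
  rw [List.isChain_iff_forall_rel_of_append_cons_cons] at hchain ⊢
  intro x y l₁ l₂ hl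
  obtain ⟨ζ, h₁, h₂⟩ := hchain hl
  have hζα : ζ ≠ α := by
    rintro rfl
    exact hα y h₁
  by_cases hζβ : ζ = β
  · subst hζβ
    refine ⟨α, ?_, (mem_missing_flipOn_left hX (hβ _ _ _ _ hl h₁)).2 h₂⟩
    rw [flipOn_mk_eq_some hX, if_pos hv, Equiv.swap_apply_left, h₁]
  · exact ⟨ζ, (flipOn_eq_some_of_ne hζα hζβ).2 h₁, (mem_missing_flipOn_of_ne hX x hζα hζβ).2 h₂⟩

/-- The edge-coloring is ready for a call of Disconnect-Vertex at `v`; the number `n` bounds the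
cost of exploring the paths at `v` and other unexplored vertices. -/
def DiscReady (G : SimpleGraph V) (c : Sym2 V → Option (Fin (d + 1))) (α β : Fin (d + 1))
    (used : Set (Fin (d + 1))) (K : Set (Fan V d)) (v : V) (n : ℕ) : Prop :=
  ∃ q₁ a₁ q₂ a₂ Y, AltPath c α β (v :: q₁) a₁ ∧ AltPath c β α (v :: q₂) a₂ ∧
    DiscBase G c α β K a₁ a₂ ({y | y ∈ v :: q₁} ∪ {y | y ∈ v :: q₂}) Y ∧
    EndWeak G c α used K a₁ a₂ ∧
    10 * (present c β \ Y).ncard + 4 * (q₁.length + q₂.length) ≤ n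

/-- The new edge can add only the vertex `x` to the unexplored vertices with `β`, which raises the
constant from 20 to 30. -/
theorem AltPath.discReady [Fintype V] (hc : IsPartialEdgeColoring G c)
    (hγδ : (γ = α ∧ δ = β) ∨ (γ = β ∧ δ = α)) (hαβ : α ≠ β) {v x e : V} {p : List V}
    {X : Set V} (hX : IsABClosed c α β X) (hpX : ∀ a ∈ v :: p, a ∈ X) (hx : x ∉ X)
    (hvδ : δ ∈ missing c v) (hxδ : δ ∈ missing c x) (hadj : G.Adj v x) (hn : c s(v, x) = none)
    (hp : AltPath c γ δ (v :: p) e) (hnd : (v :: p).Nodup) (hK : K.PairwiseDisjoint Fan.verts)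
    (hfull : ∀ u ∈ X, u ∈ cover K → u ≠ e → u ≠ v → α ∉ missing c u ∧ β ∉ missing c u)
    (h' : c' = EdgeColoring.recolor c v x (some δ)) (hweak : ∀ F ∈ K, F.Weak G c' α used e) :
    DiscReady G c' α β used K v (10 * (present c β \ X).ncard + 4 * p.length + 30) := by
  classical
  obtain ⟨q₁, a₁, q₂, a₂, Y, h₁, h₂, h₃, h₄, h₅⟩ :=
    hp.exists_discBase hc hγδ hαβ hX hpX hx hvδ hxδ hadj hn hnd hK hfull h'
  refine ⟨q₁, a₁, q₂, a₂, Y, h₁, h₂, h₃, ⟨e, h₄, hweak⟩, ?_⟩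
  have hsub : present c' β \ X ⊆ insert x (present c β \ X) := by
    rintro u ⟨hu, huX⟩
    by_cases hux : u = x
    · exact Or.inl hux
    · refine Or.inr ⟨fun hm => hu ?_, huX⟩
      rwa [h', missing_recolor_some_of_ne hn (by rintro rfl; exact huX (hpX u (by simp))) hux]
  have := (Set.ncard_le_ncard hsub (Set.toFinite _)).trans (Set.ncard_insert_le _ _)
  omega

theorem wp_disconnectVertex_of_ready [Fintype V] [DecidableEq V] (hαβ : α ≠ β) (hα : α ∉ used)
    (hβ : β ∉ used) {v : V} {n t : ℕ} {Q : Unit → ℕ → State V d → Prop}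
    (h : DiscReady G c α β used K v n) (ht : n + 200 * (cover K).ncard + 15 ≤ t)
    (hQ : ∀ c' K' X' t', StageInv G c' α β used K' X' →
      t + potential c' β K' X' ≤ t' + n + 200 * (cover K).ncard + 15 →
      7 * colorCount G c' none + (tok K).ncard ≤
        7 * colorCount G c none + 4 + (tok K').ncard →
      SameCounts G α β c c' → Q () t' ⟨c', K', S⟩) :
    wp (disconnectVertex G α β v) t ⟨c, K, S⟩ Q := by
  obtain ⟨q₁, a₁, q₂, a₂, Y, h₁, h₂, h₃, h₄, h₅⟩ := h
  unfold potential at hQ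
  refine wp_disconnectVertex hαβ hα hβ h₁ h₂ h₃ h₄ (by unfold potential; omega)
    fun c' K' X' t' k₁ k₂ k₃ k₄ => hQ c' K' X' t' k₁ ?_ k₃ k₄
  unfold potential at k₂
  omega

theorem wp_leafBefore [DecidableEq V] (x y : V) (l₂ : List V) (s : State V d) (l₁ : List V) :
    ∀ {t : ℕ} {Q : Option V → ℕ → State V d → Prop}, (l₁ ++ x :: y :: l₂).Nodup →
    l₁.length + 1 ≤ t → (∀ t', t ≤ t' + l₁.length + 1 → Q (some x) t' s) →
    wp (leafBefore y (l₁ ++ x :: y :: l₂)) t s Q := by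
  induction l₁ with
  | nil =>
    intro t Q _ ht hQ
    simp only [List.nil_append, leafBefore, if_true]
    exact wp_bind (wp_tick (by omega) (wp_pure (hQ _ (by simp only [List.length_nil]; omega))))
  | cons a l₁ ih =>
    intro t Q hnd ht hQ
    have hnd' := (List.nodup_cons.1 hnd).2
    simp only [List.length_cons] at ht hQ
    obtain ⟨b, l, hl, hby⟩ : ∃ b l, l₁ ++ x :: y :: l₂ = b :: l ∧ b ≠ y := by
      cases l₁ with
      | nil => exact ⟨x, y :: l₂, rfl, fun h => by simp [h] at hnd'⟩
      | cons b l => exact ⟨b, l ++ x :: y :: l₂, rfl, fun h => by simp [h] at hnd'⟩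
    have hih := ih (t := t - 1) (Q := Q) hnd' (by omega) fun t' ht' => hQ t' (by omega)
    rw [List.cons_append, hl]
    rw [hl] at hih
    simp only [leafBefore, hby, if_false]
    exact wp_bind (wp_tick (by omega) hih)

/-- The reason why every path flipped or explored in a stage begins at an unexplored vertex. -/
theorem StageInv.not_mem_of_missing {E : Set V} (h : StageInv G c α β used K E) {u : V}
    (hu : u ∈ cover K) (hm : α ∈ missing c u ∨ β ∈ missing c u) : u ∉ E := fun huE =>
  hm.elim (h.full u huE hu).1 (h.full u huE hu).2

end ActivateFan

/-! ### The three cases of activating a c-fan -/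

section ActivateCFan

variable {V : Type} [Fintype V] {d : ℕ} {G : SimpleGraph V}
  {c c₁ c₂ c' : Sym2 V → Option (Fin (d + 1))}
  {α β γ δ : Fin (d + 1)} {used : Set (Fin (d + 1))} {K : Set (Fan V d)} {S : Set V}

/-- The common end of the three cases. Before the shift `β` is already missing at `v`, so the shift
moves no `β`-edge and the set of vertices with `β` is unchanged. -/
theorem IsShifted.discReady (hαβ : α ≠ β) {v x e : V} {zs p : List V} {X : Set V}
    (hs : IsShifted G c₁ c₂ v zs x) (hvβ : β ∈ missing c₁ v) (hxβ : β ∈ missing c₁ x)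
    (hadj : G.Adj v x) (hX : IsABClosed c₂ α β X) (hpX : ∀ a ∈ v :: p, a ∈ X)
    (hx : x ∉ X) (hp : AltPath c₂ α β (v :: p) e) (hnd : (v :: p).Nodup)
    (hK : K.PairwiseDisjoint Fan.verts) (hvK : v ∉ cover K) (hxK : x ∉ cover K)
    (hzs : ∀ z ∈ zs, z ∉ cover K)
    (hfull : ∀ u ∈ X, u ∈ cover K → u ≠ e → α ∉ missing c₁ u ∧ β ∉ missing c₁ u)
    (hweak : ∀ F ∈ K, F.Weak G c₁ α used e) :
    IsPartialEdgeColoring G (recolor c₂ v x (some β)) ∧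
    colorCount G (recolor c₂ v x (some β)) none + 1 = colorCount G c₁ none ∧
    SameCounts G α β c₁ (recolor c₂ v x (some β)) ∧
    DiscReady G (recolor c₂ v x (some β)) α β used K v
      (10 * (present c₁ β \ X).ncard + 4 * p.length + 30) := by
  have hvβ₂ : β ∈ missing c₂ v := (hs.mem_missing_iff hvβ v).2 hvβ
  have hxβ₂ : β ∈ missing c₂ x := hs.subset_last hxβ
  refine ⟨hs.isPartial.recolor_some hadj hvβ₂ hxβ₂, ?_, ?_, ?_⟩
  · rw [colorCount_recolor_some_none hadj hs.last, hs.count]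
  · intro ζ h₁ h₂
    rw [sameCounts_recolor (Or.inr rfl) hs.last ζ h₁ h₂, hs.count]
  · have hpres : present c₂ β = present c₁ β := by
      ext u
      exact not_congr (hs.mem_missing_iff hvβ u)
    rw [← hpres]
    refine hp.discReady hs.isPartial (Or.inl ⟨rfl, rfl⟩) hαβ hX hpX hx hvβ₂ hxβ₂ hadj hs.last hnd
      hK (fun u hu huK hue _ => ?_) rfl fun F hF => ?_
    · rw [hs.missing_of_not_mem u fun hz => hzs u hz huK]
      exact hfull u hu huK hue
    · have h₁ : F.SameOn c₁ c₂ := hs.sameOn (fun h => hvK ⟨F, hF, h⟩)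
        fun z hz h => hzs z hz ⟨F, hF, h⟩
      exact (h₁.trans (Fan.sameOn_recolor hs.last (fun h => hvK ⟨F, hF, h⟩)
        fun h => hxK ⟨F, hF, h⟩)).weak (hweak F hF)

/-- The result of the activation of a fan, when it starts with the coloring `c`; the time `n` is
used up. -/
def Activated (G : SimpleGraph V) (c c' : Sym2 V → Option (Fin (d + 1))) (α β : Fin (d + 1))
    (used : Set (Fin (d + 1))) (K : Set (Fan V d)) (E : Set V) (v : V) (n : ℕ) : Prop :=
  IsPartialEdgeColoring G c' ∧ colorCount G c' none + 1 = colorCount G c none ∧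
  SameCounts G α β c c' ∧
  ∃ m, n + m ≤ 10 * (present c β \ E).ncard + 60 ∧ DiscReady G c' α β used K v m

/-- The center misses both colors and forms a component by itself, so no flip is needed and the path
at `v` is trivial. -/
theorem IsShifted.activated_of_missing (hαβ : α ≠ β) {v x : V} {zs : List V} {E : Set V}
    (hinv : StageInv G c α β used (insert (.cfan v zs β) K) E)
    (hK : K.PairwiseDisjoint Fan.verts)
    (hd : ∀ u ∈ (Fan.cfan v zs β).verts, u ∉ cover K)
    (hx : x ∈ zs) (hadj : G.Adj v x) (hvzs : v ∉ zs) (hvα : α ∈ missing c v)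
    (hvβ : β ∈ missing c v) (hxβ : β ∈ missing c x) (hs : IsShifted G c c₂ v zs x) :
    Activated G c (recolor c₂ v x (some β)) α β used K E v 0 := by
  have hcov : ∀ u ∈ (Fan.cfan v zs β).verts, u ∈ cover (insert (.cfan v zs β) K) := fun u hu =>
    ⟨_, Set.mem_insert _ _, hu⟩
  have hxE := hinv.not_mem_of_missing (hcov x (Or.inr hx)) (Or.inr hxβ)
  have hα₂ := hs.eq_some_iff α fun y _ => hvα y
  have hβ₂ := hs.eq_some_iff β fun y _ => hvβ y
  have hX : IsABClosed c₂ α β (E ∪ {v}) := by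
    refine IsABClosed.union (fun u hu w hw => hinv.closed u hu w ?_) fun u hu w hw => ?_
    · rwa [hα₂, hβ₂] at hw
    · rw [Set.mem_singleton_iff.1 hu, hα₂, hβ₂] at hw
      exact (hw.elim (hvα w) (hvβ w)).elim
  have hfull : ∀ u ∈ E ∪ {v}, u ∈ cover K → u ≠ v → α ∉ missing c u ∧ β ∉ missing c u := by
    rintro u (hu | hu) huK hue
    · exact hinv.full u hu (by rw [cover_insert]; exact Or.inr huK)
    · exact absurd hu hue
  obtain ⟨h₁, h₂, h₃, h₄⟩ := hs.discReady (used := used) (p := []) hαβ hvβ hxβ hadj hX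
    (by simp) (by rintro (h | rfl); exacts [hxE h, hvzs hx])
    (.last _ _ _ ((hs.mem_missing_iff hvα v).2 hvα)) (by simp) hK (hd v (Or.inl rfl))
    (hd x (Or.inr hx)) (fun z hz => hd z (Or.inr hz)) hfull
    (fun F hF => (hinv.good F (Or.inr hF)).weak v)
  · refine ⟨h₁, h₂, h₃, _, ?_, h₄⟩
    have : (present c β \ (E ∪ {v})).ncard ≤ (present c β \ E).ncard :=
      Set.ncard_le_ncard (Set.sdiff_subset_sdiff_right Set.subset_union_left) (Set.toFinite _)
    simp only [List.length_nil]
    omega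

theorem eq_of_append_cons_cons {ι : Type} {l₁ l₂ m₁ m₂ : List ι} {x x' y : ι}
    (h : (l₁ ++ x :: y :: l₂).Nodup) (he : l₁ ++ x :: y :: l₂ = m₁ ++ x' :: y :: m₂) : x' = x := by
  rw [List.append_cons l₁, List.append_cons m₁] at he
  rw [List.append_cons l₁] at h
  have hn' := (List.nodup_middle.1 (he ▸ h))
  rw [List.nodup_cons, List.mem_append, not_or] at hn'
  have := ((List.append_cons_inj_of_notMem hn'.1.1 hn'.1.2).1 he.symm).1
  exact (List.cons.inj (List.append_inj' this rfl).2).1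

/-- The colors `α` and `β` have been exchanged on the path that begins at the center `v` of the
fan `F`. -/
structure Flipped (G : SimpleGraph V) (c c₁ : Sym2 V → Option (Fin (d + 1)))
    (α β γ δ : Fin (d + 1)) (K : Set (Fan V d)) (F : Fan V d) (E : Set V) (v w : V)
    (p : List V) : Prop where
  closed : IsABClosed c α β {a | a ∈ v :: p}
  eq : c₁ = flipOn c α β {a | a ∈ v :: p}
  closed' : IsABClosed c₁ α β (E ∪ {a | a ∈ v :: p})
  isPartial : IsPartialEdgeColoring G c₁
  path' : AltPath c₁ δ γ (v :: p) w
  full : ∀ u ∈ E ∪ {a | a ∈ v :: p}, u ∈ cover (insert F K) → u ≠ w → u ≠ v →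
    α ∉ missing c₁ u ∧ β ∉ missing c₁ u
  not_mem : ∀ u, γ ∈ missing c u → u ≠ w → u ∉ v :: p
  length_le : p.length + (present c₁ β \ (E ∪ {a | a ∈ v :: p})).ncard ≤
    (present c β \ E).ncard + 1

theorem AltPath.flipped {F : Fan V d} {E : Set V} {v w : V} {p : List V}
    (hinv : StageInv G c α β used (insert F K) E)
    (hγδ : (γ = α ∧ δ = β) ∨ (γ = β ∧ δ = α)) (hv : v ∈ cover (insert F K))
    (hδ : δ ∈ missing c v) (hp : AltPath c γ δ (v :: p) w) (hnd : (v :: p).Nodup)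
    (h₁ : c₁ = EdgeColoring.flipOn c α β {a | a ∈ v :: p}) :
    Flipped G c c₁ α β γ δ K F E v w p := by
  have hcl : IsABClosed c α β {a | a ∈ v :: p} :=
    (IsABClosed.of_or hγδ).1 (hp.isABClosed hinv.isPartial hδ)
  have hvE : v ∉ E := hinv.not_mem_of_missing hv (by
    rcases hγδ with ⟨rfl, rfl⟩ | ⟨rfl, rfl⟩
    · exact Or.inr hδ
    · exact Or.inl hδ)
  have hpE : ∀ u ∈ v :: p, u ∉ E := fun u hu huE =>
    hvE (hp.head_mem rfl ((IsABClosed.of_or hγδ).2 hinv.closed) hu huE)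
  have hlen := hp.length_add_le hγδ hnd hpE
  refine ⟨hcl, h₁, ?_, ?_, ?_, ?_, ?_, ?_⟩
  · rw [h₁]
    exact (hinv.closed.union hcl).flipOn
  · rw [h₁]
    exact hinv.isPartial.flipOn hcl
  · rw [h₁]
    rcases hγδ with ⟨rfl, rfl⟩ | ⟨rfl, rfl⟩
    · exact hp.flipOn hcl fun _ ha => ha
    · rw [flipOn_comm]
      exact hp.flipOn hcl.symm fun _ ha => ha
  · intro u hu huK huw huv
    have hfull : α ∉ missing c u ∧ β ∉ missing c u := by
      rcases hu with hu | hu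
      · exact hinv.full u hu huK
      · rcases hp.present_or hγδ hu with h | h | h
        · exact absurd h huv
        · exact absurd h huw
        · exact h
    rwa [h₁, missing_flipOn_of_full hcl hfull.1 hfull.2]
  · intro u hu huw hup
    exact (hp.not_mem_missing rfl hup huw).1 hu
  · refine le_trans (Nat.add_le_add_left (Set.ncard_le_ncard ?_ (Set.toFinite _)) _) hlen
    rintro u ⟨hu, hu'⟩
    refine ⟨?_, hu'⟩
    rwa [present, Set.mem_ofPred_eq, h₁, missing_flipOn_of_not_mem hcl fun h => hu' (Or.inr h)] at hu

/-- The leaves in `zs` come before the `β`-edge of the fan, so the shift moves neither `α` nor `β`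
and the flipped path survives. As `y` misses `β` and is not the far end `w`, it is off this path and
still misses `β`. -/
theorem Flipped.activated_of_ne (hαβ : α ≠ β) (hα : α ∉ used) (hβ : β ∉ used) {v w y : V}
    {zs xs p : List V} {E : Set V}
    (hinv : StageInv G c α β used (insert (.cfan v xs β) K) E)
    (hK : K.PairwiseDisjoint Fan.verts)
    (hd : ∀ u ∈ (Fan.cfan v xs β).verts, u ∉ cover K) (hp : AltPath c β α (v :: p) w)
    (hnd : (v :: p).Nodup) (h : Flipped G c c₁ α β β α K (.cfan v xs β) E v w p)
    (hy : y ∈ xs) (hzs : ∀ z ∈ zs, z ∈ xs) (hadj : G.Adj v y)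
    (hvα : α ∈ missing c v) (hyβ : β ∈ missing c y) (hyw : y ≠ w)
    (hcol : ∀ z ∈ zs, c s(v, z) ≠ some β) (hs : IsShifted G c₁ c₂ v zs y) :
    Activated G c (recolor c₂ v y (some β)) α β used K E v (4 * (p.length + 1) + 1) := by
  have hv : v ∈ {a | a ∈ v :: p} := List.mem_cons_self
  have hcov : ∀ u ∈ (Fan.cfan v xs β).verts, u ∈ cover (insert (.cfan v xs β) K) := fun u hu =>
    ⟨_, Set.mem_insert _ _, hu⟩
  have hyE := hinv.not_mem_of_missing (hcov y (Or.inr hy)) (Or.inr hyβ)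
  have hyp : y ∉ {a | a ∈ v :: p} := h.not_mem y hyβ hyw
  have hvβ₁ : β ∈ missing c₁ v := by rwa [h.eq, mem_missing_flipOn_right h.closed hv]
  have hyβ₁ : β ∈ missing c₁ y := by rwa [h.eq, missing_flipOn_of_not_mem h.closed hyp]
  have hα₂ := hs.eq_some_iff α fun z hz => by
    rw [h.eq, Ne, flipOn_mk_eq_some h.closed, if_pos hv, Equiv.swap_apply_left]
    exact hcol z hz
  have hβ₂ := hs.eq_some_iff β fun z _ => hvβ₁ z
  obtain ⟨k₁, k₂, k₃, k₄⟩ := hs.discReady (used := used) (K := K) hαβ hvβ₁ hyβ₁ hadj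
    (X := E ∪ {a | a ∈ v :: p}) (e := w) (p := p)
    (fun u hu x hx => h.closed' u hu x (by rwa [hα₂, hβ₂] at hx)) (fun a ha => Or.inr ha)
    (by rintro (h | h); exacts [hyE h, hyp h])
    (h.path'.congr fun a _ b ζ hζ => by rcases hζ with rfl | rfl <;> simp only [hα₂, hβ₂]) hnd hK
    (hd v (Or.inl rfl)) (hd y (Or.inr hy)) (fun z hz => hd z (Or.inr (hzs z hz)))
    (fun u hu huK huw => h.full u hu (by rw [cover_insert]; exact Or.inr huK) huw
      fun huv => hd v (Or.inl rfl) (huv ▸ huK))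
    (fun F hF => by
      rw [h.eq]
      exact (hinv.good F (Or.inr hF)).weak_flipOn hinv.isPartial (Or.inr ⟨rfl, rfl⟩) hp hvα hα hβ
        fun hvF => hd v (Or.inl rfl) ⟨F, hF, hvF⟩)
  have hlen := h.length_le
  refine ⟨k₁, ?_, ?_, _, ?_, k₄⟩
  · rw [k₂, h.eq, colorCount_flipOn_none]
  · rw [h.eq] at k₃
    exact sameCounts_flipOn.trans k₃
  · omega

/-- The flipped path ends at the leaf `w` just before `y`. Then `w` misses `α` and `vy` has color
`α`, so the whole fan can still be shifted. Since `w` belongs to the fan being discarded, the flip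
damages no other fan. -/
theorem Flipped.activated_of_eq (hαβ : α ≠ β) (hα : α ∉ used) (hβ : β ∉ used) {v w y x : V}
    {l₁ l₂ p : List V} {E : Set V}
    (hinv : StageInv G c α β used (insert (.cfan v (l₁ ++ w :: y :: l₂) β) K) E)
    (hK : K.PairwiseDisjoint Fan.verts)
    (hd : ∀ u ∈ (Fan.cfan v (l₁ ++ w :: y :: l₂) β).verts, u ∉ cover K)
    (hp : AltPath c β α (v :: p) w)
    (h : Flipped G c c₁ α β β α K (.cfan v (l₁ ++ w :: y :: l₂) β) E v w p)
    (hsh : IsShiftable G c v (l₁ ++ w :: y :: l₂))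
    (hx : x ∈ l₁ ++ w :: y :: l₂) (hxw : x ≠ w)
    (hvα : α ∈ missing c v) (hxβ : β ∈ missing c x) (hy : c s(v, y) = some β)
    (hs : IsShifted G c₁ c₂ v (l₁ ++ w :: y :: l₂) x) :
    Activated G c (recolor c₂ v x (some β)) α β used K E v (4 * (p.length + 1) + 1) := by
  have hv : v ∈ {a | a ∈ v :: p} := List.mem_cons_self
  have hvxs := hsh.center_not_mem
  have hcov : ∀ u ∈ (Fan.cfan v (l₁ ++ w :: y :: l₂) β).verts,
      u ∈ cover (insert (.cfan v (l₁ ++ w :: y :: l₂) β) K) := fun u hu =>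
    ⟨_, Set.mem_insert _ _, hu⟩
  have hwK : w ∉ cover K := hd w (Or.inr (by simp))
  have hxE := hinv.not_mem_of_missing (hcov x (Or.inr hx)) (Or.inr hxβ)
  have hxp : x ∉ {a | a ∈ v :: p} := h.not_mem x hxβ hxw
  have hvβ₁ : β ∈ missing c₁ v := by rwa [h.eq, mem_missing_flipOn_right h.closed hv]
  have hxβ₁ : β ∈ missing c₁ x := by rwa [h.eq, missing_flipOn_of_not_mem h.closed hxp]
  -- The shift moves `α` from `vy` to `vw` and touches no other edge of the two colors. Both ends of
  -- `vw` lie on the flipped path, so closed sets containing that path remain closed.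
  have horig : ∀ e, (c₂ e = some α ∨ c₂ e = some β) →
      (c₁ e = some α ∨ c₁ e = some β) ∨ e = s(v, w) := by
    have key : ∀ ζ, (ζ = α ∨ ζ = β) → ∀ e, c₂ e = some ζ → c₁ e = some ζ ∨ e = s(v, w) := by
      intro ζ hζ e he
      refine (hs.origin e ζ he).imp_right ?_
      rintro ⟨m₁, a, b, m₂, hl, hb, rfl⟩
      have hbβ : c s(v, b) = some β := by
        have : c s(v, b) = some α ∨ c s(v, b) = some β := by
          rw [← flipOn_eq_or (K := {a | a ∈ v :: p}), ← h.eq]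
          rcases hζ with rfl | rfl
          · exact Or.inl hb
          · exact Or.inr hb
        exact this.resolve_left (hvα b)
      have hby : b = y := hinv.isPartial.proper v b y β hbβ hy
      subst hby
      rw [eq_of_append_cons_cons hsh.nodup hl]
    rintro e (he | he)
    · exact (key α (Or.inl rfl) e he).imp_left Or.inl
    · exact (key β (Or.inr rfl) e he).imp_left Or.inr
  have hclosed : ∀ X : Set V, IsABClosed c₁ α β X → v ∈ X → w ∈ X → IsABClosed c₂ α β X := by
    intro X hX hvX hwX u hu b hb
    rcases horig _ hb with hb | hb
    · exact hX u hu b hb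
    · rcases Sym2.eq_iff.1 hb with ⟨-, rfl⟩ | ⟨-, rfl⟩
      · exact hwX
      · exact hvX
  have hwp : w ∈ {a | a ∈ v :: p} := hp.last_mem
  have hcl₁ : IsABClosed c₁ α β {a | a ∈ v :: p} := by
    rw [h.eq]; exact h.closed.flipOn
  -- The shift may have cut the old path, so the path at `v` is taken anew; it stays within the
  -- vertices of the old one, which bounds its length.
  obtain ⟨p₁, e, hp₁, hnd₁⟩ := AltPath.exists hs.isPartial α ((hs.mem_missing_iff hvβ₁ v).2 hvβ₁)
  have hsub : ∀ a ∈ v :: p₁, a ∈ v :: p := hp₁.subset rfl (hclosed _ hcl₁ hv hwp) hv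
  have hlen₁ : (v :: p₁).length ≤ (v :: p).length :=
    (List.subperm_of_subset hnd₁ hsub).length_le
  simp only [List.length_cons] at hlen₁
  obtain ⟨k₁, k₂, k₃, k₄⟩ := hs.discReady (used := used) (K := K) hαβ hvβ₁ hxβ₁
    (hsh.adj x hx) (X := E ∪ {a | a ∈ v :: p}) (e := e) (p := p₁)
    (hclosed _ h.closed' (Or.inr hv) (Or.inr hwp)) (fun a ha => Or.inr (hsub a ha))
    (by rintro (h | h); exacts [hxE h, hxp h])
    hp₁ hnd₁ hK
    (hd v (Or.inl rfl)) (hd x (Or.inr hx)) (fun z hz => hd z (Or.inr hz))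
    (fun u hu huK _ => h.full u hu (by rw [cover_insert]; exact Or.inr huK)
      (fun huw => hwK (huw ▸ huK)) fun huv => hd v (Or.inl rfl) (huv ▸ huK))
    (fun F hF => by
      rw [h.eq]
      exact (((hinv.good F (Or.inr hF)).weak_flipOn hinv.isPartial (Or.inr ⟨rfl, rfl⟩) hp hvα hα hβ
        fun hvF => hd v (Or.inl rfl) ⟨F, hF, hvF⟩).good fun hw => hwK ⟨F, hF, hw⟩).weak e)
  have hlen := h.length_le
  refine ⟨k₁, ?_, ?_, _, ?_, k₄⟩
  · rw [k₂, h.eq, colorCount_flipOn_none]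
  · rw [h.eq] at k₃
    exact sameCounts_flipOn.trans k₃
  · omega

end ActivateCFan

/-! ### Execution of the activation of a c-fan -/

section Activate

variable {V : Type} [Fintype V] [DecidableEq V] {d : ℕ} {G : SimpleGraph V}
  {c c' : Sym2 V → Option (Fin (d + 1))}
  {α β : Fin (d + 1)} {used : Set (Fin (d + 1))} {K : Set (Fan V d)} {S : Set V}

theorem wp_activateCFan (hαβ : α ≠ β) (hα : α ∉ used) (hβ : β ∉ used) {v : V} {xs : List V}
    {E : Set V} {t : ℕ} {Q : Unit → ℕ → State V d → Prop}
    (hinv : StageInv G c α β used (insert (.cfan v xs β) K) E)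
    (hK : K.PairwiseDisjoint Fan.verts) (hd : ∀ u ∈ (Fan.cfan v xs β).verts, u ∉ cover K)
    (ht : 10 * (present c β \ E).ncard + 5 * xs.length + 60 ≤ t)
    (hQ : ∀ c' n t', Activated G c c' α β used K E v n → t ≤ t' + n + 5 * xs.length + 5 →
      Q () t' ⟨c', insert (.cfan v xs β) K, S⟩) :
    wp (activateCFan G α v xs β) t ⟨c, insert (.cfan v xs β) K, S⟩ Q := by
  obtain ⟨⟨hcf, ⟨xk, hxk, hxkβ⟩, hor⟩, -, -⟩ := hinv.good _ (Set.mem_insert _ _)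
  obtain ⟨hvα, hne, hsh⟩ := isCFan_iff.1 hcf
  obtain ⟨pre, rfl⟩ : ∃ pre, xs = pre ++ [xk] := by
    rw [Option.mem_def, List.getLast?_eq_some_iff] at hxk
    exact hxk
  have hvxs := hsh.center_not_mem
  simp only [List.length_append, List.length_singleton] at ht hQ
  unfold activateCFan
  simp only [List.getLast?_append, List.getLast?_singleton, Option.some_or]
  refine wp_bind (wp_isMissing (by omega) ?_ ?_)
  · intro hvβ
    simp only [if_true]
    refine wp_bind (wp_shift v xk [] _ _ pre _ _ _ hinv.isPartial hsh (by omega) ?_)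
    intro c₂ t₂ ht₂ hs
    refine wp_colorEdge (by omega) (hsh.adj xk (by simp)) hs.last
      ((hs.mem_missing_iff hvβ v).2 hvβ) ((hs.mem_missing_iff hvβ xk).2 hxkβ) ?_
    exact hQ _ 0 _ (hs.activated_of_missing hαβ hinv hK hd (by simp) (hsh.adj xk (by simp)) hvxs hvα
      hvβ hxkβ) (by omega)
  · intro hvβ
    simp only [Bool.false_eq_true, if_false]
    obtain ⟨xj, hxj, hcol⟩ := hor.resolve_left hvβ
    refine wp_bind (wp_lookup (by omega) ?_ fun h => absurd h hvβ)
    intro xj' hcol'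
    obtain rfl : xj' = xj := hinv.isPartial.proper v _ _ β hcol' hcol
    dsimp only
    obtain ⟨l, l₂, hl⟩ := List.append_of_mem hxj
    -- The leaf with the `β`-edge is not the first one, as the first edge is uncolored; so it has a
    -- predecessor.
    obtain ⟨l₁, y, rfl⟩ : ∃ l₁ y, l = l₁ ++ [y] := by
      rcases List.eq_nil_or_concat l with rfl | ⟨l₁, y, h⟩
      · have := hsh.head xj' (by rw [hl]; rfl)
        rw [this] at hcol
        exact absurd hcol (by simp)
      · exact ⟨l₁, y, by simpa using h⟩
    rw [List.append_assoc, List.singleton_append] at hl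
    have hlen : l₁.length + 2 ≤ pre.length + 1 := by
      have := congrArg List.length hl
      simp only [List.length_append, List.length_cons, List.length_nil] at this
      omega
    have hnd' : (l₁ ++ y :: xj' :: l₂).Nodup := hl ▸ hsh.nodup
    have hleaf := fun {t Q} => wp_leafBefore (t := t) (Q := Q) y xj' l₂
      ⟨c, insert (.cfan v (pre ++ [xk]) β) K, S⟩ l₁ hnd'
    rw [← hl] at hleaf
    refine wp_bind (hleaf (by omega) ?_)
    intro t₁ ht₁
    dsimp only
    obtain ⟨p, w, hp, hnd⟩ := AltPath.exists hinv.isPartial β hvα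
    have hfl := hp.flipped hinv (Or.inr ⟨rfl, rfl⟩) ⟨_, Set.mem_insert _ _, Or.inl rfl⟩ hvα hnd rfl
    have hlen' := hfl.length_le
    refine wp_bind (wp_flipPath hinv.isPartial (Or.inl ⟨rfl, rfl, hvα⟩) hp hnd (by omega) ?_)
    intro t₂ ht₂
    have hv : v ∈ {a | a ∈ v :: p} := List.mem_cons_self
    have hvβ₁ : β ∈ missing (flipOn c α β {a | a ∈ v :: p}) v := by
      rwa [mem_missing_flipOn_right hfl.closed hv]
    have hnext : ∀ m₁ a b m₂, pre ++ [xk] = m₁ ++ a :: b :: m₂ → c s(v, b) = some β → a = y := by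
      intro m₁ a b m₂ hm hb
      obtain rfl := hinv.isPartial.proper v _ _ β hb hcol
      exact eq_of_append_cons_cons hnd' (hl.symm.trans hm)
    by_cases hwy : w = y
    · subst hwy
      simp only [ne_eq, not_true, if_false]
      have hsh₁ := hsh.flipOn hfl.closed hv hvα fun m₁ a b m₂ hm hb => by
        rw [hnext m₁ a b m₂ hm hb]; exact hp.last_mem
      refine wp_bind (wp_shift v xk [] _ _ pre _ _ _ hfl.isPartial hsh₁ (by omega) ?_)
      intro c₂ t₃ ht₃ hs
      -- The leaf `w` is followed by `xj'`, so it is not the last one.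
      have hxw : xk ≠ w := by
        rintro rfl
        have h₁ : (xj' :: l₂).getLast? = some xk := by
          have := congrArg List.getLast? hl
          rw [List.getLast?_concat, List.append_cons, List.getLast?_append_of_ne_nil _ (by simp)] at this
          exact this.symm
        have h₂ := (List.nodup_cons.1 (List.nodup_append.1 hnd').2.1).1
        exact h₂ (List.mem_of_getLast? h₁)
      have hxkβ₁ : β ∈ missing (flipOn c α β {a | a ∈ v :: p}) xk := by
        rwa [missing_flipOn_of_not_mem hfl.closed (hfl.not_mem xk hxkβ hxw)]
      refine wp_colorEdge (by omega) (hsh.adj xk (by simp)) hs.last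
        ((hs.mem_missing_iff hvβ₁ v).2 hvβ₁) ((hs.mem_missing_iff hvβ₁ xk).2 hxkβ₁) ?_
      refine hQ _ (4 * (p.length + 1) + 1) _ ?_ (by omega)
      have hxk' : xk ∈ pre ++ [xk] := by simp
      rw [hl] at hinv hd hfl hsh hs hxk'
      exact hfl.activated_of_eq hαβ hα hβ hinv hK hd hp hsh hxk' hxw hvα hxkβ hcol hs
    · simp only [ne_eq, hwy, not_false_iff, if_true]
      have hpre : pre ++ [xk] = (l₁ ++ [y]) ++ (xj' :: l₂) := by simp [hl]
      have hxjl : xj' ∉ l₁ ++ [y] := fun h =>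
        List.disjoint_of_nodup_append (hpre ▸ hsh.nodup) h List.mem_cons_self
      have hcoll : ∀ z ∈ l₁ ++ [y], c s(v, z) ≠ some β := fun z hz hzβ =>
        hxjl (hinv.isPartial.proper v _ _ β hzβ hcol ▸ hz)
      have hsh' : IsShiftable G c v (l₁ ++ [y]) := (hpre ▸ hsh).left_of_append
      have hsh₁ := hsh'.flipOn hfl.closed hv hvα fun m₁ a b m₂ hm hb =>
        absurd hb (hcoll b (hm ▸ by simp))
      have hymem : y ∈ pre ++ [xk] := by rw [hl]; simp
      have hyβ : β ∈ missing c y := by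
        have := hsh.chain
        rw [List.isChain_iff_forall_rel_of_append_cons_cons] at this
        obtain ⟨ζ, h₁, h₂⟩ := this hl
        rw [hcol] at h₁
        cases h₁
        exact h₂
      have hsp := wp_shift (G := G) v y (xj' :: l₂) (insert (.cfan v (pre ++ [xk]) β) K) S l₁
      rw [← hl] at hsp
      refine wp_bind (hsp _ _ _ hfl.isPartial hsh₁ (by omega) ?_)
      intro c₂ t₃ ht₃ hs
      have hyβ₁ : β ∈ missing (flipOn c α β {a | a ∈ v :: p}) y := by
        rwa [missing_flipOn_of_not_mem hfl.closed (hfl.not_mem y hyβ (Ne.symm hwy))]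
      refine wp_colorEdge (by omega) (hsh.adj y hymem) hs.last
        ((hs.mem_missing_iff hvβ₁ v).2 hvβ₁) ((hs.mem_missing_iff hvβ₁ y).2 hyβ₁) ?_
      refine hQ _ (4 * (p.length + 1) + 1) _ ?_ (by omega)
      exact hfl.activated_of_ne hαβ hα hβ hinv hK hd hp hnd hymem
        (fun z hz => hpre ▸ List.mem_append_left _ hz) (hsh.adj y hymem) hvα hyβ (Ne.symm hwy)
        hcoll hs

end Activate

/-! ### Activating a u-fan, and a whole stage -/

section ActivationStage

variable {V : Type} [Fintype V] [DecidableEq V] {d : ℕ} {G : SimpleGraph V}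
  {c c' : Sym2 V → Option (Fin (d + 1))}
  {α β : Fin (d + 1)} {used : Set (Fin (d + 1))} {K : Set (Fan V d)} {S : Set V}

/-- The center has `α` and misses `β`; the flip makes it miss `α`. A leaf misses `α`, so it can lie
on the path only as its far end `w`; all others still miss `α` and any of them can be joined to `v`
by an `α`-edge. -/
theorem wp_activateUFan (hαβ : α ≠ β) (hα : α ∉ used) (hβ : β ∉ used) {v : V} {L : Finset V}
    {E : Set V} {t : ℕ} {Q : Finset V → ℕ → State V d → Prop}
    (hinv : StageInv G c α β used (insert (.ufan v L) K) E)
    (hK : K.PairwiseDisjoint Fan.verts) (hd : ∀ u ∈ (Fan.ufan v L : Fan V d).verts, u ∉ cover K)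
    (hvβ : β ∈ missing c v) (ht : 10 * (present c β \ E).ncard + 60 ≤ t)
    (hQ : ∀ c' L' K' n t', L' ⊆ L → L'.card < L.card → L.card ≤ L'.card + 2 →
      K' = (if L'.card < 2 then K else insert (.ufan v L') K) →
      Activated G c c' α β used K' E v n → t ≤ t' + n + 5 →
      Q L' t' ⟨c', insert (.ufan v L) K, S⟩) :
    wp (activateUFan G α v L β) t ⟨c, insert (.ufan v L) K, S⟩ Q := by
  obtain ⟨⟨hcard, hleaf, hvα⟩, hproc⟩ := hinv.good _ (Set.mem_insert _ _)
  have hcov : ∀ u ∈ (Fan.ufan v L : Fan V d).verts, u ∈ cover (insert (.ufan v L) K) := fun u hu =>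
    ⟨_, Set.mem_insert _ _, hu⟩
  obtain ⟨p, w, hp, hnd⟩ := AltPath.exists hinv.isPartial α hvβ
  have h := hp.flipped hinv (Or.inl ⟨rfl, rfl⟩) (hcov v (Or.inl rfl)) hvβ hnd rfl
  have hlen := h.length_le
  refine wp_bind (wp_flipPath hinv.isPartial (Or.inr ⟨rfl, rfl, hvα, hvβ⟩) hp hnd (by omega) ?_)
  intro t₁ ht₁
  have herase : L.card ≤ (L.erase w).card + 1 := by
    have := Finset.pred_card_le_card_erase (s := L) (a := w)
    omega
  -- A u-fan has at least two leaves, and the flip spoils at most one.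
  have hne : (L.erase w).Nonempty := Finset.card_pos.1 (by omega)
  refine wp_bind (wp_pick hne fun x hx => ?_)
  have hxL : x ∈ L := Finset.mem_of_mem_erase hx
  have hxw : x ≠ w := Finset.ne_of_mem_erase hx
  obtain ⟨hadj, hnone, hxα⟩ := hleaf x hxL
  have hv : v ∈ {a | a ∈ v :: p} := List.mem_cons_self
  have hxp : x ∉ {a | a ∈ v :: p} := h.not_mem x hxα hxw
  have hxE := hinv.not_mem_of_missing (hcov x (Or.inr hxL)) (Or.inl hxα)
  have hvα₁ : α ∈ missing (flipOn c α β {a | a ∈ v :: p}) v := by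
    rwa [mem_missing_flipOn_left h.closed hv]
  have hxα₁ : α ∈ missing (flipOn c α β {a | a ∈ v :: p}) x := by
    rwa [missing_flipOn_of_not_mem h.closed hxp]
  have hnone₁ : flipOn c α β {a | a ∈ v :: p} s(v, x) = none := flipOn_eq_none.2 hnone
  refine wp_bind (wp_colorEdge (by omega) hadj hnone₁ hvα₁ hxα₁ (wp_pure ?_))
  have hsub : (L.erase w).erase x ⊆ L :=
    (Finset.erase_subset _ _).trans (Finset.erase_subset _ _)
  have hcard' : ((L.erase w).erase x).card + 1 = (L.erase w).card :=
    Finset.card_erase_add_one hx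
  have hle : (L.erase w).card ≤ L.card := Finset.card_le_card (Finset.erase_subset _ _)
  refine hQ _ _ _ (4 * (p.length + 1) + 1) _ hsub (by omega) (by omega) rfl ?_ (by omega)
  set K' : Set (Fan V d) := if ((L.erase w).erase x).card < 2 then K else
    insert (.ufan v ((L.erase w).erase x)) K with hK'
  have hverts : (Fan.ufan v ((L.erase w).erase x) : Fan V d).verts ⊆ (Fan.ufan v L : Fan V d).verts :=
    verts_ufan_erase.trans verts_ufan_erase
  have hdisj' : K'.PairwiseDisjoint Fan.verts := by
    rw [hK']
    split_ifs
    · exact hK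
    · exact pairwiseDisjoint_insert hK fun u hu => hd u (hverts hu)
  have hcov' : cover K' ⊆ cover (insert (.ufan v L) K) := by
    rw [hK', cover_insert]
    split_ifs
    · exact Set.subset_union_right
    · rw [cover_insert]
      exact Set.union_subset_union_left _ hverts
  have hweak : ∀ F ∈ K, F.Weak G (recolor (flipOn c α β {a | a ∈ v :: p}) v x (some α)) α used w := by
    intro F hF
    have hvF : v ∉ F.verts := fun hvF => hd v (Or.inl rfl) ⟨F, hF, hvF⟩
    have hxF : x ∉ F.verts := fun hxF => hd x (Or.inr hxL) ⟨F, hF, hxF⟩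
    exact (Fan.sameOn_recolor hnone₁ hvF hxF).weak
      ((hinv.good F (Or.inr hF)).weak_flipOn hinv.isPartial (Or.inl ⟨rfl, rfl⟩) hp hvβ hα hβ hvF)
  refine ⟨h.isPartial.recolor_some hadj hvα₁ hxα₁, ?_, ?_, _, ?_,
    h.path'.discReady (used := used) (K := K') h.isPartial (Or.inr ⟨rfl, rfl⟩) hαβ h.closed'
      (fun a ha => Or.inr ha) (by rintro (h | h); exacts [hxE h, hxp h]) hvα₁ hxα₁ hadj hnone₁ hnd
      hdisj' (fun u hu huK => h.full u hu (hcov' huK)) rfl ?_⟩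
  · rw [colorCount_recolor_some_none hadj hnone₁, colorCount_flipOn_none]
  · exact sameCounts_flipOn.trans (sameCounts_recolor (Or.inl rfl) hnone₁)
  · omega
  · rw [hK']
    split_ifs with hlt
    · exact hweak
    · rintro F (rfl | hF)
      · refine Fan.Good.weak (F := .ufan v ((L.erase w).erase x))
          ⟨⟨not_lt.1 hlt, fun y hy => ?_, ?_⟩, fun ζ hζ => ?_⟩ _
        · have hyL := hsub hy
          obtain ⟨k₁, k₂, k₃⟩ := hleaf y hyL
          have hyx : y ≠ x := Finset.ne_of_mem_erase hy
          have hyw : y ≠ w := Finset.ne_of_mem_erase (Finset.mem_of_mem_erase hy)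
          refine ⟨k₁, ?_, ?_⟩
          · rw [recolor_of_ne (mk_ne_mk hyx)]
            exact flipOn_eq_none.2 k₂
          · rwa [missing_recolor_some_of_ne hnone₁ k₁.ne' hyx,
              missing_flipOn_of_not_mem h.closed (h.not_mem y k₃ hyw)]
        · rw [mem_missing_recolor_some hnone₁]
          simp
        · rw [mem_missing_recolor_some hnone₁, mem_missing_flipOn_of_ne h.closed v
            (by rintro rfl; exact hα hζ) (by rintro rfl; exact hβ hζ)]
          exact fun hm => hproc ζ hζ hm.1
      · exact hweak F hF

/-- At the start nothing is explored, so the budget for paths is 10 for each vertex with `β`. Every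
activation takes at least one vertex out of the cover, which releases 200 units for the constant
costs. -/
theorem wp_activationStage (hαβ : α ≠ β) (hα : α ∉ used) (hβ : β ∉ used) {t : ℕ}
    {Q : Unit → ℕ → State V d → Prop} (hc : IsPartialEdgeColoring G c)
    (hK : K.PairwiseDisjoint Fan.verts) (hgood : ∀ F ∈ K, F.Good G c α used)
    (ht : 10 * (present c β).ncard + 200 * (cover K).ncard + 5 ≤ t)
    (hQ : ∀ c' K' t', IsPartialEdgeColoring G c' → K'.PairwiseDisjoint Fan.verts →
      (∀ F ∈ K', F.Good G c' α (insert β used)) →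
      t + 200 * (cover K').ncard ≤ t' + 10 * (present c β).ncard + 200 * (cover K).ncard + 5 →
      7 * colorCount G c' none + (tok K).ncard ≤ 7 * colorCount G c none + (tok K').ncard →
      SameCounts G α β c c' → Q () t' ⟨c', K', S⟩) :
    wp (activationStage G α β) t ⟨c, K, S⟩ Q := by
  refine wp_loop (fun _ t' s => ∃ E, StageInv G s.color α β used s.coll E ∧ s.pending = S ∧
    t + potential s.color β s.coll E ≤ t' + potential c β K ∅ ∧
    7 * colorCount G s.color none + (tok K).ncard ≤ 7 * colorCount G c none + (tok s.coll).ncard ∧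
    SameCounts G α β c s.color) ?_ ?_
  · exact ⟨∅, ⟨hc, hK, fun u hu => hu.elim, fun u hu => hu.elim, hgood⟩, rfl, le_rfl, le_rfl,
      fun _ _ _ => rfl⟩
  rintro ⟨⟩ t₁ ⟨c₁, K₁, S₁⟩ ⟨E, hinv, hS, h₁, h₂, h₃⟩
  dsimp only at hinv hS h₁ h₂ h₃
  subst hS
  have hp₀ : potential c β K ∅ = 10 * (present c β).ncard + 200 * (cover K).ncard := by
    rw [potential, Set.sdiff_empty]
  -- This is where the 7 comes from: the activated fan loses at most three tokens (a u-fan with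
  -- three leaves may be discarded entirely), and disconnecting costs at most four.
  have next : ∀ {c₂ K₂ n m v t₂}, colorCount G c₂ none + 1 = colorCount G c₁ none →
      SameCounts G α β c₁ c₂ → n + m ≤ 10 * (present c₁ β \ E).ncard + 60 →
      DiscReady G c₂ α β used K₂ v m → (tok K₁).ncard ≤ (tok K₂).ncard + 3 →
      t₁ + 200 * (cover K₂).ncard + 90 ≤ t₂ + n + 200 * (cover K₁).ncard →
      wp (do disconnectVertex G α β v; return Sum.inl () : Prog (State V d) (Unit ⊕ Unit)) t₂
        ⟨c₂, K₂, S₁⟩ (fun r t' s => Sum.elim (fun _ => ∃ E, StageInv G s.color α β used s.coll E ∧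
          s.pending = S₁ ∧ t + potential s.color β s.coll E ≤ t' + potential c β K ∅ ∧
          7 * colorCount G s.color none + (tok K).ncard ≤
            7 * colorCount G c none + (tok s.coll).ncard ∧
          SameCounts G α β c s.color) (fun a => Q a t' s) r) := by
    intro c₂ K₂ n m v t₂ k₁ k₂ k₃ k₄ k₅ k₆
    rw [hp₀, potential] at h₁
    refine wp_bind (wp_disconnectVertex_of_ready hαβ hα hβ k₄ (by omega) ?_)
    intro c₃ K₃ X₃ t₃ m₁ m₂ m₃ m₄
    refine wp_pure ⟨X₃, m₁, rfl, ?_, by dsimp only; omega, (h₃.trans k₂).trans m₄⟩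
    dsimp only
    rw [hp₀]
    omega
  have hpot : potential c₁ β K₁ E = 10 * (present c₁ β \ E).ncard + 200 * (cover K₁).ncard := rfl
  refine ⟨by omega, wp_bind (wp_pickStageFan (by omega) ?_ ?_)⟩
  · rintro F ⟨hF, hFβ⟩
    obtain ⟨K₀, rfl, hK₀, hd⟩ := exists_eq_insert hinv.disjoint hF
    have hcov := ncard_cover_insert hd
    have htok := ncard_tok_insert hd
    have hdiff := insert_diff_of_disjoint_cover hd
    have hsize := (hinv.good _ hF).ncard_verts
    cases F with
    | cfan v xs b =>
      obtain rfl : b = β := hFβ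
      simp only [Fan.size] at hsize
      rw [ncard_tok_cfan] at htok
      refine wp_bind (wp_activateCFan hαβ hα hβ hinv hK₀ hd (by omega) ?_)
      rintro c₂ n t₂ ⟨k₁, k₂, k₃, m, k₄, k₅⟩ ht₂
      refine wp_bind (wp_removeFan (by simp only [Fan.size]; omega) ?_)
      simp only [Fan.size, hdiff]
      exact next k₂ k₃ k₄ k₅ (by omega) (by omega)
    | ufan v L =>
      simp only [Fan.size] at hsize
      rw [ncard_tok_ufan] at htok
      refine wp_bind (wp_activateUFan hαβ hα hβ hinv hK₀ hd hFβ (by omega) ?_)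
      rintro c₂ L' K' n t₂ hsub hlt hle rfl ⟨k₁, k₂, k₃, m, k₄, k₅⟩ ht₂
      split_ifs at k₅ ⊢ with hL'
      · refine wp_bind (wp_removeFan (by simp only [Fan.size]; omega) ?_)
        simp only [Fan.size, hdiff]
        exact next k₂ k₃ k₄ k₅ (by omega) (by omega)
      · refine wp_bind (wp_changeLeaves (by omega) ?_)
        simp only [hdiff]
        have hd' : ∀ u ∈ (Fan.ufan v L' : Fan V d).verts, u ∉ cover K₀ := by
          rintro u (rfl | hu)
          · exact hd _ (Or.inl rfl)
          · exact hd u (Or.inr (hsub hu))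
        have hcov' := ncard_cover_insert hd'
        have htok' := ncard_tok_insert hd'
        rw [ncard_tok_ufan] at htok'
        have hvL' : v ∉ L' := fun h => (hinv.good _ hF).1.center_not_mem (hsub h)
        rw [ncard_verts_ufan hvL'] at hcov'
        exact next k₂ k₃ k₄ k₅ (by omega) (by omega)
  · intro hQβ
    refine wp_pure (hQ c₁ K₁ _ hinv.isPartial hinv.disjoint (fun F hF => ?_) (by omega) h₂ h₃)
    -- An empty `Q` says exactly that every remaining fan also satisfies the conditions for the
    -- color `β`.
    have hnot : F ∉ stageFans ⟨c₁, K₁, S₁⟩ β := hQβ ▸ Set.notMem_empty F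
    have hgood := hinv.good F hF
    cases F with
    | cfan v xs b =>
      refine ⟨hgood.1, hgood.2.1, ?_⟩
      rintro (rfl | hb)
      · exact hnot ⟨hF, rfl⟩
      · exact hgood.2.2 hb
    | ufan v L =>
      refine ⟨hgood.1, ?_⟩
      rintro ζ (rfl | hζ) hm
      · exact hnot ⟨hF, hm⟩
      · exact hgood.2 ζ hζ hm

end ActivationStage

/-! ### Counting -/

section Counting

variable {V : Type} [Fintype V] {d : ℕ} {G : SimpleGraph V} {c : Sym2 V → Option (Fin (d + 1))}

theorem ncard_present_le (hc : IsPartialEdgeColoring G c) (β : Fin (d + 1)) :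
    (present c β).ncard ≤ 2 * colorCount G c (some β) := by
  classical
  have h₁ : present c β ⊆
      (({e | e ∈ G.edgeSet ∧ c e = some β}.toFinset.biUnion Sym2.toFinset : Finset V) : Set V) := by
    intro v hv
    obtain ⟨u, hu⟩ := not_mem_missing.1 hv
    simp only [Finset.coe_biUnion, Set.mem_iUnion, Finset.mem_coe, Set.mem_toFinset]
    exact ⟨s(v, u), ⟨(SimpleGraph.mem_edgeSet G).2 (hc.adj hu), hu⟩, by simp⟩
  refine (Set.ncard_le_ncard h₁ (Set.toFinite _)).trans ?_
  rw [Set.ncard_coe_finset]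
  refine (Finset.card_biUnion_le_card_mul _ _ 2 fun e _ => ?_).trans ?_
  · rw [Sym2.card_toFinset]
    split_ifs <;> omega
  · rw [colorCount, Set.ncard_eq_toFinset_card', mul_comm]

theorem sum_colorCount_le [DecidableRel G.Adj] :
    ∑ γ, colorCount G c (some γ) ≤ G.edgeFinset.card := by
  classical
  rw [Finset.card_eq_sum_card_fiberwise (f := c) (t := Finset.univ) (fun _ _ => Finset.mem_univ _),
    Fintype.sum_option]
  refine le_add_of_nonneg_of_le (Nat.zero_le _) (Finset.sum_le_sum fun γ _ => ?_)
  rw [colorCount, ← Set.ncard_coe_finset]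
  refine (congrArg Set.ncard ?_).le
  ext e
  simp

theorem ncard_uncoloredEdges_le [DecidableRel G.Adj] :
    (uncoloredEdges G c).ncard ≤ ∑ v, {u | G.Adj v u ∧ c s(v, u) = none}.ncard := by
  classical
  have h₁ : uncoloredEdges G c ⊆ ((Finset.univ.biUnion fun v =>
      {u | G.Adj v u ∧ c s(v, u) = none}.toFinset.image fun u => s(v, u) : Finset (Sym2 V)) :
      Set (Sym2 V)) := by
    intro e he
    induction e with
    | _ v u =>
      simp only [Finset.coe_biUnion, Set.mem_iUnion, Finset.mem_coe, Finset.mem_univ,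
        Finset.mem_image, Set.mem_toFinset]
      exact ⟨v, trivial, u, ⟨(SimpleGraph.mem_edgeSet G).1 he.1, he.2⟩, rfl⟩
  refine (Set.ncard_le_ncard h₁ (Set.toFinite _)).trans ?_
  rw [Set.ncard_coe_finset]
  refine Finset.card_biUnion_le.trans (Finset.sum_le_sum fun v _ => Finset.card_image_le.trans ?_)
  rw [Set.ncard_eq_toFinset_card']

/-- Double counting of pairs of a color and an incomplete vertex missing it: each incomplete vertex
is counted once for every missing color, and these outnumber its uncolored edges. -/
theorem ncard_uncoloredEdges_le_sum [DecidableRel G.Adj] (hc : IsPartialEdgeColoring G c)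
    (hdeg : ∀ v, G.degree v ≤ d) :
    (uncoloredEdges G c).ncard ≤ ∑ β, (incompleteMissing G c β).ncard := by
  classical
  have h₁ : ∑ β, (incompleteMissing G c β).ncard =
      ∑ v, {β | v ∈ incompleteMissing G c β}.ncard := by
    have := Finset.sum_card_bipartiteAbove_eq_sum_card_bipartiteBelow
      (s := (Finset.univ : Finset (Fin (d + 1)))) (t := (Finset.univ : Finset V))
      (fun β v => v ∈ incompleteMissing G c β)
    convert this using 2 with β _ v _
    · rw [← Set.ncard_coe_finset]
      congr 1; ext; simp [Finset.bipartiteAbove]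
    · rw [← Set.ncard_coe_finset]
      congr 1; ext; simp [Finset.bipartiteBelow]
  rw [h₁]
  refine ncard_uncoloredEdges_le.trans (Finset.sum_le_sum fun v _ => ?_)
  by_cases hv : ∃ u, G.Adj v u ∧ c s(v, u) = none
  · have h₂ : {β | v ∈ incompleteMissing G c β} = missing c v := by
      ext β
      exact and_iff_right hv
    rw [h₂]
    exact (ncard_missing_gt hc hdeg v).le
  · have h₂ : {u | G.Adj v u ∧ c s(v, u) = none} = ∅ :=
      Set.eq_empty_of_forall_notMem fun u hu => hv ⟨u, hu⟩
    rw [h₂, Set.ncard_empty]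
    exact Nat.zero_le _

theorem card_le_two_mul_card_edgeFinset [DecidableRel G.Adj] (hpos : ∀ v, 0 < G.degree v) :
    Fintype.card V ≤ 2 * G.edgeFinset.card := by
  rw [← G.sum_degrees_eq_twice_card_edges, Fintype.card_eq_sum_ones]
  exact Finset.sum_le_sum fun v _ => hpos v

theorem degree_le_card_edgeFinset [DecidableRel G.Adj] (v : V) :
    G.degree v ≤ G.edgeFinset.card := by
  classical
  rw [← G.card_incidenceFinset_eq_degree]
  exact Finset.card_le_card (G.incidenceFinset_subset v)

end Counting

theorem BuildInv.isCollection {V : Type} {d : ℕ} {G : SimpleGraph V}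
    {c : Sym2 V → Option (Fin (d + 1))} {α : Fin (d + 1)} {K : Set (Fan V d)} {S : Set V}
    (h : BuildInv G c α K S) : IsCollection G c α K := by
  refine ⟨h.disjoint, fun F hF => ?_⟩
  have hg := h.good F hF
  cases F with
  | cfan v xs b => exact hg.1
  | ufan v L => exact hg.1

/-! ### All stages together, and the complete procedure -/

section ActivateCollection

variable {V : Type} [Fintype V] [DecidableEq V] {d : ℕ} {G : SimpleGraph V} [DecidableRel G.Adj]
  {c c' : Sym2 V → Option (Fin (d + 1))}
  {α : Fin (d + 1)} {K : Set (Fan V d)} {S : Set V}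

theorem wp_setUpStages {s : State V d} {t : ℕ} {Q : Unit → ℕ → State V d → Prop}
    (ht : 3 * Fintype.card V + ∑ v, G.degree v ≤ t)
    (hQ : ∀ t', t ≤ t' + 3 * Fintype.card V + ∑ v, G.degree v → Q () t' s) :
    wp (setUpStages G) t s Q := by
  have hsum : ((vertexList V).map fun v => G.degree v + 3).sum =
      ∑ v, G.degree v + 3 * Fintype.card V := by
    rw [sum_vertexList, Finset.sum_add_distrib, Finset.sum_const, Finset.card_univ, smul_eq_mul,
      mul_comm]
  refine wp_forList (fun l _ t' s' => s' = s ∧ (l.map fun v => G.degree v + 3).sum ≤ t' ∧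
    t + (l.map fun v => G.degree v + 3).sum ≤
      t' + ((vertexList V).map fun v => G.degree v + 3).sum) ?_ ?_ _ _ _ _
    ⟨rfl, by omega, le_rfl⟩
  · rintro v l ⟨⟩ t' s' ⟨rfl, h₁, h₂⟩
    simp only [List.map_cons, List.sum_cons] at h₁ h₂
    refine ⟨by omega, wp_bind (wp_fanContaining (by omega) ?_ ?_)⟩
    · intro F _ _
      dsimp only
      split_ifs
      · exact wp_spend (by omega) ⟨rfl, by omega, by omega⟩
      · exact wp_pure ⟨rfl, by omega, by omega⟩
    · intro _
      exact wp_pure ⟨rfl, by omega, by omega⟩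
  · rintro ⟨⟩ t' s' ⟨rfl, h₁, h₂⟩
    simp only [List.map_nil, List.sum_nil] at h₁ h₂
    exact hQ _ (by omega)

/-- With at most `2m` vertices, 428 is composed of 8 for setting up the stages, 20 for all paths,
and 400 for the covered vertices. The 6 per color is the overhead of 5 of a stage and the tick of
the list loop. -/
theorem wp_activateCollection (hdeg : ∀ v, G.degree v ≤ d) (hpos : ∀ v, 0 < G.degree v)
    (hc : IsPartialEdgeColoring G c) (hK : K.PairwiseDisjoint Fan.verts)
    (hgood : ∀ F ∈ K, F.Good G c α ∅) {t : ℕ} {Q : Unit → ℕ → State V d → Prop}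
    (ht : 428 * G.edgeFinset.card + 6 * d ≤ t)
    (hQ : ∀ c' K' t', IsPartialEdgeColoring G c' →
      7 * colorCount G c' none + (tok K).ncard ≤ 7 * colorCount G c none → Q () t' ⟨c', K', S⟩) :
    wp (activateCollection G α) t ⟨c, K, S⟩ Q := by
  have hV := card_le_two_mul_card_edgeFinset hpos
  have hE := G.sum_degrees_eq_twice_card_edges
  have hcov : (cover K).ncard ≤ Fintype.card V := by
    rw [← Nat.card_eq_fintype_card]
    exact Set.ncard_le_card _
  refine wp_bind (wp_setUpStages (by omega) fun t₁ ht₁ => ?_)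
  refine wp_bind (wp_pick ?_ ?_)
  · exact ⟨(Finset.univ.erase α).toList, Finset.nodup_toList _, by simp⟩
  rintro stages ⟨hnd, hmem⟩
  have hsum : (stages.map fun γ => 20 * colorCount G c (some γ) + 6).sum ≤
      20 * G.edgeFinset.card + 6 * d := by
    have hset : stages.toFinset = Finset.univ.erase α := by
      ext γ
      simp [hmem γ]
    have hle := (Finset.sum_le_sum_of_subset (f := fun γ => colorCount G c (some γ))
      (Finset.erase_subset α Finset.univ)).trans (sum_colorCount_le (G := G))
    rw [← List.sum_toFinset _ hnd, hset, Finset.sum_add_distrib, ← Finset.mul_sum,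
      Finset.sum_const, Finset.card_erase_of_mem (Finset.mem_univ _), Finset.card_univ,
      Fintype.card_fin, smul_eq_mul, Nat.add_sub_cancel]
    omega
  refine wp_forList (fun l _ t' s => IsPartialEdgeColoring G s.color ∧
    s.coll.PairwiseDisjoint Fan.verts ∧
    (∀ F ∈ s.coll, F.Good G s.color α {γ | γ ≠ α ∧ γ ∉ l}) ∧ s.pending = S ∧ l.Nodup ∧ α ∉ l ∧
    (∀ γ ∈ l, colorCount G s.color (some γ) = colorCount G c (some γ)) ∧
    (l.map fun γ => 20 * colorCount G c (some γ) + 6).sum + 200 * (cover s.coll).ncard ≤ t' ∧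
    7 * colorCount G s.color none + (tok K).ncard ≤
      7 * colorCount G c none + (tok s.coll).ncard) ?_ ?_ _ _ _ _
    ⟨hc, hK, ?_, rfl, hnd, fun h => (hmem α).1 h rfl, fun _ _ => rfl, by dsimp only; omega, le_rfl⟩
  · rintro β l ⟨⟩ t' ⟨c', K', S'⟩ ⟨h₁, h₂, h₃, h₄, h₅, h₆, h₇, h₈, h₉⟩
    dsimp only at h₁ h₂ h₃ h₄ h₇ h₈ h₉
    subst h₄
    simp only [List.map_cons, List.sum_cons] at h₈
    rw [List.nodup_cons] at h₅
    rw [List.mem_cons, not_or] at h₆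
    have hpres := ncard_present_le h₁ β
    -- The earlier stages have not changed the size of the `β`-class, so the costs of the stages add
    -- up to a multiple of the number of edges.
    rw [h₇ β List.mem_cons_self] at hpres
    refine ⟨by omega, wp_activationStage h₆.1 (by simp) (by simp) h₁ h₂ h₃ (by omega) ?_⟩
    intro c'' K'' t'' k₁ k₂ k₃ k₄ k₅ k₆
    have hset : insert β {γ | γ ≠ α ∧ γ ∉ β :: l} = {γ | γ ≠ α ∧ γ ∉ l} := by
      ext γ
      simp only [Set.mem_insert_iff, Set.mem_ofPred_eq, List.mem_cons, not_or]
      constructor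
      · rintro (rfl | h)
        · exact ⟨fun h => h₆.1 h.symm, h₅.1⟩
        · exact ⟨h.1, h.2.2⟩
      · intro h
        by_cases hγ : γ = β
        · exact Or.inl hγ
        · exact Or.inr ⟨h.1, hγ, h.2⟩
    refine ⟨k₁, k₂, hset ▸ k₃, rfl, h₅.2, h₆.2, fun γ hγ => ?_, by dsimp only; omega,
      by dsimp only; omega⟩
    rw [← h₇ γ (List.mem_cons_of_mem _ hγ)]
    exact k₆ γ (fun h => h₆.2 (h ▸ hγ)) fun h => h₅.1 (h ▸ hγ)
  · rintro ⟨⟩ t' ⟨c', K', S'⟩ ⟨h₁, -, h₃, h₄, -, -, -, -, h₉⟩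
    dsimp only at h₁ h₃ h₄ h₉
    subst h₄
    -- All colors other than `α` are used. No color is left to prime a c-fan, and the center of a
    -- u-fan would have to have every color although its degree is at most `d`.
    have hemp : K' = ∅ := by
      refine Set.eq_empty_of_forall_notMem fun F hF => ?_
      have hg := h₃ F hF
      cases F with
      | cfan v xs b => exact hg.2.2 ⟨hg.2.1, List.not_mem_nil⟩
      | ufan v L =>
        obtain ⟨γ, hγ⟩ := missing_nonempty h₁ hdeg v
        refine hg.2 γ ⟨?_, List.not_mem_nil⟩ hγ
        rintro rfl
        exact hg.1.2.2 hγ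
    subst hemp
    have htok : tok (∅ : Set (Fan V d)) = ∅ := by
      ext; simp [tok]
    rw [htok, Set.ncard_empty] at h₉
    exact hQ _ _ _ h₁ h₉
  · have hset : {γ | γ ≠ α ∧ γ ∉ stages} = ∅ := by
      ext γ
      simp [hmem γ]
    rw [hset]
    exact hgood

/-- Step 1 contributes 16 and Step 2 contributes 130 to the factor 146, as the degrees sum to `2m`
and there are at most `2m` vertices. -/
theorem wp_chooseAndBuild (hdeg : ∀ v, G.degree v ≤ d) (hpos : ∀ v, 0 < G.degree v)
    (hc : IsPartialEdgeColoring G c) {t : ℕ} {Q : Fin (d + 1) → ℕ → State V d → Prop}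
    (ht : 146 * G.edgeFinset.card + d + 3 ≤ t)
    (hQ : ∀ α c' K' t', t ≤ t' + 146 * G.edgeFinset.card + d + 3 →
      (∀ β, (incompleteMissing G c β).ncard ≤ (incompleteMissing G c α).ncard) →
      BuildInv G c' α K' ∅ →
      (incompleteMissing G c α).ncard + 7 * colorCount G c' none ≤
        (tok K').ncard + 7 * colorCount G c none → Q α t' ⟨c', K', ∅⟩) :
    wp (chooseAndBuild G) t ⟨c, K, S⟩ Q := by
  have hV := card_le_two_mul_card_edgeFinset hpos
  have hE := G.sum_degrees_eq_twice_card_edges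
  refine wp_bind (wp_chooseColor hc (by omega) fun α t₁ ht₁ hmax => ?_)
  refine wp_bind (wp_buildCollection hdeg hpos hc (by omega) fun c' K' t₂ ht₂ hinv hcount => ?_)
  exact wp_pure (hQ α c' K' t₂ (by omega) hmax hinv hcount)

theorem wp_colorMany (hdeg : ∀ v, G.degree v ≤ d) (hpos : ∀ v, 0 < G.degree v)
    (hc : IsPartialEdgeColoring G c) {t : ℕ} (ht : 574 * G.edgeFinset.card + 7 * d + 3 ≤ t) :
    wp (colorMany G) t ⟨c, K, S⟩ (fun _ _ s => IsPartialEdgeColoring G s.color ∧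
      (uncoloredEdges G c).ncard + 7 * (d + 1) * (uncoloredEdges G s.color).ncard ≤
        7 * (d + 1) * (uncoloredEdges G c).ncard) := by
  refine wp_bind (wp_chooseAndBuild hdeg hpos hc (by omega) fun α c₂ K₂ t₂ ht₂ hmax hinv hcount => ?_)
  refine wp_activateCollection hdeg hpos hinv.isPartial hinv.disjoint hinv.good (by omega) ?_
  intro c₃ K₃ t₃ hc₃ hcount₃
  refine ⟨hc₃, ?_⟩
  rw [colorCount_none, colorCount_none] at hcount₃ hcount
  -- The chosen color is at least as good as the average over the `d + 1` colors.
  have h₁ : (uncoloredEdges G c).ncard ≤ (d + 1) * (incompleteMissing G c α).ncard := by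
    refine (ncard_uncoloredEdges_le_sum hc hdeg).trans
      ((Finset.sum_le_card_nsmul _ _ _ fun β _ => hmax β).trans ?_)
    simp
  have h₂ : (incompleteMissing G c α).ncard + 7 * (uncoloredEdges G c₃).ncard ≤
      7 * (uncoloredEdges G c).ncard := by omega
  have h₃ := Nat.mul_le_mul_left (d + 1) h₂
  rw [Nat.mul_add] at h₃
  dsimp only
  calc _ ≤ (d + 1) * (incompleteMissing G c α).ncard +
        7 * (d + 1) * (uncoloredEdges G c₃).ncard := Nat.add_le_add_right h₁ _
    _ = (d + 1) * (incompleteMissing G c α).ncard +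
        (d + 1) * (7 * (uncoloredEdges G c₃).ncard) := by ring
    _ ≤ (d + 1) * (7 * (uncoloredEdges G c).ncard) := h₃
    _ = _ := by ring

end ActivateCollection

end EdgeColoring

end

theorem mainTheorem3 :
    ∃ κ : ℝ, 0 < κ ∧ ∃ C : ℕ,
      ∀ (V : Type) [Fintype V] [DecidableEq V] [Nonempty V]
        (G : SimpleGraph V) [DecidableRel G.Adj] (d : ℕ)
        (c : Sym2 V → Option (Fin (d + 1))),
        G.maxDegree = d → (∀ v, 0 < G.degree v) →
        EdgeColoring.IsPartialEdgeColoring G c →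
        (∀ o ∈ (EdgeColoring.chooseAndBuild (d := d) G).outcomes
            (C * G.edgeFinset.card) ⟨c, ∅, ∅⟩,
          ∃ α t s, o = EdgeColoring.Outcome.finished α t s ∧
            (∀ β, (EdgeColoring.incompleteMissing G c β).ncard ≤
              (EdgeColoring.incompleteMissing G c α).ncard) ∧
            EdgeColoring.IsPartialEdgeColoring G s.color ∧
            EdgeColoring.IsCollection G s.color α s.coll) ∧
        (∀ o ∈ (EdgeColoring.colorMany (d := d) G).outcomes
            (C * G.edgeFinset.card) ⟨c, ∅, ∅⟩,
          ∃ t s, o = EdgeColoring.Outcome.finished () t s ∧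
            EdgeColoring.IsPartialEdgeColoring G s.color ∧
            κ * ((EdgeColoring.uncoloredEdges G c).ncard : ℝ) / (d : ℝ) ≤
              ((EdgeColoring.uncoloredEdges G c).ncard : ℝ) -
                ((EdgeColoring.uncoloredEdges G s.color).ncard : ℝ)) := by
  -- At least `ℓ / (7 (d + 1))` edges get colored, and `d + 1 ≤ 2d`. Since `d ≤ m` and `m ≥ 1`, the
  -- budget `574 m + 7 d + 3` is at most `600 m`.
  refine ⟨1 / 14, by norm_num, 600, fun V _ _ _ G _ d c hd hpos hc => ?_⟩
  have hdeg : ∀ v, G.degree v ≤ d := fun v => hd ▸ G.degree_le_maxDegree v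
  obtain ⟨v₀, hv₀⟩ := G.exists_maximal_degree_vertex
  have hd₀ : 1 ≤ d := (hpos v₀).trans_le (hdeg v₀)
  have hdm : d ≤ G.edgeFinset.card := by
    rw [← hd, hv₀]
    exact EdgeColoring.degree_le_card_edgeFinset v₀
  refine ⟨fun o ho => ?_, fun o ho => ?_⟩
  · have h := EdgeColoring.wp_chooseAndBuild (K := ∅) (S := ∅) hdeg hpos hc
      (t := 600 * G.edgeFinset.card)
      (Q := fun α _ s => (∀ β, (EdgeColoring.incompleteMissing G c β).ncard ≤
          (EdgeColoring.incompleteMissing G c α).ncard) ∧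
        EdgeColoring.IsPartialEdgeColoring G s.color ∧
        EdgeColoring.IsCollection G s.color α s.coll) (by omega)
      (fun α c' K' t' _ hmax hinv _ => ⟨hmax, hinv.isPartial, hinv.isCollection⟩)
    obtain ⟨α, t, s, rfl, -, hQ⟩ := h o ho
    exact ⟨α, t, s, rfl, hQ⟩
  · obtain ⟨⟨⟩, t, s, rfl, -, hpart, hcount⟩ := EdgeColoring.wp_colorMany (K := ∅) (S := ∅)
      hdeg hpos hc (t := 600 * G.edgeFinset.card) (by omega) o ho
    refine ⟨t, s, rfl, hpart, ?_⟩
    have hcount' : ((EdgeColoring.uncoloredEdges G c).ncard : ℝ) +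
        7 * (d + 1) * ((EdgeColoring.uncoloredEdges G s.color).ncard : ℝ) ≤
        7 * (d + 1) * ((EdgeColoring.uncoloredEdges G c).ncard : ℝ) := by exact_mod_cast hcount
    have hd₁ : (1 : ℝ) ≤ d := by exact_mod_cast hd₀
    set a : ℝ := ((EdgeColoring.uncoloredEdges G c).ncard : ℝ) with ha
    set b : ℝ := ((EdgeColoring.uncoloredEdges G s.color).ncard : ℝ) with hb
    have ha₀ : 0 ≤ a := Nat.cast_nonneg _
    have hab : 0 ≤ a - b := by
      by_contra hcon
      have := mul_pos (by linarith : (0 : ℝ) < 7 * (d + 1)) (by linarith : 0 < b - a)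
      linarith
    rw [div_le_iff₀ (by linarith)]
    -- This is `7 (d + 1) (a - b) ≤ 14 d (a - b)` in disguise; it turns the bound with `d + 1` into
    -- the one with `d`.
    have := mul_nonneg hab (by linarith : (0 : ℝ) ≤ d - 1)
    linarith
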